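/- Let $L$ be an even lattice of signature $(p,q)$, that is, a free abelian group of finite rank with a nondegenerate symmetric bilinear form $(\cdot,\cdot)\colon L\times L\to\mathbb{Z}$ such that $(l,l)\in 2\mathbb{Z}$ for all $l\in L$. Put $\sigma(L)=p-q$, $A_L=L^\vee/L$, and let $\rho_L$ be the Weil representation of $\mathrm{Mp}_2(\mathbb{Z})$ on $\mathbb{C}A_L$ (basis $\mathbf e_\lambda$), given on the generators $T=\left(\begin{pmatrix}1&1\\0&1\end{pmatrix},1\right)$, $S=\left(\begin{pmatrix}0&-1\\1&0\end{pmatrix},\sqrt\tau\right)$ by $$\rho_L(T)\mathbf e_\lambda=e((\lambda,\lambda)/2)\,\mathbf e_\lambda,\qquad \rho_L(S)\mathbf e_\lambda=\frac{e(-\sigma(L)/8)}{\sqrt{|A_L|}}\sum_{\mu\in A_L}e(-(\lambda,\mu))\,\mathbf e_\mu ,\qquad e(x)=\exp(2\pi i x).$$ Let $M^!(L)$ be the space of holomorphic functions $f\colon\mathbb{H}\to\mathbb{C}A_L$, meromorphic at the cusp, with $f(M\tau)=\phi(\tau)^{\sigma(L)}\rho_L(M,\phi)f(\tau)$ for all $(M,\phi)\in\mathrm{Mp}_2(\mathbb{Z})$,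 and let $M^!$ be the ring of scalar-valued weakly holomorphic modular forms of weight $0$ for $\mathrm{SL}_2(\mathbb{Z})$. For even lattices $L_1\subset L_2$ with $L_2/L_1$ finite, let $\pi\colon L_2^\vee/L_1\to A_{L_2}$ be the projection, where $L_2^\vee/L_1\subset A_{L_1}$. The pullback $\uparrow\colon\mathbb{C}A_{L_2}\to\mathbb{C}A_{L_1}$ sends $\mathbf e_\lambda$ to $\sum_{\mu\in\pi^{-1}(\lambda)}\mathbf e_\mu$, and the pushforward $\downarrow\colon\mathbb{C}A_{L_1}\to\mathbb{C}A_{L_2}$ sends $\mathbf e_\mu$ to $\mathbf e_{\pi(\mu)}$ if $\mu\in L_2^\vee/L_1$ and to $0$ otherwise. For a negative definite even lattice $N$ let $\Theta_{N^+}(\tau)=\sum_{l\in N^\vee}e(-(l,l)\tau/2)\,\mathbf e_{[l]}^\vee$, and let $\langle\cdot,\cdot\rangle$ be the contraction with $\mathbf e_\lambda,\mathbf e_\mu^\vee$ dual bases. Let $I$ be a maximal isotropic sublattice of $L$, meaning isotropic, primitive in $L$ and of rank $p$. Put $K=(I^\perp\cap L)/I$ (a negative definite even lattice), $I^*=I_{\mathbb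 Q}\cap L^\vee$ and $L^*=L+I^*$. Identify $A_{L^*}=A_K$ by sending the class of $x\in (L^*)^\vee\cap I^\perp$ to the class of $x$ modulo $I_{\mathbb Q}$, and let $\downarrow^L_K\colon\mathbb{C}A_L\to\mathbb{C}A_{L^*}=\mathbb{C}A_K$ be the pushforward. For $f\in M^!(L)$ put $\xi(f)=\langle f\downarrow^L_K,\Theta_{K^+}\rangle\in M^!$. The $\Theta$-product on $M^!(L)$ is $f*_I g=\xi(f)\cdot g$, and $\Theta^\perp(L)=\{f\in M^!(L): f*_Ig=0\text{ for all }g\in M^!(L)\}$ is its left annihilator. Let $L'\subset L$ be a sublattice of signature $(p,q')$ (not necessarily primitive) such that $I_{\mathbb Q}\subset L'_{\mathbb Q}$, and put $I'=I\cap L'$, a maximal isotropic sublattice of $L'$. Define $\xi'$, $*_{I'}$ and $\Theta^\perp(L')$ by means of $(L',I')$. With $N=(L')^\perp\cap L$, the quasi-pullback of $f\in M^!(L)$ is $f|_{L'}=\langle f\uparrow_L^{L'\oplus N},\Theta_{N^+}\rangle\in M^!(L')$, where $\mathbb{C}A_{L'\oplus N}=\mathbb{C}A_{L'}\otimes\mathbb{C}A_N$.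 Then $\xi$, $\xi'$, $*_I$, $*_{I'}$ and $|_{L'}$ are well defined as maps into the stated spaces, and $$|_{L'}^{-1}\bigl(\Theta^\perp(L')\bigr)=\Theta^\perp(L);\qquad\text{in particular}\quad \ker(|_{L'})\subset\Theta^\perp(L).$$ Moreover $M^!$ is the polynomial ring $\mathbb{C}[j]$ in $j=E_4^3/\Delta=q^{-1}+744+\cdots$; the maps $\xi$ and $\xi'$ induce injective multiplicative $\mathbb{C}$-linear maps $M^!(L)/\Theta^\perp(L)\to M^!$ and $M^!(L')/\Theta^\perp(L')\to M^!$ whose images $\mathfrak a$ and $\mathfrak a'$ are ideals of $M^!=\mathbb{C}[j]$; and under these identifications the map $M^!(L)/\Theta^\perp(L)\to M^!(L')/\Theta^\perp(L')$ induced by $|I/I'|^{-1}\cdot|_{L'}$ is the inclusion of ideals $\mathfrak a\subset\mathfrak a'$. -/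

import Mathlib

open scoped Manifold MatrixGroups
open UpperHalfPlane

noncomputable section

namespace ThetaProduct

/-! ### Even lattices in a rational bilinear space

A lattice is a finitely generated `ℤ`-submodule `L` of a `ℚ`-vector space `V` with a symmetric
bilinear form `b`; `L_ℚ` is `Submodule.span ℚ L`. -/

section Lattice

variable {V : Type*} [AddCommGroup V] [Module ℚ V]

/-- The rational span `L_ℚ` of a lattice. -/
abbrev rat (L : Submodule ℤ V) : Submodule ℚ V := Submodule.span ℚ (L : Set V)

/-- `L` is an even lattice for `b`: finitely generated, integral, even and nondegenerate.
(The symmetry of `b` is stated separately.) -/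
structure IsEvenLattice (b : LinearMap.BilinForm ℚ V) (L : Submodule ℤ V) : Prop where
  fg : L.FG
  integral : ∀ x ∈ L, ∀ y ∈ L, ∃ n : ℤ, b x y = n
  even : ∀ x ∈ L, ∃ n : ℤ, b x x = 2 * n
  nondegenerate : ∀ x ∈ L, (∀ y ∈ L, b x y = 0) → x = 0

/-- The quadratic form `x ↦ (x, x)` on `L_ℚ`. -/
def ratForm (b : LinearMap.BilinForm ℚ V) (L : Submodule ℤ V) : QuadraticForm ℚ (rat L) :=
  LinearMap.BilinMap.toQuadraticMap (b.restrict (rat L))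

/-- `L` has signature `(p, q)`. -/
def HasSignature (b : LinearMap.BilinForm ℚ V) (L : Submodule ℤ V) (p q : ℕ) : Prop :=
  sigPos (ratForm b L) = p ∧ sigNeg (ratForm b L) = q

/-- `σ(L) = p - q` for `L` of signature `(p, q)`. -/
def sigma (b : LinearMap.BilinForm ℚ V) (L : Submodule ℤ V) : ℤ :=
  sigPos (ratForm b L) - sigNeg (ratForm b L)

/-- The dual lattice `L^∨ ⊂ L_ℚ`. -/
def dual (b : LinearMap.BilinForm ℚ V) (L : Submodule ℤ V) : Submodule ℤ V :=
  (rat L).restrictScalars ℤ ⊓ b.dualSubmodule L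

/-- The discriminant group `A_L = L^∨ / L`, as a subgroup of `V / L`. -/
def disc (b : LinearMap.BilinForm ℚ V) (L : Submodule ℤ V) : Submodule ℤ (V ⧸ L) :=
  (dual b L).map L.mkQ

/-- The rational subspace orthogonal to a subset `S` (both conditions agree for symmetric `b`). -/
def perp (b : LinearMap.BilinForm ℚ V) (S : Set V) : Submodule ℚ V where
  carrier := {x | ∀ y ∈ S, b x y = 0 ∧ b y x = 0}
  add_mem' := by
    intro x x' hx hx' y hy
    simp [hx y hy, hx' y hy]
  zero_mem' := by simp
  smul_mem' := by
    intro c x hx y hy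
    simp [hx y hy]

/-- The orthogonal complement `(L')^⊥ ∩ L` of `L'` in `L`. -/
def orthIn (b : LinearMap.BilinForm ℚ V) (L L' : Submodule ℤ V) : Submodule ℤ V :=
  L ⊓ (perp b (L' : Set V)).restrictScalars ℤ

/-- `I` is a maximal isotropic sublattice of the lattice `L` of signature `(p, q)`, in the sense:
isotropic, primitive in `L`, and of rank `p`. -/
structure IsMaximalIsotropic (b : LinearMap.BilinForm ℚ V) (L : Submodule ℤ V) (p : ℕ)
    (I : Submodule ℤ V) : Prop where
  le : I ≤ L
  isotropic : ∀ x ∈ I, ∀ y ∈ I, b x y = 0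
  primitive : ∀ x ∈ L, ∀ n : ℤ, n ≠ 0 → n • x ∈ I → x ∈ I
  rank : Module.finrank ℤ I = p

end Lattice

/-! ### The lattice `K = (I^⊥ ∩ L) / I` and the overlattice `L^* = ⟨L, I^*⟩` -/

section Reduction

variable {V : Type*} [AddCommGroup V] [Module ℚ V]

/-- The rational space `I^⊥ ∩ L_ℚ`. -/
def ratPerp (b : LinearMap.BilinForm ℚ V) (L I : Submodule ℤ V) : Submodule ℚ V :=
  rat L ⊓ perp b (I : Set V)

/-- `I_ℚ` as a subspace of `I^⊥ ∩ L_ℚ`. -/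
def ratIn (b : LinearMap.BilinForm ℚ V) (L I : Submodule ℤ V) : Submodule ℚ (ratPerp b L I) :=
  (rat I).submoduleOf (ratPerp b L I)

/-- The rational space `K_ℚ = (I^⊥ ∩ L_ℚ) / I_ℚ`. -/
abbrev redSpace (b : LinearMap.BilinForm ℚ V) (L I : Submodule ℤ V) : Type _ :=
  ratPerp b L I ⧸ ratIn b L I

theorem perp_rat (b : LinearMap.BilinForm ℚ V) (L I : Submodule ℤ V) (x : ratPerp b L I)
    (y : V) (hy : y ∈ rat I) : b x y = 0 ∧ b y x = 0 := by
  induction hy using Submodule.span_induction with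
  | mem y hy => exact x.2.2 y hy
  | zero => simp
  | add y z _ _ h h' => simp [h, h']
  | smul c y _ h => simp [h]

/-- The bilinear form on `(I^⊥ ∩ L_ℚ) / I_ℚ` induced by `b`. -/
def redForm (b : LinearMap.BilinForm ℚ V) (L I : Submodule ℤ V) :
    LinearMap.BilinForm ℚ (redSpace b L I) :=
  (ratIn b L I).liftQ
    (LinearMap.flip ((ratIn b L I).liftQ (LinearMap.flip (b.restrict (ratPerp b L I)))
      (by
        intro y hy
        ext x
        exact (perp_rat b L I x y hy).1)))
    (by
      intro x hx
      ext y
      exact (perp_rat b L I y x hx).2)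

theorem redForm_mk (b : LinearMap.BilinForm ℚ V) (L I : Submodule ℤ V) (x y : ratPerp b L I) :
    redForm b L I ((ratIn b L I).mkQ x) ((ratIn b L I).mkQ y) = b x y := rfl

/-- The lattice `K = (I^⊥ ∩ L) / I`, realized as the image of `I^⊥ ∩ L` in
`(I^⊥ ∩ L_ℚ) / I_ℚ` (for `I` primitive in `L` the kernel of `I^⊥ ∩ L → K_ℚ` is `I`). -/
def redLattice (b : LinearMap.BilinForm ℚ V) (L I : Submodule ℤ V) :
    Submodule ℤ (redSpace b L I) :=
  (L.comap ((ratPerp b L I).subtype.restrictScalars ℤ)).map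
    ((ratIn b L I).mkQ.restrictScalars ℤ)

/-- `I^* = I_ℚ ∩ L^∨`. -/
def starI (b : LinearMap.BilinForm ℚ V) (L I : Submodule ℤ V) : Submodule ℤ V :=
  (rat I).restrictScalars ℤ ⊓ dual b L

/-- `L^* = ⟨L, I^*⟩`. -/
def starL (b : LinearMap.BilinForm ℚ V) (L I : Submodule ℤ V) : Submodule ℤ V :=
  L ⊔ starI b L I

end Reduction

/-! ### Group rings and linear maps between them -/

/-- The vector space underlying the group ring `ℂA`, i.e. the free vector space on `A`. -/
def GroupSpace (A : Type*) : Type _ := A →₀ ℂ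

namespace GroupSpace

instance (A : Type*) : AddCommGroup (GroupSpace A) := inferInstanceAs (AddCommGroup (A →₀ ℂ))

instance (A : Type*) : Module ℂ (GroupSpace A) := inferInstanceAs (Module ℂ (A →₀ ℂ))

/-- The standard basis `(e_a)` of `ℂA`. -/
def basis (A : Type*) : Module.Basis A ℂ (GroupSpace A) := ⟨LinearEquiv.refl ℂ (A →₀ ℂ)⟩

/-- The coefficient of `e_a`, as a linear form. -/
def coeff {A : Type*} (a : A) : GroupSpace A →ₗ[ℂ] ℂ := (basis A).coord a

/-- The linear map on `ℂA` with prescribed values on the standard basis. -/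
def lift {A M : Type*} [AddCommGroup M] [Module ℂ M] (v : A → M) : GroupSpace A →ₗ[ℂ] M :=
  (basis A).constr ℂ v

end GroupSpace

/-- The linear map `ℂA → ℂB` with `e_a ↦ ∑ e_c`, the sum over all `c` in relation to `a`. -/
def transfer {A B : Type*} (R : A → B → Prop) : GroupSpace A →ₗ[ℂ] GroupSpace B :=
  GroupSpace.lift fun a => ∑ᶠ (c : B) (_ : R a c), GroupSpace.basis _ c

section Transfer

variable {V : Type*} [AddCommGroup V] [Module ℚ V]

/-- For lattices `L₁ ⊂ L₂` of finite index, `m ∈ A_{L₁}` and `l ∈ A_{L₂}` : the class `m` lies in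
`H^⊥`, where `H = L₂ / L₁`, and maps to `l` under `H^⊥ → H^⊥ / H = A_{L₂}`. That is, some vector
(necessarily in `L₂^∨`) represents both `m` and `l`. -/
def Over (b : LinearMap.BilinForm ℚ V) (L₁ L₂ : Submodule ℤ V)
    (m : disc b L₁) (l : disc b L₂) : Prop :=
  ∃ x : V, L₁.mkQ x = m ∧ L₂.mkQ x = l

/-- The pullback `↑ : ℂA_{L₂} → ℂA_{L₁}` for `L₁ ⊂ L₂`. -/
def pullback (b : LinearMap.BilinForm ℚ V) (L₁ L₂ : Submodule ℤ V) :
    GroupSpace (disc b L₂) →ₗ[ℂ] GroupSpace (disc b L₁) :=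
  transfer fun l m => Over b L₁ L₂ m l

/-- The pushforward `↓ : ℂA_{L₁} → ℂA_{L₂}` for `L₁ ⊂ L₂`. -/
def pushforward (b : LinearMap.BilinForm ℚ V) (L₁ L₂ : Submodule ℤ V) :
    GroupSpace (disc b L₁) →ₗ[ℂ] GroupSpace (disc b L₂) :=
  transfer fun m l => Over b L₁ L₂ m l

/-- The canonical isomorphism `A_{L^*} ≃ A_K` induced by any splitting `L^* = pU ⊕ K` with
`I^* ⊂ pU`, as a relation: a class of `A_{L^*}` is represented by some `x ∈ I^⊥` (for instance in
the dual of the complement of `pU`), and corresponds to the class of `x` modulo `I_ℚ` in `A_K`. -/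
def DiscIso (b : LinearMap.BilinForm ℚ V) (L I : Submodule ℤ V)
    (l : disc b (starL b L I)) (k : disc (redForm b L I) (redLattice b L I)) : Prop :=
  ∃ x : ratPerp b L I, (starL b L I).mkQ (x : V) = l ∧
    (redLattice b L I).mkQ ((ratIn b L I).mkQ x) = k

/-- The pushforward `↓^L_K : ℂA_L → ℂA_{L^*} = ℂA_K`. -/
def pushK (b : LinearMap.BilinForm ℚ V) (L I : Submodule ℤ V) :
    GroupSpace (disc b L) →ₗ[ℂ] GroupSpace (disc (redForm b L I) (redLattice b L I)) :=
  transfer (DiscIso b L I) ∘ₗ pushforward b L (starL b L I)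

end Transfer

/-! ### The metaplectic group and the Weil representation -/

/-- `Mp₂(ℤ)`: pairs `(M, φ)` with `M ∈ SL₂(ℤ)` and `φ` holomorphic on `ℍ`, `φ(τ)² = cτ + d`. -/
@[ext]
structure Mp2 where
  M : SL(2, ℤ)
  phi : ℍ → ℂ
  holo : MDifferentiable 𝓘(ℂ) 𝓘(ℂ) phi
  sq : ∀ τ : ℍ, phi τ ^ 2 = (M 1 0 : ℂ) * (τ : ℂ) + (M 1 1 : ℂ)

namespace Mp2

/-- The identity `(1, 1)`. -/
instance : One Mp2 where
  one :=
    { M := 1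
      phi := fun _ => 1
      holo := mdifferentiable_const
      sq := by simp }

/-- `(M, φ(τ)) (M', φ'(τ)) = (M M', φ(M'τ) φ'(τ))`. -/
instance : Mul Mp2 where
  mul g h :=
    { M := g.M * h.M
      phi := fun τ => g.phi (h.M • τ) * h.phi τ
      holo := by
        have h1 : MDifferentiable 𝓘(ℂ) 𝓘(ℂ) fun τ : ℍ => h.M • τ :=
          mdifferentiable_smul (g := (h.M : GL (Fin 2) ℝ)) (by simp)
        exact (g.holo.comp h1).mul h.holo
      sq := by
        intro τ
        have hd : (h.M 1 0 : ℂ) * (τ : ℂ) + (h.M 1 1 : ℂ) ≠ 0 := by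
          simpa [denom] using denom_ne_zero (h.M : GL (Fin 2) ℝ) τ
        rw [mul_pow, g.sq, h.sq, UpperHalfPlane.specialLinearGroup_apply]
        simp only [Matrix.SpecialLinearGroup.coe_mul, Matrix.mul_apply, Fin.sum_univ_two]
        simp only [algebraMap_int_eq, eq_intCast, Complex.ofReal_intCast, Int.cast_add, Int.cast_mul]
        generalize (h.M 1 0 : ℂ) = c at hd ⊢
        generalize (h.M 1 1 : ℂ) = d at hd ⊢
        have hd' : (τ : ℂ) * c + d ≠ 0 := by rwa [mul_comm]
        field_simp
        ring }

/-- `T = ((1, 1; 0, 1), 1)`. -/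
def T : Mp2 where
  M := ModularGroup.T
  phi := fun _ => 1
  holo := mdifferentiable_const
  sq := by simp [ModularGroup.T]

/-- `S = ((0, -1; 1, 0), √τ)`, with the principal branch of the square root. -/
def S : Mp2 where
  M := ModularGroup.S
  phi := fun τ => (τ : ℂ) ^ (1 / 2 : ℂ)
  holo := by
    rw [UpperHalfPlane.mdifferentiable_iff]
    intro z hz
    have hz' : 0 < z.im := hz
    have h1 : DifferentiableAt ℂ (fun w : ℂ => w ^ (1 / 2 : ℂ)) z :=
      differentiableAt_id.cpow_const (Or.inr hz'.ne')
    refine (h1.congr_of_eventuallyEq ?_).differentiableWithinAt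
    filter_upwards [isOpen_upperHalfPlaneSet.mem_nhds hz] with w hw
    simp [ofComplex_apply_of_im_pos hw]
  sq := by
    intro τ
    simp [ModularGroup.S]
end Mp2

/-- `e(x) = exp(2πix)`. -/
def e (x : ℚ) : ℂ := Complex.exp (2 * Real.pi * Complex.I * (x : ℂ))

section Weil

variable {V : Type*} [AddCommGroup V] [Module ℚ V]

/-- A representative in `V` of a class in `A_L`. -/
def rep {b : LinearMap.BilinForm ℚ V} {L : Submodule ℤ V} (l : disc b L) : V :=
  Quotient.out (l : V ⧸ L)

theorem mk_rep {b : LinearMap.BilinForm ℚ V} {L : Submodule ℤ V} (l : disc b L) :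
    L.mkQ (rep l) = l := Quotient.out_eq _

/-- `ρ_L(T) e_l = e(q_L(l)) e_l`, where `q_L(l) = (l, l) / 2`. -/
def weilT (b : LinearMap.BilinForm ℚ V) (L : Submodule ℤ V) :
    Module.End ℂ (GroupSpace (disc b L)) :=
  GroupSpace.lift fun l => e (b (rep l) (rep l) / 2) • GroupSpace.basis _ l

/-- `ρ_L(S) e_l = e(-σ(L)/8) / √|A_L| · ∑_{m ∈ A_L} e(-(l, m)) e_m`. -/
def weilS (b : LinearMap.BilinForm ℚ V) (L : Submodule ℤ V) :
    Module.End ℂ (GroupSpace (disc b L)) :=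
  GroupSpace.lift fun l =>
    (e (-(sigma b L : ℚ) / 8) / (Real.sqrt (Nat.card (disc b L)) : ℂ)) •
      ∑ᶠ m : disc b L, e (-(b (rep l) (rep m))) • GroupSpace.basis _ m

/-- The Weil representation `ρ_L` of `Mp₂(ℤ)` on `ℂA_L`, given by its graph:
`Weil b L g R` means `ρ_L(g) = R`. The graph is generated under multiplication by `S ↦ ρ_L(S)` and
`T ↦ ρ_L(T)`; as `S⁸ = 1` and `(ST)³ = S²`, the elements `S, T` generate `Mp₂(ℤ)` as a monoid. -/
inductive Weil (b : LinearMap.BilinForm ℚ V) (L : Submodule ℤ V) :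
    Mp2 → Module.End ℂ (GroupSpace (disc b L)) → Prop
  | one : Weil b L 1 1
  | S : Weil b L Mp2.S (weilS b L)
  | T : Weil b L Mp2.T (weilT b L)
  | mul {g h : Mp2} {P R : Module.End ℂ (GroupSpace (disc b L))} :
      Weil b L g P → Weil b L h R → Weil b L (g * h) (P * R)

end Weil

/-! ### Weakly holomorphic modular forms -/

/-- `f` is meromorphic at the cusp: `f = O(|q|^{-n})` as `Im τ → ∞`, for some `n`. -/
def MeromorphicAtCusp (f : ℍ → ℂ) : Prop :=
  ∃ n : ℕ, f =O[atImInfty] fun τ => Real.exp (2 * Real.pi * n * τ.im)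

theorem MeromorphicAtCusp.mono {f : ℍ → ℂ} {n m : ℕ} (hnm : n ≤ m)
    (hf : f =O[atImInfty] fun τ => Real.exp (2 * Real.pi * n * τ.im)) :
    f =O[atImInfty] fun τ => Real.exp (2 * Real.pi * m * τ.im) := by
  refine hf.trans (Asymptotics.IsBigO.of_bound 1 (Filter.Eventually.of_forall fun τ => ?_))
  have hn : (n : ℝ) ≤ m := by exact_mod_cast hnm
  have := τ.im_pos
  simp only [Real.norm_eq_abs, Real.abs_exp, one_mul]
  gcongr

theorem MeromorphicAtCusp.add {f g : ℍ → ℂ} (hf : MeromorphicAtCusp f)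
    (hg : MeromorphicAtCusp g) : MeromorphicAtCusp (f + g) := by
  obtain ⟨n, hn⟩ := hf
  obtain ⟨m, hm⟩ := hg
  exact ⟨max n m, (mono (le_max_left n m) hn).add (mono (le_max_right n m) hm)⟩

theorem MeromorphicAtCusp.mul {f g : ℍ → ℂ} (hf : MeromorphicAtCusp f)
    (hg : MeromorphicAtCusp g) : MeromorphicAtCusp (f * g) := by
  obtain ⟨n, hn⟩ := hf
  obtain ⟨m, hm⟩ := hg
  refine ⟨n + m, (hn.mul hm).congr_right fun τ => ?_⟩
  rw [← Real.exp_add]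
  push_cast
  ring_nf

theorem MeromorphicAtCusp.const (c : ℂ) : MeromorphicAtCusp fun _ => c :=
  ⟨0, by simpa using Asymptotics.isBigO_const_const c (one_ne_zero (α := ℝ)) atImInfty⟩

/-- The algebra `M^!` of scalar-valued weakly holomorphic modular forms of weight `0`. -/
def scalarForms : Subalgebra ℂ (ℍ → ℂ) where
  carrier := {f | MDifferentiable 𝓘(ℂ) 𝓘(ℂ) f ∧ (∀ (g : SL(2, ℤ)) (τ : ℍ), f (g • τ) = f τ) ∧
    MeromorphicAtCusp f}
  mul_mem' := by
    intro f g hf hg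
    exact ⟨hf.1.mul hg.1, fun a τ => by
      rw [Pi.mul_apply, Pi.mul_apply, hf.2.1 a τ, hg.2.1 a τ], hf.2.2.mul hg.2.2⟩
  add_mem' := by
    intro f g hf hg
    exact ⟨hf.1.add hg.1, fun a τ => by
      rw [Pi.add_apply, Pi.add_apply, hf.2.1 a τ, hg.2.1 a τ], hf.2.2.add hg.2.2⟩
  algebraMap_mem' := by
    intro c
    exact ⟨mdifferentiable_const, fun a τ => rfl, MeromorphicAtCusp.const c⟩

/-- The modular function `j = E₄³ / Δ = q⁻¹ + 744 + ⋯`. -/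
def jFun (τ : ℍ) : ℂ := ModularForm.E₄ τ ^ 3 / ModularForm.discriminant τ

section Forms

variable {V : Type*} [AddCommGroup V] [Module ℚ V]

/-- `M^!(L)`: weakly holomorphic modular forms of weight `σ(L)/2` and type `ρ_L`. -/
def forms (b : LinearMap.BilinForm ℚ V) (L : Submodule ℤ V) :
    Submodule ℂ (ℍ → GroupSpace (disc b L)) where
  carrier := {f |
    (∀ l, MDifferentiable 𝓘(ℂ) 𝓘(ℂ) fun τ => GroupSpace.coeff l (f τ)) ∧
    (∀ (g : Mp2) (R : Module.End ℂ (GroupSpace (disc b L))), Weil b L g R →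
      ∀ τ : ℍ, f (g.M • τ) = g.phi τ ^ sigma b L • R (f τ)) ∧
    (∀ l, MeromorphicAtCusp fun τ => GroupSpace.coeff l (f τ))}
  add_mem' := by
    intro f g hf hg
    refine ⟨fun l => ?_, fun a R hR τ => ?_, fun l => ?_⟩
    · convert (hf.1 l).add (hg.1 l) using 1
      funext τ
      simp
    swap
    · convert (hf.2.2 l).add (hg.2.2 l) using 1
      funext τ
      simp
    rw [Pi.add_apply, Pi.add_apply, hf.2.1 a R hR τ, hg.2.1 a R hR τ, map_add, smul_add]
  zero_mem' := by
    refine ⟨fun l => ?_, fun a R hR τ => by simp, fun l => ?_⟩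
    · simpa using mdifferentiable_const
    · simpa using MeromorphicAtCusp.const 0
  smul_mem' := by
    intro c f hf
    refine ⟨fun l => ?_, fun a R hR τ => ?_, fun l => ?_⟩
    · have h : (fun τ => GroupSpace.coeff l ((c • f) τ)) =
          (fun _ => c) * fun τ => GroupSpace.coeff l (f τ) := by
        funext τ
        simp
      rw [h]
      exact mdifferentiable_const.mul (hf.1 l)
    swap
    · convert (MeromorphicAtCusp.const c).mul (hf.2.2 l) using 1
      funext τ
      simp
    rw [Pi.smul_apply, Pi.smul_apply, hf.2.1 a R hR τ, map_smul, smul_comm]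

/-- The coefficient of `e_l` in the theta series `Θ_N` of a positive definite lattice `N`:
`∑_{x ∈ l + N} q^{(x, x)/2}`. -/
def theta (b : LinearMap.BilinForm ℚ V) (N : Submodule ℤ V) (τ : ℍ) (l : V ⧸ N) : ℂ :=
  ∑' x : {x : V // N.mkQ x = l},
    Complex.exp (2 * Real.pi * Complex.I * ((b x x / 2 : ℚ) : ℂ) * (τ : ℂ))

/-- `ξ(f) = ⟨f ↓^L_K, Θ_{K⁺}⟩`, where `K⁺ = K(-1)`. -/
def xi (b : LinearMap.BilinForm ℚ V) (L I : Submodule ℤ V) :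
    (ℍ → GroupSpace (disc b L)) →ₗ[ℂ] (ℍ → ℂ) :=
  LinearMap.pi fun τ =>
    (GroupSpace.lift fun k : disc (redForm b L I) (redLattice b L I) =>
      theta (-redForm b L I) (redLattice b L I) τ k) ∘ₗ pushK b L I ∘ₗ LinearMap.proj τ

/-- The `Θ`-product `f ∗_I g = ξ(f) · g`. -/
def thetaMul (b : LinearMap.BilinForm ℚ V) (L I : Submodule ℤ V)
    (f g : ℍ → GroupSpace (disc b L)) : ℍ → GroupSpace (disc b L) :=
  fun τ => xi b L I f τ • g τ

/-- `Θ^⊥(L)`: the left annihilator of `M^!(L)` with respect to `∗_I`. -/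
def leftAnn (b : LinearMap.BilinForm ℚ V) (L I : Submodule ℤ V) :
    Submodule ℂ (forms b L) where
  carrier := {f | ∀ g : forms b L, thetaMul b L I f g = 0}
  add_mem' := by
    intro f f' hf hf' g
    funext τ
    have h := congrFun (hf g) τ
    have h' := congrFun (hf' g) τ
    simp only [thetaMul, Pi.zero_apply] at h h'
    simp [thetaMul, add_smul, h, h']
  zero_mem' := by
    intro g
    funext τ
    simp [thetaMul]
  smul_mem' := by
    intro c f hf g
    funext τ
    have h := congrFun (hf g) τ
    simp only [thetaMul, Pi.zero_apply] at h
    simp [thetaMul, mul_smul, h]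

/-- The contraction `ℂA_{L'⊕N} = ℂA_{L'} ⊗ ℂA_N → ℂA_{L'}` with `Θ_{N⁺}(τ)`, for orthogonal
lattices `L'`, `N`: a class in `A_{L'⊕N}` is `[x + y]` for a unique pair
`([x], [y]) ∈ A_{L'} × A_N`, and its basis vector is sent to `Θ_{N⁺}(τ)_{[y]} e_{[x]}`. -/
def contractTheta (b : LinearMap.BilinForm ℚ V) (L' N : Submodule ℤ V) (τ : ℍ) :
    GroupSpace (disc b (L' ⊔ N)) →ₗ[ℂ] GroupSpace (disc b L') :=
  GroupSpace.lift fun k =>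
    ∑ᶠ (c : disc b L' × disc b N)
      (_ : ∃ x y : V, L'.mkQ x = c.1 ∧ N.mkQ y = c.2 ∧ (L' ⊔ N).mkQ (x + y) = k),
      theta (-b) N τ c.2 • GroupSpace.basis _ c.1

/-- The quasi-pullback `f ↦ f|_{L'} = ⟨f ↑_L^{L'⊕N}, Θ_{N⁺}⟩`, where `N = (L')^⊥ ∩ L`. -/
def quasiPullback (b : LinearMap.BilinForm ℚ V) (L L' : Submodule ℤ V) :
    (ℍ → GroupSpace (disc b L)) →ₗ[ℂ] (ℍ → GroupSpace (disc b L')) :=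
  LinearMap.pi fun τ =>
    contractTheta b L' (orthIn b L L') τ ∘ₗ pullback b (L' ⊔ orthIn b L L') L ∘ₗ
      LinearMap.proj τ

end Forms

end ThetaProduct

end

open ThetaProduct

noncomputable section

namespace ThetaProduct

section ModularFunctions

open Asymptotics Filter Topology ModularForm

/-! ### Weakly holomorphic modular functions are the polynomials in `j` -/

/-! Everything rests on one identity, `ξ'(f|_{L'}) = |I/I'| ξ(f)` (`xi_quasiPullback`), and on the
fact that `Θ^⊥` is the kernel of `ξ` (`mem_leftAnn_iff`). The latter holds because `ξ` is linear
over scalar functions: if `f * f = ξ(f) f` vanishes, applying `ξ` gives `ξ(f)² = 0`. Hence `Θ^⊥(L) =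
ker ξ` is the preimage of `Θ^⊥(L') = ker ξ'`, both quotients embed into `M^!` with ideals as images,
and `|I/I'|⁻¹ · |_{L'}` becomes an inclusion of ideals.

For the identity, a vector of `ℂA_L` is viewed as an `L`-periodic function `F` on `V` supported on
`L^∨` (`ext`). Pulling back to a sublattice of finite index does not change `F`, and pushing forward
to `K` gives `k ↦ ∑_{i ∈ I_ℚ/I} F(k + i)` (`ext_pushK_toRed`). So `ξ(f)(τ)` is the sum of `F(k + i)
exp(-πiτ(k,k))` over `k ∈ K_ℚ` and `i ∈ I_ℚ/I`. As `I_ℚ ⊂ L'_ℚ`, there is an orthogonal splitting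
`K_ℚ = K'_ℚ ⊕ N_ℚ`. Summing over `N_ℚ` is contraction with the theta series of `N`, and the
remaining sum is `ξ'` of the quasi-pullback, except that there `i` runs over `I_ℚ/I'`, which counts
every class `|I/I'|` times.

Modularity of `ξ(f)` and `f|_{L'}` is checked on `S` and `T`. The action of `S` is encoded by the
Fourier transform on discriminant groups with a free constant (`SLaw`); this law survives passage to
sublattices of finite index and pushforward to overlattices, and no Gauss sum has to be evaluated.
`K` and `N` are negative definite because `I`, respectively `L'`, exhausts the positive part of `L`.
Their theta inversion is reduced, through a sublattice with orthogonal basis, to the functional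
equation of the Jacobi theta function. The weights match because `σ(L) = -rank K` and `σ(L') = σ(L)
+ rank N`.

For `M^! = ℂ[j]`, a power of `Δ` clears the pole at the cusp; subtracting multiples of powers of
`E₄` and dividing by `Δ` then descends to weight `0`, where only constants remain. -/

theorem qExpansion_pow_E₄_coeff_zero (n : ℕ) :
    (qExpansion 1 (E₄.pow n)).coeff 0 = 1 := by
  have h4 : (qExpansion 1 E₄).coeff 0 = 1 :=
    EisensteinSeries.E_qExpansion_coeff_zero (by norm_num) (by decide)
  rw [ModularForm.qExpansion_pow one_pos one_mem_strictPeriods_SL,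
    PowerSeries.coeff_zero_eq_constantCoeff_apply, map_pow,
    ← PowerSeries.coeff_zero_eq_constantCoeff_apply, h4, one_pow]

/-- A modular form of weight `12 n` divided by `Δ ^ n` is a polynomial in `j`. -/
theorem exists_polynomial_div_discriminant_pow (n : ℕ) :
    ∀ F : ModularForm 𝒮ℒ (12 * n : ℤ), ∃ P : Polynomial ℂ, ∀ τ : ℍ,
      F τ / discriminant τ ^ n = P.eval (jFun τ) := by
  induction n with
  | zero =>
    intro F
    obtain ⟨c, hc⟩ := ModularFormClass.levelOne_weight_zero_const (F.mcast (by simp) : ModularForm 𝒮ℒ 0)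
    refine ⟨Polynomial.C c, fun τ => ?_⟩
    have := congrFun hc τ
    rw [coe_mcast] at this
    simp [this]
  | succ n ih =>
    intro F
    -- `E₄^{3(n+1)}` has weight `12(n+1)` and constant term `1`, so it removes the constant term of
    -- `F`; divided by `Δ^{n+1}` it becomes `j^{n+1}`.
    let E : ModularForm 𝒮ℒ (12 * (n + 1 : ℕ) : ℤ) :=
      (E₄.pow (3 * (n + 1))).mcast (by push_cast; ring)
    have hE : (qExpansion 1 E).coeff 0 = 1 := qExpansion_pow_E₄_coeff_zero _
    set c := (qExpansion 1 F).coeff 0 with hc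
    obtain ⟨G, hG⟩ := sub_smul_isCuspForm F E hE
    -- Division by `Δ` turns cusp forms of weight `12(n+1)` into modular forms of weight `12n`.
    obtain ⟨P, hP⟩ := ih ((CuspForm.discriminantEquiv G).mcast (by push_cast; ring))
    refine ⟨P + Polynomial.C c * Polynomial.X ^ (n + 1), fun τ => ?_⟩
    have h1 : G τ = F τ - c * E₄ τ ^ (3 * (n + 1)) := by
      have := DFunLike.congr_fun hG τ
      rw [CuspForm.toModularFormₗ_apply] at this
      rw [this]
      change F τ - c * (E₄.pow (3 * (n + 1))) τ = _
      rw [coe_pow, Pi.pow_apply]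
    have h2 := hP τ
    rw [mcast_apply, CuspForm.discriminantEquiv_apply, h1] at h2
    have hD := discriminant_ne_zero τ
    rw [Polynomial.eval_add, ← h2]
    simp only [Polynomial.eval_mul, Polynomial.eval_C, Polynomial.eval_pow, Polynomial.eval_X, jFun,
      div_pow, ← pow_mul]
    field_simp
    ring

theorem discriminant_isBigO_exp :
    discriminant =O[atImInfty] fun τ => Real.exp (-(2 * Real.pi * τ.im)) := by
  simpa using CuspFormClass.exp_decay_atImInfty (h := 1) CuspForm.discriminant one_pos
    one_mem_strictPeriods_SL

theorem slash_eq_of_invariant {f : ℍ → ℂ} (hf : ∀ (g : SL(2, ℤ)) (τ : ℍ), f (g • τ) = f τ)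
    (n : ℕ) (g : SL(2, ℤ)) :
    (fun τ => f τ * discriminant τ ^ n) ∣[(12 * n : ℤ)] g = fun τ => f τ * discriminant τ ^ n := by
  have hg : (g : GL (Fin 2) ℝ) ∈ 𝒮ℒ := ⟨g, rfl⟩
  funext τ
  have h := congrFun (CuspForm.discriminant.slash_action_eq' _ hg) τ
  have h' : ModularForm.discriminant (g • τ) * denom g τ ^ (-12 : ℤ) =
      ModularForm.discriminant τ := by
    rw [← SL_slash_apply]
    exact h
  rw [SL_slash_apply, hf, ← h']
  have : denom g τ ^ (-(12 * n : ℤ)) = (denom g τ ^ (-12 : ℤ)) ^ n := by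
    rw [← zpow_natCast, ← zpow_mul]
    ring_nf
  rw [this, mul_pow]
  ring

/-- The modular form `f Δ ^ n` attached to a modular function with a pole of order at most `n`. -/
def mulDiscriminantPow (f : scalarForms) (n : ℕ)
    (hn : (f : ℍ → ℂ) =O[atImInfty] fun τ => Real.exp (2 * Real.pi * n * τ.im)) :
    ModularForm 𝒮ℒ (12 * n : ℤ) where
  toFun τ := (f : ℍ → ℂ) τ * ModularForm.discriminant τ ^ n
  slash_action_eq' := fun _ ⟨g, hg⟩ => hg ▸ slash_eq_of_invariant f.2.2.1 n g
  holo' := f.2.1.mul (CuspForm.discriminant.holo'.pow n)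
  bdd_at_cusps' {c} hc := by
    rw [Subgroup.IsArithmetic.isCusp_iff_isCusp_SL2Z] at hc
    rw [OnePoint.isBoundedAt_iff_forall_SL2Z hc]
    intro g _
    rw [slash_eq_of_invariant f.2.2.1 n g, IsBoundedAtImInfty, BoundedAtFilter]
    -- The growth `e^{2πny}` of `f` is exactly offset by the decay `e^{-2πny}` of `Δ^n`.
    refine (hn.mul (discriminant_isBigO_exp.pow n)).congr_right fun τ => ?_
    simp only [← Real.exp_nat_mul, ← Real.exp_add, Pi.one_apply, Real.exp_eq_one_iff]
    ring

theorem exists_polynomial_eval_jFun (f : scalarForms) :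
    ∃ P : Polynomial ℂ, ∀ τ : ℍ, (f : ℍ → ℂ) τ = P.eval (jFun τ) := by
  obtain ⟨n, hn⟩ := f.2.2.2
  obtain ⟨P, hP⟩ := exists_polynomial_div_discriminant_pow n (mulDiscriminantPow f n hn)
  refine ⟨P, fun τ => ?_⟩
  rw [← hP τ]
  exact (mul_div_cancel_right₀ _ (pow_ne_zero n (discriminant_ne_zero τ))).symm

/-! ### The function `j` at the cusp and its algebraic independence -/

theorem tendsto_E₄ : Tendsto E₄ atImInfty (𝓝 1) := by
  have han := ModularFormClass.analyticAt_cuspFunction_zero E₄ one_pos one_mem_strictPeriods_SL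
  have h0 : cuspFunction 1 E₄ 0 = 1 := by
    have h4 : (qExpansion 1 E₄).coeff 0 = 1 :=
      EisensteinSeries.E_qExpansion_coeff_zero (by norm_num) (by decide)
    simpa [qExpansion_coeff] using h4
  rw [← h0]
  exact (han.continuousAt.tendsto.comp (qParam_tendsto_atImInfty one_pos)).congr
    (fun τ => SlashInvariantFormClass.eq_cuspFunction E₄ τ one_mem_strictPeriods_SL one_ne_zero)

theorem jFun_mem : jFun ∈ scalarForms := by
  refine ⟨?_, fun g τ => ?_, 1, ?_⟩
  · exact (E₄.holo'.pow 3).div CuspForm.discriminant.holo' discriminant_ne_zero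
  · have hg : (g : GL (Fin 2) ℝ) ∈ 𝒮ℒ := ⟨g, rfl⟩
    have h := congrFun (CuspForm.discriminant.slash_action_eq' _ hg) τ
    have h1 : ModularForm.discriminant (g • τ) * denom g τ ^ (-12 : ℤ) =
        ModularForm.discriminant τ := by
      rw [← SL_slash_apply]
      exact h
    have h2 : E₄ (g • τ) * denom g τ ^ (-4 : ℤ) = E₄ τ := by
      rw [← SL_slash_apply]
      exact congrFun (E₄.slash_action_eq' _ hg) τ
    have hd := denom_ne_zero (g : GL (Fin 2) ℝ) τ
    have hD := discriminant_ne_zero (g • τ)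
    rw [jFun, jFun, ← h1, ← h2]
    generalize denom (g : GL (Fin 2) ℝ) τ = d at hd ⊢
    have e1 : d ^ (-12 : ℤ) = (d ^ 12)⁻¹ := by rw [zpow_neg]; rfl
    have e2 : d ^ (-4 : ℤ) = (d ^ 4)⁻¹ := by rw [zpow_neg]; rfl
    rw [e1, e2]
    field_simp
  · have h1 : (fun τ => E₄ τ ^ 3) =O[atImInfty] fun _ => (1 : ℝ) :=
      (tendsto_E₄.pow 3).isBigO_one ℝ
    have h2 : (fun τ => (ModularForm.discriminant τ)⁻¹) =O[atImInfty]
        fun τ => (Real.exp (-2 * Real.pi * τ.im))⁻¹ :=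
      exp_isBigO_discriminant.inv_rev (Eventually.of_forall fun τ h => absurd h (Real.exp_pos _).ne')
    refine (h1.mul h2).congr (fun τ => (div_eq_mul_inv _ _).symm) fun τ => ?_
    rw [← Real.exp_neg, one_mul]
    simp

/-- If `j` took finitely many values it would be bounded, and `E₄³ = jΔ` would tend to `0` at the
cusp instead of `1`. A polynomial vanishing at `j` therefore has infinitely many roots and is zero.
-/
theorem infinite_range_jFun : (Set.range jFun).Infinite := by
  intro hfin
  obtain ⟨C, hC⟩ := hfin.isBounded.exists_norm_le
  have h1 : Tendsto (fun τ => C * ‖ModularForm.discriminant τ‖) atImInfty (𝓝 (C * ‖(0 : ℂ)‖)) :=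
    (discriminant_isZeroAtImInfty.norm).const_mul C
  have h2 : Tendsto (fun τ => ‖E₄ τ ^ 3‖) atImInfty (𝓝 ‖(1 : ℂ) ^ 3‖) := (tendsto_E₄.pow 3).norm
  have h3 : ‖(1 : ℂ) ^ 3‖ ≤ C * ‖(0 : ℂ)‖ := by
    refine le_of_tendsto_of_tendsto' h2 h1 fun τ => ?_
    have h := hC _ ⟨τ, rfl⟩
    rwa [jFun, norm_div, div_le_iff₀ (norm_pos_iff.2 (discriminant_ne_zero τ))] at h
  norm_num at h3

/-- `M^! = ℂ[j]`. -/
theorem exists_algEquiv_scalarForms :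
    ∃ e : Polynomial ℂ ≃ₐ[ℂ] scalarForms, (e Polynomial.X : ℍ → ℂ) = jFun := by
  let φ : Polynomial ℂ →ₐ[ℂ] scalarForms := Polynomial.aeval ⟨jFun, jFun_mem⟩
  have hφ (P : Polynomial ℂ) (τ : ℍ) : (φ P : ℍ → ℂ) τ = P.eval (jFun τ) := by
    have : ((Pi.evalAlgHom ℂ (fun _ : ℍ => ℂ) τ).comp (scalarForms.val.comp φ)) =
        Polynomial.aeval (jFun τ) := by
      ext
      simp [φ]
    simpa [Polynomial.aeval_def, Polynomial.eval₂_eq_eval_map] using AlgHom.congr_fun this P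
  refine ⟨AlgEquiv.ofBijective φ ⟨?_, fun f => ?_⟩, ?_⟩
  · rw [injective_iff_map_eq_zero]
    intro P hP
    refine Polynomial.eq_zero_of_infinite_isRoot P (infinite_range_jFun.mono ?_)
    rintro _ ⟨τ, rfl⟩
    have := hφ P τ
    rw [hP] at this
    exact this.symm
  · obtain ⟨P, hP⟩ := exists_polynomial_eval_jFun f
    exact ⟨P, Subtype.ext (funext fun τ => (hφ P τ).trans (hP τ).symm)⟩
  · funext τ
    exact (hφ Polynomial.X τ).trans Polynomial.eval_X

end ModularFunctions

/-! ### Even lattices, their duals and discriminant groups -/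

section LatticeBasics

variable {V : Type*} [AddCommGroup V] [Module ℚ V] {b : LinearMap.BilinForm ℚ V}
  {L L₁ L₂ : Submodule ℤ V}

theorem le_rat {x : V} (hx : x ∈ L) : x ∈ rat L := Submodule.subset_span hx

theorem rat_mono (h : L₁ ≤ L₂) : rat L₁ ≤ rat L₂ := Submodule.span_mono h

theorem zsmul_mem_rat {S : Submodule ℚ V} {x : V} (n : ℤ) (hx : x ∈ S) : n • x ∈ S :=
  (S.restrictScalars ℤ).smul_mem n hx

theorem mem_of_zsmul_mem {S : Submodule ℚ V} {x : V} {n : ℤ} (hn : n ≠ 0) (hx : n • x ∈ S) :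
    x ∈ S := by
  have h : ((n : ℚ)⁻¹) • (n • x) = x := by
    rw [← Int.cast_smul_eq_zsmul ℚ n x, smul_smul, inv_mul_cancel₀ (by exact_mod_cast hn), one_smul]
  rw [← h]
  exact S.smul_mem _ hx

/-- Clearing denominators: statements about rational spans are reduced to lattice vectors in this
way. -/
theorem exists_zsmul_mem {x : V} (hx : x ∈ rat L) : ∃ n : ℤ, n ≠ 0 ∧ n • x ∈ L := by
  induction hx using Submodule.span_induction with
  | mem x hx => exact ⟨1, one_ne_zero, by simpa using hx⟩
  | zero => exact ⟨1, one_ne_zero, by simp⟩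
  | add x y _ _ hx hy =>
    obtain ⟨n, hn, hx⟩ := hx
    obtain ⟨m, hm, hy⟩ := hy
    refine ⟨n * m, mul_ne_zero hn hm, ?_⟩
    rw [smul_add, mul_comm n m, mul_smul, mul_comm m n, mul_smul]
    exact L.add_mem (L.smul_mem _ hx) (L.smul_mem _ hy)
  | smul c x _ hx =>
    obtain ⟨n, hn, hx⟩ := hx
    refine ⟨n * c.den, mul_ne_zero hn (by exact_mod_cast c.den_nz), ?_⟩
    have : (n * c.den : ℤ) • c • x = c.num • (n • x) := by
      rw [← Int.cast_smul_eq_zsmul ℚ, ← Int.cast_smul_eq_zsmul ℚ c.num,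
        ← Int.cast_smul_eq_zsmul ℚ n, smul_smul, smul_smul]
      congr 1
      push_cast
      rw [mul_assoc, mul_comm (c.den : ℚ), Rat.mul_den_eq_num, mul_comm]
    rw [this]
    exact L.smul_mem _ hx

theorem mem_dual {z : V} :
    z ∈ dual b L ↔ z ∈ rat L ∧ ∀ l ∈ L, ∃ n : ℤ, b z l = n := by
  simp only [dual, Submodule.mem_inf, Submodule.restrictScalars_mem,
    LinearMap.BilinForm.mem_dualSubmodule, Submodule.mem_one]
  simp [eq_comm]

theorem IsEvenLattice.le_dual (hL : IsEvenLattice b L) : L ≤ dual b L := fun x hx =>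
  mem_dual.2 ⟨le_rat hx, hL.integral x hx⟩

theorem bilin_zsmul_left (n : ℤ) (x y : V) : b (n • x) y = n * b x y := by
  rw [← Int.cast_smul_eq_zsmul ℚ, map_smul, LinearMap.smul_apply, smul_eq_mul]

theorem bilin_zsmul_right (n : ℤ) (x y : V) : b x (n • y) = n * b x y := by
  rw [← Int.cast_smul_eq_zsmul ℚ, map_smul, smul_eq_mul]

/-- A form which vanishes on a lattice vanishes on its rational span. -/
theorem eq_zero_of_forall_mem_rat {x y : V} (h : ∀ y ∈ L, b x y = 0) (hy : y ∈ rat L) :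
    b x y = 0 := by
  obtain ⟨n, hn, hy⟩ := exists_zsmul_mem hy
  have := h _ hy
  rw [bilin_zsmul_right] at this
  exact (mul_eq_zero.1 this).resolve_left (by exact_mod_cast hn)

theorem IsEvenLattice.rat_nondegenerate (hL : IsEvenLattice b L) {x : V} (hx : x ∈ rat L)
    (h : ∀ y ∈ L, b x y = 0) : x = 0 := by
  obtain ⟨n, hn, hnx⟩ := exists_zsmul_mem hx
  have := hL.nondegenerate _ hnx fun y hy => by rw [bilin_zsmul_left, h y hy, mul_zero]
  rw [← Int.cast_smul_eq_zsmul ℚ] at this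
  exact (smul_eq_zero.1 this).resolve_left (by exact_mod_cast hn)

theorem finiteDimensional_rat (hL : L.FG) : FiniteDimensional ℚ (rat L) := by
  obtain ⟨s, rfl⟩ := hL
  have : rat (Submodule.span ℤ (s : Set V)) = Submodule.span ℚ (s : Set V) :=
    Submodule.span_span_of_tower ℤ ℚ (s : Set V)
  rw [this]
  infer_instance

theorem restrict_nondegenerate (hb : b.IsSymm) (hL : IsEvenLattice b L) :
    (b.restrict (rat L)).Nondegenerate := by
  have hr : (b.restrict (rat L)).IsRefl := (hb.restrict _).isRefl
  refine (LinearMap.IsRefl.nondegenerate_iff_separatingLeft hr).2 fun x hx => ?_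
  exact Subtype.ext (hL.rat_nondegenerate x.2 fun y hy => hx ⟨y, le_rat hy⟩)

/-- A `ℤ`-basis of `L` and the dual basis with respect to the form. -/
theorem exists_dual_basis (hb : b.IsSymm) (hL : IsEvenLattice b L) :
    ∃ (n : ℕ) (v w : Fin n → V), L = Submodule.span ℤ (Set.range v) ∧ (∀ i, w i ∈ rat L) ∧
      ∀ i j, b (w i) (v j) = if i = j then 1 else 0 := by
  classical
  have : Module.Finite ℤ L := Module.Finite.iff_fg.2 hL.fg
  have : IsAddTorsionFree V := IsAddTorsionFree.of_module_rat V
  let B := Module.finBasis ℤ L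
  have hli : LinearIndependent ℤ fun i => (B i : V) :=
    B.linearIndependent.map' L.subtype (Submodule.ker_subtype L)
  have hli' : LinearIndependent ℚ fun i => (B i : V) :=
    (LinearIndependent.iff_fractionRing ℤ ℚ).1 hli
  have hspan : L = Submodule.span ℤ (Set.range fun i => (B i : V)) := by
    have := congrArg (Submodule.map L.subtype) B.span_eq
    rw [Submodule.map_span, Submodule.map_top, Submodule.range_subtype, ← Set.range_comp] at this
    exact this.symm
  have hrat : Submodule.span ℚ (Set.range fun i => (B i : V)) = rat L := by
    conv_rhs => rw [hspan]
    exact (Submodule.span_span_of_tower ℤ ℚ _).symm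
  -- The `ℤ`-basis stays independent over `ℚ = Frac ℤ`, hence is a `ℚ`-basis of `L_ℚ`, which has a
  -- dual basis because the form is nondegenerate there.
  let C : Module.Basis _ ℚ (rat L) := (Module.Basis.span hli').map (LinearEquiv.ofEq _ _ hrat)
  have hC (i) : (C i : V) = B i := by
    simp [C, Module.Basis.span_apply]
  have := finiteDimensional_rat hL.fg
  let W := (b.restrict (rat L)).dualBasis (restrict_nondegenerate hb hL) C
  refine ⟨_, fun i => (B i : V), fun i => (W i : V), hspan, fun i => (W i).2, fun i j => ?_⟩
  have := (b.restrict (rat L)).apply_dualBasis_left (restrict_nondegenerate hb hL) C i j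
  change b (W i : V) (B j : V) = _
  rw [← hC]
  simp only [eq_comm (a := i)]
  exact this

/-- Every integral linear form on `L` is represented by a vector of the dual lattice. -/
theorem exists_mem_dual (hb : b.IsSymm) (hL : IsEvenLattice b L) (φ : L →ₗ[ℤ] ℤ) :
    ∃ z ∈ dual b L, ∀ l : L, b z l = φ l := by
  obtain ⟨n, v, w, hv, hw, hvw⟩ := exists_dual_basis hb hL
  have hvL (i) : v i ∈ L := hv ▸ Submodule.subset_span ⟨i, rfl⟩
  -- In the dual basis, the coordinates of the representing vector are the values of `φ` on the
  -- basis of `L`.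
  let z := ∑ i, (φ ⟨v i, hvL i⟩ : ℚ) • w i
  have hz (l : L) : b z l = φ l := by
    obtain ⟨l, hl⟩ := l
    have hl' := hl
    rw [hv] at hl'
    induction hl' using Submodule.span_induction with
    | mem x hx =>
      obtain ⟨j, rfl⟩ := hx
      simp [z, hvw]
    | zero =>
      rw [show (⟨0, hl⟩ : L) = 0 from rfl]
      simp
    | add x y hx hy ihx ihy =>
      rw [← hv] at hx hy
      rw [show (⟨x + y, hl⟩ : L) = ⟨x, hx⟩ + ⟨y, hy⟩ from rfl, map_add]
      push_cast
      rw [map_add, ← ihx hx, ← ihy hy]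
    | smul c x hx ihx =>
      rw [← hv] at hx
      rw [show (⟨c • x, hl⟩ : L) = c • ⟨x, hx⟩ from rfl, map_smul]
      push_cast
      rw [bilin_zsmul_right, ihx hx, smul_eq_mul, Int.cast_mul]
  refine ⟨z, mem_dual.2 ⟨Submodule.sum_mem _ fun i _ => Submodule.smul_mem _ _ (hw i), ?_⟩, hz⟩
  exact fun l hl => ⟨_, hz ⟨l, hl⟩⟩

/-- The bidual of `L` is `L`. -/
theorem mem_of_forall_dual (hb : b.IsSymm) (hL : IsEvenLattice b L) {z : V} (hz : z ∈ rat L)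
    (h : ∀ y ∈ dual b L, ∃ n : ℤ, b z y = n) : z ∈ L := by
  obtain ⟨n, v, w, hv, hw, hvw⟩ := exists_dual_basis hb hL
  have hvL (i) : v i ∈ L := hv ▸ Submodule.subset_span ⟨i, rfl⟩
  have hwd (i) : w i ∈ dual b L := by
    refine mem_dual.2 ⟨hw i, fun l hl => ?_⟩
    rw [hv] at hl
    induction hl using Submodule.span_induction with
    | mem x hx =>
      obtain ⟨j, rfl⟩ := hx
      exact ⟨if i = j then 1 else 0, by rw [hvw]; split_ifs <;> simp⟩
    | zero => exact ⟨0, by simp⟩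
    | add x y _ _ ihx ihy =>
      obtain ⟨m, hm⟩ := ihx
      obtain ⟨k, hk⟩ := ihy
      exact ⟨m + k, by rw [map_add, hm, hk]; simp⟩
    | smul c x _ ihx =>
      obtain ⟨m, hm⟩ := ihx
      exact ⟨c * m, by rw [bilin_zsmul_right, hm]; simp⟩
  -- The coordinates of `z` in the basis `v` are its pairings with the dual basis, which lies in
  -- `L^∨`; they are integers by hypothesis.
  choose m hm using fun i => h (w i) (hwd i)
  have key : z = ∑ i, m i • v i := by
    have hmem : ∑ i, m i • v i ∈ L := Submodule.sum_mem _ fun i _ => L.smul_mem _ (hvL i)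
    refine sub_eq_zero.1 (hL.rat_nondegenerate ((rat L).sub_mem hz (le_rat hmem)) fun y hy => ?_)
    -- the two vectors pair equally with the dual basis, which spans
    have hy' : y = ∑ i, b y (v i) • w i := by
      refine sub_eq_zero.1 (hL.rat_nondegenerate ((rat L).sub_mem (le_rat hy)
        (Submodule.sum_mem _ fun i _ => Submodule.smul_mem _ _ (hw i))) fun x hx => ?_)
      rw [hv] at hx
      induction hx using Submodule.span_induction with
      | mem x hx =>
        obtain ⟨j, rfl⟩ := hx
        simp [hvw]
      | zero => simp
      | add x y _ _ ihx ihy => rw [map_add, ihx, ihy, add_zero]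
      | smul c x _ ihx => rw [bilin_zsmul_right, ihx, mul_zero]
    rw [hy', map_sum]
    refine Finset.sum_eq_zero fun i _ => ?_
    rw [map_smul, map_sub, LinearMap.sub_apply, hm i, map_sum, LinearMap.sum_apply]
    have : ∀ j, b (m j • v j) (w i) = if j = i then (m j : ℚ) else 0 := fun j => by
      rw [bilin_zsmul_left, hb.eq, hvw]
      simp [eq_comm]
    simp only [this, Finset.sum_ite_eq', Finset.mem_univ, if_true, sub_self, smul_zero]
  rw [key]
  exact Submodule.sum_mem _ fun i _ => L.smul_mem _ (hvL i)

theorem dual_fg (hb : b.IsSymm) (hL : IsEvenLattice b L) : (dual b L).FG := by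
  obtain ⟨n, v, w, hv, hw, hvw⟩ := exists_dual_basis hb hL
  have hle : dual b L ≤ Submodule.span ℤ (Set.range w) := by
    intro y hy
    obtain ⟨hy, hyL⟩ := mem_dual.1 hy
    have hvL (i) : v i ∈ L := hv ▸ Submodule.subset_span ⟨i, rfl⟩
    choose m hm using fun i => hyL (v i) (hvL i)
    have : y = ∑ i, m i • w i := by
      refine sub_eq_zero.1 (hL.rat_nondegenerate ((rat L).sub_mem hy
        (Submodule.sum_mem _ fun i _ => zsmul_mem_rat _ (hw i))) fun x hx => ?_)
      rw [hv] at hx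
      induction hx using Submodule.span_induction with
      | mem x hx =>
        obtain ⟨j, rfl⟩ := hx
        rw [map_sub, LinearMap.sub_apply, hm, map_sum, LinearMap.sum_apply]
        simp only [bilin_zsmul_left, hvw]
        simp
      | zero => simp
      | add x y _ _ ihx ihy => rw [map_add, ihx, ihy, add_zero]
      | smul c x _ ihx => rw [bilin_zsmul_right, ihx, mul_zero]
    rw [this]
    exact Submodule.sum_mem _ fun i _ => Submodule.smul_mem _ _ (Submodule.subset_span ⟨i, rfl⟩)
  exact (Submodule.fg_span (Set.finite_range w)).of_le hle

/-- If `B` is finitely generated and contained in `A_ℚ`, then `(A + B) / A` is finite. -/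
theorem finite_map_mkQ {A B : Submodule ℤ V} (hB : B.FG) (h : ∀ x ∈ B, x ∈ rat A) :
    Finite (B.map A.mkQ) := by
  have : Module.Finite ℤ (B.map A.mkQ) := Module.Finite.iff_fg.2 (hB.map _)
  refine Module.finite_of_fg_torsion (B.map A.mkQ) ?_
  rintro ⟨_, x, hx, rfl⟩
  obtain ⟨n, hn, hnx⟩ := exists_zsmul_mem (h x hx)
  refine ⟨⟨n, mem_nonZeroDivisors_of_ne_zero hn⟩, Subtype.ext ?_⟩
  change n • A.mkQ x = 0
  rw [← map_zsmul]
  exact (Submodule.Quotient.mk_eq_zero A).2 hnx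

theorem finite_disc (hb : b.IsSymm) (hL : IsEvenLattice b L) : Finite (disc b L) :=
  finite_map_mkQ (dual_fg hb hL) fun _ hx => (mem_dual.1 hx).1

theorem dual_anti (h : L₁ ≤ L₂) (hr : rat L₂ ≤ rat L₁) : dual b L₂ ≤ dual b L₁ := fun _ hx =>
  mem_dual.2 ⟨hr (mem_dual.1 hx).1, fun l hl => (mem_dual.1 hx).2 l (h hl)⟩

theorem mkQ_mem_disc (hL : IsEvenLattice b L) {z : V} : L.mkQ z ∈ disc b L ↔ z ∈ dual b L := by
  refine ⟨?_, fun h => ⟨z, h, rfl⟩⟩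
  rintro ⟨x, hx, h⟩
  have : z - x ∈ L := (Submodule.Quotient.eq L).1 h.symm
  rw [← sub_add_cancel z x]
  exact (dual b L).add_mem (hL.le_dual this) hx

theorem IsEvenLattice.of_le (hL : IsEvenLattice b L₂) (h : L₁ ≤ L₂)
    (hd : ∀ x ∈ L₁, (∀ y ∈ L₁, b x y = 0) → x = 0) : IsEvenLattice b L₁ where
  fg := hL.fg.of_le h
  integral x hx y hy := hL.integral x (h hx) y (h hy)
  even x hx := hL.even x (h hx)
  nondegenerate := hd

end LatticeBasics

/-! ### The exponential `e` -/

theorem e_add (x y : ℚ) : e (x + y) = e x * e y := by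
  simp only [e, Rat.cast_add, mul_add, Complex.exp_add]

theorem e_zero : e 0 = 1 := by simp [e]

theorem e_intCast (n : ℤ) : e n = 1 := by
  rw [e, Complex.exp_eq_one_iff]
  exact ⟨n, by push_cast; ring⟩

theorem e_eq_one_iff {x : ℚ} : e x = 1 ↔ ∃ n : ℤ, x = n := by
  refine ⟨fun h => ?_, ?_⟩
  · rw [e, Complex.exp_eq_one_iff] at h
    obtain ⟨n, hn⟩ := h
    refine ⟨n, ?_⟩
    have h2 : (2 * Real.pi * Complex.I : ℂ) ≠ 0 := Complex.two_pi_I_ne_zero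
    rw [mul_comm (n : ℂ)] at hn
    exact_mod_cast mul_left_cancel₀ h2 hn
  · rintro ⟨n, rfl⟩
    exact e_intCast n

theorem e_add_intCast (x : ℚ) (n : ℤ) : e (x + n) = e x := by rw [e_add, e_intCast, mul_one]

theorem e_ne_zero (x : ℚ) : e x ≠ 0 := Complex.exp_ne_zero _

theorem e_congr {x y : ℚ} (h : ∃ n : ℤ, x - y = n) : e x = e y := by
  obtain ⟨n, hn⟩ := h
  rw [show x = y + n by linarith, e_add_intCast]

/-! ### Finite sums over cosets -/

theorem finsum_comm_of_finite {α β : Type*} {f : α → β → ℂ} {S : Set α} {T : Set β}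
    (hS : S.Finite) (hT : T.Finite) (h : ∀ a c, f a c ≠ 0 → a ∈ S ∧ c ∈ T) :
    ∑ᶠ a, ∑ᶠ c, f a c = ∑ᶠ c, ∑ᶠ a, f a c := by
  have h1 : Function.HasFiniteSupport fun p : α × β => f p.1 p.2 :=
    (hS.prod hT).subset fun p hp => h _ _ hp
  have h2 : Function.HasFiniteSupport fun p : β × α => f p.2 p.1 :=
    (hT.prod hS).subset fun p hp => (h _ _ hp).symm
  rw [← finsum_curry _ h1, ← finsum_curry _ h2, ← finsum_comp_equiv (Equiv.prodComm α β)]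
  rfl

section CosetSum

variable {V : Type*} [AddCommGroup V]

/-- The sum of an `A`-periodic function over `V / A`. -/
def csum (A : Submodule ℤ V) (g : V → ℂ) : ℂ := ∑ᶠ c : V ⧸ A, g (Quotient.out c)

/-- `g` is invariant under translation by `A`. -/
def Periodic (A : Submodule ℤ V) (g : V → ℂ) : Prop := ∀ x, ∀ a ∈ A, g (x + a) = g x

variable {A B C : Submodule ℤ V} {g : V → ℂ}

theorem mkQ_out (c : V ⧸ A) : A.mkQ (Quotient.out c) = c := Quotient.out_eq c

theorem out_sub_mem (x : V) : Quotient.out (A.mkQ x) - x ∈ A :=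
  (Submodule.Quotient.eq A).1 (mkQ_out (A.mkQ x))

theorem Periodic.out_mkQ (hg : Periodic A g) (x : V) : g (Quotient.out (A.mkQ x)) = g x := by
  rw [← hg x _ (out_sub_mem (A := A) x), add_sub_cancel]

theorem Periodic.mono (hg : Periodic B g) (h : A ≤ B) : Periodic A g :=
  fun x a ha => hg x a (h ha)

theorem Periodic.mul {g' : V → ℂ} (hg : Periodic A g) (hg' : Periodic A g') :
    Periodic A fun x => g x * g' x := fun x a ha => by
  simp only [hg x a ha, hg' x a ha]

theorem Periodic.translate (hg : Periodic A g) (y : V) : Periodic A fun x => g (y + x) :=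
  fun x a ha => by simp only [← add_assoc, hg _ a ha]

theorem Periodic.indicator (hg : Periodic A g) (h : A ≤ B) :
    Periodic A ((B : Set V).indicator g) := fun x a ha => by
  classical
  simp only [Set.indicator_apply, SetLike.mem_coe, B.add_mem_iff_left (h ha), hg x a ha]

theorem mem_iff_mkQ_mem (h : A ≤ B) {x : V} : A.mkQ x ∈ B.map A.mkQ ↔ x ∈ B := by
  refine ⟨?_, fun hx => ⟨x, hx, rfl⟩⟩
  rintro ⟨y, hy, hxy⟩
  have : x - y ∈ A := (Submodule.Quotient.eq A).1 hxy.symm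
  rw [← sub_add_cancel x y]
  exact B.add_mem (h this) hy

theorem out_mem_iff (h : A ≤ B) {c : V ⧸ A} : Quotient.out c ∈ B ↔ c ∈ B.map A.mkQ := by
  rw [← mem_iff_mkQ_mem h, mkQ_out]

theorem csum_congr {g g' : V → ℂ} (h : ∀ x, g x = g' x) : csum A g = csum A g' := by
  rw [show g = g' from funext h]

theorem csum_zero : csum A (fun _ => 0) = 0 := by simp [csum]

theorem mul_csum (c : ℂ) : c * csum A g = csum A fun x => c * g x := mul_finsum _ _

theorem csum_translate (hg : Periodic A g) (y : V) : csum A (fun x => g (y + x)) = csum A g := by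
  rw [csum, csum, ← finsum_comp_equiv (Equiv.addLeft (A.mkQ y)) (f := fun c => g (Quotient.out c))]
  refine finsum_congr fun c => ?_
  rw [Equiv.coe_addLeft, ← hg.out_mkQ (y + Quotient.out c), map_add, mkQ_out]

/-- `csum` as a sum over a finite group of cosets. -/
theorem finsum_out_eq_csum (h : A ≤ B) :
    ∑ᶠ c : B.map A.mkQ, g (Quotient.out (c : V ⧸ A)) = csum A ((B : Set V).indicator g) := by
  classical
  rw [csum]
  refine (finsum_set_coe_eq_finsum_mem (f := fun c : V ⧸ A => g (Quotient.out c))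
    (B.map A.mkQ : Set (V ⧸ A))).trans ?_
  rw [finsum_mem_def]
  refine finsum_congr fun c => ?_
  simp only [Set.indicator_apply, SetLike.mem_coe, out_mem_iff h]

theorem csum_indicator_one (h : A ≤ B) :
    csum A ((B : Set V).indicator fun _ => 1) = Nat.card (B.map A.mkQ) := by
  rw [← finsum_out_eq_csum h]
  have := finsum_one (s := (Set.univ : Set (B.map A.mkQ)))
  simp only [Set.mem_univ, finsum_true, Set.ncard_univ] at this
  rw [← this]
  by_cases hf : Finite (B.map A.mkQ)
  · have := Fintype.ofFinite (B.map A.mkQ)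
    simp [finsum_eq_sum_of_fintype]
  -- For infinite `B / A` both sums have infinite support and take the default value `0`, so no
  -- finiteness assumption is needed.
  · have := not_finite_iff_infinite.1 hf
    rw [finsum_of_infinite_support, finsum_of_infinite_support]
    · simp
    · simpa [Function.support] using Set.infinite_univ
    · simpa [Function.support] using Set.infinite_univ

theorem support_out (h : A ≤ B) (hg : ∀ x, g x ≠ 0 → x ∈ B) {c : V ⧸ A}
    (hc : g (Quotient.out c) ≠ 0) : c ∈ (B.map A.mkQ : Set (V ⧸ A)) :=
  (out_mem_iff h).1 (hg _ hc)

theorem csum_comm {A' B' : Submodule ℤ V} {f : V → V → ℂ} (h : A ≤ B) (h' : A' ≤ B')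
    [Finite (B.map A.mkQ)] [Finite (B'.map A'.mkQ)] (hf : ∀ x y, f x y ≠ 0 → x ∈ B ∧ y ∈ B') :
    csum A (fun x => csum A' (fun y => f x y)) = csum A' (fun y => csum A (fun x => f x y)) :=
  finsum_comm_of_finite (Set.toFinite (B.map A.mkQ : Set (V ⧸ A)))
    (Set.toFinite (B'.map A'.mkQ : Set (V ⧸ A')))
    fun _ _ hn => ⟨(out_mem_iff h).1 (hf _ _ hn).1, (out_mem_iff h').1 (hf _ _ hn).2⟩

/-- Summation over `V / A` in two steps for `A ⊂ B`. -/
theorem csum_tower (hAB : A ≤ B) (hAC : A ≤ C) [hfin : Finite (C.map A.mkQ)]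
    (hg : Periodic A g) (hsupp : ∀ x, g x ≠ 0 → x ∈ C) :
    csum A g = csum B fun z => csum A ((B : Set V).indicator fun h => g (z + h)) := by
  classical
  let G : V ⧸ A → ℂ := fun c => g (Quotient.out c)
  let π : V ⧸ A → V ⧸ B := Submodule.factor hAB
  have hGS : ∀ c, G c ≠ 0 → c ∈ (C.map A.mkQ : Set (V ⧸ A)) := fun c => support_out hAC hsupp
  have hS : (C.map A.mkQ : Set (V ⧸ A)).Finite := Set.toFinite _
  -- Each class is recorded together with its image in `V / B`; exchanging the sums groups the
  -- classes by fibres of `V / A → V / B`.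
  have h1 : csum A g = ∑ᶠ c, ∑ᶠ d, if π c = d then G c else 0 := by
    refine finsum_congr fun c => ?_
    rw [finsum_eq_single _ (π c) fun d hd => if_neg (Ne.symm hd), if_pos rfl]
  rw [h1, finsum_comm_of_finite hS (hS.image π) (by
    intro c d hcd
    split_ifs at hcd with h
    · exact ⟨hGS c hcd, c, hGS c hcd, h⟩
    · exact absurd rfl hcd)]
  refine finsum_congr fun d => ?_
  -- Translation by a representative of `d` identifies `B / A` with the fibre over `d`.
  rw [← finsum_comp_equiv (Equiv.addLeft (A.mkQ (Quotient.out d)))]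
  refine finsum_congr fun c => ?_
  have hc : π (A.mkQ (Quotient.out d) + c) = d ↔ Quotient.out c ∈ B := by
    conv_lhs => rw [← mkQ_out c, ← map_add]
    change B.mkQ (Quotient.out d + Quotient.out c) = d ↔ _
    rw [map_add, mkQ_out, add_eq_left]
    exact Submodule.Quotient.mk_eq_zero B
  simp only [Equiv.coe_addLeft, hc, Set.indicator_apply, SetLike.mem_coe, G]
  congr 1
  rw [← hg.out_mkQ (Quotient.out d + Quotient.out c), map_add, mkQ_out c]

/-- If `g` is `B`-periodic, summation over `V / A` multiplies the sum over `V / B` by `|B / A|`. -/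
theorem csum_of_periodic (hAB : A ≤ B) (hAC : A ≤ C) [Finite (C.map A.mkQ)]
    (hg : Periodic B g) (hsupp : ∀ x, g x ≠ 0 → x ∈ C) :
    csum A g = Nat.card (B.map A.mkQ) * csum B g := by
  rw [csum_tower hAB hAC (hg.mono hAB) hsupp, mul_csum]
  refine csum_congr fun z => ?_
  rw [← csum_indicator_one hAB, mul_comm, mul_csum]
  refine csum_congr fun h => ?_
  by_cases hh : h ∈ B
  · simp [hh, hg z h hh]
  · simp [hh]

end CosetSum

/-! ### Finite Fourier transforms on discriminant groups -/

section Fourier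

variable {V : Type*} [AddCommGroup V] [Module ℚ V] {b : LinearMap.BilinForm ℚ V}
  {A B L L₁ L₂ : Submodule ℤ V}

theorem periodic_character {z : V} (hz : ∀ a ∈ A, ∃ n : ℤ, b a z = n) :
    Periodic A fun h => e (-(b h z)) := by
  intro x a ha
  obtain ⟨n, hn⟩ := hz a ha
  refine e_congr ⟨-n, ?_⟩
  rw [map_add, LinearMap.add_apply, hn]
  push_cast
  ring

open Classical in
/-- Orthogonality of characters on `B / A`. -/
theorem csum_character (hAB : A ≤ B) {z : V} (hz : ∀ a ∈ A, ∃ n : ℤ, b a z = n) :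
    csum A ((B : Set V).indicator fun h => e (-(b h z))) =
      if ∀ h ∈ B, ∃ n : ℤ, b h z = n then (Nat.card (B.map A.mkQ) : ℂ) else 0 := by
  split_ifs with hB
  · rw [← csum_indicator_one hAB]
    refine csum_congr fun h => ?_
    by_cases hh : h ∈ B
    · obtain ⟨n, hn⟩ := hB h hh
      simp only [Set.indicator_of_mem, SetLike.mem_coe, hh, hn]
      rw [← Int.cast_neg, e_intCast]
    · simp [hh]
  · push Not at hB
    -- The character is nontrivial at `h₀`. Translation by `h₀` leaves the sum unchanged but also
    -- multiplies it by a number other than `1`, so the sum is `0`.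
    obtain ⟨h₀, hh₀, hn⟩ := hB
    have hper := (periodic_character hz).indicator hAB
    have h1 := csum_translate hper h₀
    have h2 : csum A (fun x => (B : Set V).indicator (fun h => e (-(b h z))) (h₀ + x)) =
        e (-(b h₀ z)) * csum A ((B : Set V).indicator fun h => e (-(b h z))) := by
      rw [mul_csum]
      refine csum_congr fun h => ?_
      simp only [Set.indicator_apply, SetLike.mem_coe, B.add_mem_iff_right hh₀, map_add,
        LinearMap.add_apply, neg_add, e_add, mul_ite, mul_zero]
    rw [h2] at h1
    have h3 : e (-(b h₀ z)) ≠ 1 := by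
      rw [Ne, e_eq_one_iff]
      rintro ⟨n, h⟩
      exact hn (-n) (by rw [Int.cast_neg, ← h, neg_neg])
    by_contra h0
    exact h3 ((mul_eq_right₀ h0).1 h1)

/-- The Fourier transform on the discriminant group `L^∨ / L`. -/
def FT (b : LinearMap.BilinForm ℚ V) (L : Submodule ℤ V) (F : V → ℂ) (z : V) : ℂ :=
  csum L ((dual b L : Set V).indicator fun m => e (-(b m z)) * F m)

theorem dual_int_left {x z : V} (hz : z ∈ dual b L) (hx : x ∈ L) : ∃ n : ℤ, b z x = n :=
  (mem_dual.1 hz).2 x hx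

theorem dual_int_right (hb : b.IsSymm) {x z : V} (hz : z ∈ dual b L) (hx : x ∈ L) :
    ∃ n : ℤ, b x z = n := by
  rw [hb.eq]
  exact dual_int_left hz hx

theorem periodic_FT_term (hb : b.IsSymm) {F : V → ℂ} (hF : Periodic L F) {z : V}
    (hz : z ∈ dual b L) : Periodic L fun m => e (-(b m z)) * F m :=
  (periodic_character fun _ ha => dual_int_right hb hz ha).mul hF

/-- The Fourier transform of a function coming from an overlattice. -/
theorem FT_of_le (hb : b.IsSymm) (h1 : IsEvenLattice b L₁) (h2 : IsEvenLattice b L₂)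
    (hle : L₁ ≤ L₂) (hr : rat L₂ ≤ rat L₁) {F : V → ℂ} (hF : Periodic L₂ F)
    (hsupp : ∀ x, F x ≠ 0 → x ∈ dual b L₂) {z : V} (hz : z ∈ dual b L₁) :
    FT b L₁ F z = (dual b L₂ : Set V).indicator
      (fun z => Nat.card (L₂.map L₁.mkQ) * FT b L₂ F z) z := by
  classical
  have := finite_disc hb h1
  have hd := dual_anti (b := b) hle hr
  have hper := periodic_FT_term hb (hF.mono hle) hz
  have hs : ∀ x, (dual b L₁ : Set V).indicator (fun m => e (-(b m z)) * F m) x ≠ 0 →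
      x ∈ dual b L₁ := fun x hx => Set.mem_of_indicator_ne_zero hx
  have : Finite ((dual b L₁).map L₁.mkQ) := finite_disc hb h1
  rw [FT, csum_tower hle h1.le_dual (hper.indicator h1.le_dual) hs]
  -- `F` is constant along `L₂`, so the inner sum over `L₂ / L₁` is a character sum: `|L₂ / L₁|` if
  -- `z` pairs integrally with `L₂`, and `0` otherwise.
  have key : ∀ x, csum L₁ ((L₂ : Set V).indicator fun h =>
      (dual b L₁ : Set V).indicator (fun m => e (-(b m z)) * F m) (x + h)) =
      (if ∀ h ∈ L₂, ∃ n : ℤ, b h z = n then (Nat.card (L₂.map L₁.mkQ) : ℂ) else 0) *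
        (dual b L₂ : Set V).indicator (fun m => e (-(b m z)) * F m) x := by
    intro x
    rw [← csum_character hle fun _ ha => dual_int_right hb hz ha, mul_comm, mul_csum]
    refine csum_congr fun h => ?_
    by_cases hh : h ∈ L₂
    · simp only [Set.indicator_of_mem, SetLike.mem_coe, hh]
      by_cases hx : x ∈ dual b L₂
      · rw [Set.indicator_of_mem (hd ((dual b L₂).add_mem hx (h2.le_dual hh))),
          Set.indicator_of_mem (SetLike.mem_coe.2 hx), hF x h hh, map_add, LinearMap.add_apply,
          neg_add, e_add]
        ring
      · have : F (x + h) = 0 := by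
          by_contra hne
          refine hx ?_
          have := (dual b L₂).sub_mem (hsupp _ hne) (h2.le_dual hh)
          rwa [add_sub_cancel_right] at this
        simp [Set.indicator_apply, this, hx]
    · simp [hh]
  rw [csum_congr key, ← mul_csum]
  have hcond : (∀ h ∈ L₂, ∃ n : ℤ, b h z = n) ↔ z ∈ dual b L₂ := by
    refine ⟨fun h => mem_dual.2 ⟨rat_mono hle (mem_dual.1 hz).1, fun l hl => ?_⟩,
      fun h x hx => dual_int_right hb h hx⟩
    rw [hb.eq]
    exact h l hl
  simp only [hcond, Set.indicator_apply, SetLike.mem_coe, FT, ite_mul, zero_mul]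

/-- Fourier inversion. -/
theorem FT_FT (hb : b.IsSymm) (hL : IsEvenLattice b L) {F : V → ℂ} (hF : Periodic L F) {z : V}
    (hz : z ∈ dual b L) : FT b L (FT b L F) z = Nat.card (disc b L) * F (-z) := by
  classical
  have hfin : Finite ((dual b L).map L.mkQ) := finite_disc hb hL
  have h1 : FT b L (FT b L F) z = csum L fun m => csum L fun k =>
      (dual b L : Set V).indicator (fun m => e (-(b m (z + k)))) m *
        (dual b L : Set V).indicator F k := by
    refine csum_congr fun m => ?_
    by_cases hm : m ∈ dual b L
    · simp only [Set.indicator_of_mem, SetLike.mem_coe, hm, FT, mul_csum]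
      refine csum_congr fun k => ?_
      by_cases hk : k ∈ dual b L
      · simp only [Set.indicator_of_mem, SetLike.mem_coe, hk]
        rw [map_add, neg_add, e_add, hb.eq k m]
        ring
      · simp [hk]
    · simp [hm, csum_zero]
  rw [h1, csum_comm hL.le_dual hL.le_dual (fun x y hxy =>
    ⟨Set.mem_of_indicator_ne_zero (left_ne_zero_of_mul hxy),
      Set.mem_of_indicator_ne_zero (right_ne_zero_of_mul hxy)⟩)]
  -- Biduality enters here: the character `m ↦ e(-(m, z + k))` is trivial on `L^∨` exactly for `z +
  -- k ∈ L`, so only the class `k = -z` survives the sum over `m`.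
  have hint : ∀ k ∈ dual b L, (∀ h ∈ dual b L, ∃ n : ℤ, b h (z + k) = n) ↔ z + k ∈ L := by
    intro k hk
    refine ⟨fun h => ?_, fun h x hx => dual_int_left hx h⟩
    refine mem_of_forall_dual hb hL ((rat L).add_mem (mem_dual.1 hz).1 (mem_dual.1 hk).1)
      fun y hy => ?_
    rw [hb.eq]
    exact h y hy
  have h2 : ∀ k, csum L (fun m => (dual b L : Set V).indicator (fun m => e (-(b m (z + k)))) m *
        (dual b L : Set V).indicator F k) =
      (fun x => (L : Set V).indicator (fun _ => Nat.card (disc b L) * F (-z)) x) (z + k) := by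
    intro k
    by_cases hk : k ∈ dual b L
    · have hzk : ∀ a ∈ L, ∃ n : ℤ, b a (z + k) = n := fun a ha =>
        dual_int_right hb ((dual b L).add_mem hz hk) ha
      have := csum_character hL.le_dual hzk
      simp only [Set.indicator_of_mem, SetLike.mem_coe, hk]
      rw [csum_congr fun m => mul_comm _ _, ← mul_csum]
      rw [this]
      simp only [hint k hk, Set.indicator_apply, SetLike.mem_coe]
      split_ifs with h
      · rw [← hF (-z) _ h, neg_add_cancel_left]
        exact mul_comm _ _
      · simp
    · have hzk : z + k ∉ L := fun h => hk (by
        have := (dual b L).sub_mem (hL.le_dual h) hz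
        rwa [add_sub_cancel_left] at this)
      simp [hk, hzk, csum_zero]
  rw [csum_congr h2, csum_translate (Periodic.indicator (fun _ _ _ => rfl) le_rfl)]
  rw [csum, finsum_eq_single _ 0]
  · have := Periodic.out_mkQ (A := L) (Periodic.indicator (B := L) (A := L)
      (g := fun _ => (Nat.card (disc b L) : ℂ) * F (-z)) (fun _ _ _ => rfl) le_rfl) 0
    rw [map_zero] at this
    rw [this]
    simp
  · intro c hc
    refine Set.indicator_of_notMem (fun h => hc ?_) _
    rw [← mkQ_out c]
    exact (Submodule.Quotient.mk_eq_zero L).2 h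

/-- `|A_{L₁}| = |L₂ / L₁|² |A_{L₂}|`. -/
theorem card_disc_of_le (hb : b.IsSymm) (h1 : IsEvenLattice b L₁) (h2 : IsEvenLattice b L₂)
    (hle : L₁ ≤ L₂) (hr : rat L₂ ≤ rat L₁) :
    Nat.card (disc b L₁) = Nat.card (L₂.map L₁.mkQ) ^ 2 * Nat.card (disc b L₂) := by
  have hd := dual_anti (b := b) hle hr
  have hfin : Finite ((dual b L₁).map L₁.mkQ) := finite_disc hb h1
  -- Counting by Fourier inversion: this is the delta function at `0` on `A_{L₂}`. Its transform for
  -- `L₁` is `|L₂ / L₁|` times the indicator of `L₂^∨`; transforming again and evaluating at `0`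
  -- compares `|L₂ / L₁|² |A_{L₂}|` with `|A_{L₁}|`.
  let F : V → ℂ := (L₂ : Set V).indicator fun _ => 1
  have hF : Periodic L₂ F := Periodic.indicator (fun _ _ _ => rfl) le_rfl
  have hsupp : ∀ x, F x ≠ 0 → x ∈ dual b L₂ := fun x hx =>
    h2.le_dual (Set.mem_of_indicator_ne_zero hx)
  have hF2 : ∀ z ∈ dual b L₂, FT b L₂ F z = 1 := by
    intro z hz
    rw [FT, csum, finsum_eq_single _ 0]
    · have := (periodic_FT_term hb hF hz).indicator h2.le_dual |>.out_mkQ 0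
      rw [map_zero] at this
      rw [this]
      simp [F, e_zero, (dual b L₂).zero_mem]
    · intro c hc
      have : F (Quotient.out c) = 0 := by
        refine Set.indicator_of_notMem (fun h => hc ?_) _
        rw [← mkQ_out c]
        exact (Submodule.Quotient.mk_eq_zero L₂).2 h
      simp [this]
  have hF1 : ∀ z ∈ dual b L₁, FT b L₁ F z = (dual b L₂ : Set V).indicator
      (fun _ => (Nat.card (L₂.map L₁.mkQ) : ℂ)) z := by
    intro z hz
    rw [FT_of_le hb h1 h2 hle hr hF hsupp hz]
    by_cases hz' : z ∈ dual b L₂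
    · simp [hz', hF2]
    · simp [hz']
  have h3 := FT_FT hb h1 (hF.mono hle) (dual b L₁).zero_mem
  have h4 : FT b L₁ (FT b L₁ F) 0 = csum L₁ ((dual b L₂ : Set V).indicator
      (fun _ => (Nat.card (L₂.map L₁.mkQ) : ℂ))) := by
    refine csum_congr fun x => ?_
    by_cases hx : x ∈ dual b L₁
    · simp [hx, hF1, e_zero]
    · have : x ∉ dual b L₂ := fun h => hx (hd h)
      simp [hx, this]
  rw [h4, csum_of_periodic hle h1.le_dual (Periodic.indicator (fun _ _ _ => rfl) h2.le_dual)
    (fun x hx => hd (Set.mem_of_indicator_ne_zero hx))] at h3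
  have h5 : csum L₂ ((dual b L₂ : Set V).indicator
      (fun _ => (Nat.card (L₂.map L₁.mkQ) : ℂ))) =
      Nat.card (L₂.map L₁.mkQ) * Nat.card (disc b L₂) := by
    rw [disc, ← csum_indicator_one h2.le_dual, mul_csum]
    refine csum_congr fun x => ?_
    by_cases hx : x ∈ dual b L₂ <;> simp [hx]
  rw [h5] at h3
  have h6 : F (-0) = 1 := by simp [F]
  rw [h6, mul_one] at h3
  have : ((Nat.card (L₂.map L₁.mkQ) ^ 2 * Nat.card (disc b L₂) : ℕ) : ℂ) =
      (Nat.card (disc b L₁) : ℕ) := by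
    rw [← h3]
    push_cast
    ring
  exact_mod_cast this.symm

theorem card_disc_pos (hb : b.IsSymm) (hL : IsEvenLattice b L) : 0 < Nat.card (disc b L) := by
  have := finite_disc hb hL
  exact Nat.card_pos

theorem sqrt_card_disc_ne_zero (hb : b.IsSymm) (hL : IsEvenLattice b L) :
    (Real.sqrt (Nat.card (disc b L)) : ℂ) ≠ 0 := by
  have : (0 : ℝ) < Nat.card (disc b L) := by exact_mod_cast card_disc_pos hb hL
  exact_mod_cast (Real.sqrt_pos.2 this).ne'

theorem sqrt_card_disc_of_le (hb : b.IsSymm) (h1 : IsEvenLattice b L₁) (h2 : IsEvenLattice b L₂)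
    (hle : L₁ ≤ L₂) (hr : rat L₂ ≤ rat L₁) :
    (Real.sqrt (Nat.card (disc b L₁)) : ℂ) =
      Nat.card (L₂.map L₁.mkQ) * (Real.sqrt (Nat.card (disc b L₂)) : ℂ) := by
  rw [card_disc_of_le hb h1 h2 hle hr]
  push_cast
  rw [Real.sqrt_mul (by positivity), Real.sqrt_sq (by positivity)]
  push_cast
  rfl

/-- `F₂` is the image of `F₁` under `c · ρ_L(S)`, up to the eighth root of unity in `ρ_L(S)`. -/
def SLaw (b : LinearMap.BilinForm ℚ V) (L : Submodule ℤ V) (c : ℂ) (F₁ F₂ : V → ℂ) : Prop :=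
  ∀ z ∈ dual b L, F₂ z = c / (Real.sqrt (Nat.card (disc b L)) : ℂ) * FT b L F₁ z

/-- The law is inherited by sublattices of finite index. -/
theorem SLaw.of_le (hb : b.IsSymm) (h1 : IsEvenLattice b L₁) (h2 : IsEvenLattice b L₂)
    (hle : L₁ ≤ L₂) (hr : rat L₂ ≤ rat L₁) {c : ℂ} {F₁ F₂ : V → ℂ} (hF : Periodic L₂ F₁)
    (hs₁ : ∀ x, F₁ x ≠ 0 → x ∈ dual b L₂) (hs₂ : ∀ x, F₂ x ≠ 0 → x ∈ dual b L₂)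
    (h : SLaw b L₂ c F₁ F₂) : SLaw b L₁ c F₁ F₂ := by
  intro z hz
  -- Passing from `L₂` to `L₁`, the Fourier transform on `L₂^∨` and the normalizing square root both
  -- grow by the factor `|L₂ / L₁|`.
  rw [FT_of_le hb h1 h2 hle hr hF hs₁ hz, sqrt_card_disc_of_le hb h1 h2 hle hr]
  by_cases hz' : z ∈ dual b L₂
  · rw [Set.indicator_of_mem (SetLike.mem_coe.2 hz'), h z hz']
    have : Finite (L₂.map L₁.mkQ) := finite_map_mkQ h2.fg fun x hx => hr (le_rat hx)
    have h0 : (Nat.card (L₂.map L₁.mkQ) : ℂ) ≠ 0 := by exact_mod_cast Nat.card_pos.ne'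
    have := sqrt_card_disc_ne_zero hb h2
    field_simp
  · rw [Set.indicator_of_notMem (by simpa using hz'), mul_zero]
    by_contra hne
    exact hz' (hs₂ z hne)

/-- The pushforward of a function on `L₁^∨ / L₁` to an overlattice. -/
def pushFun (L₁ L₂ : Submodule ℤ V) (F : V → ℂ) (z : V) : ℂ :=
  csum L₁ ((L₂ : Set V).indicator fun h => F (z + h))

/-- The law is inherited by pushforwards to overlattices. -/
theorem SLaw.pushFun (hb : b.IsSymm) (h1 : IsEvenLattice b L₁) (h2 : IsEvenLattice b L₂)
    (hle : L₁ ≤ L₂) (hr : rat L₂ ≤ rat L₁) {c : ℂ} {F₁ F₂ : V → ℂ} (hF : Periodic L₁ F₁)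
    (h : SLaw b L₁ c F₁ F₂) : SLaw b L₂ c (pushFun L₁ L₂ F₁) (pushFun L₁ L₂ F₂) := by
  classical
  intro z hz
  have hd := dual_anti (b := b) hle hr
  have hfin : Finite ((dual b L₁).map L₁.mkQ) := finite_disc hb h1
  have hfin' : Finite (L₂.map L₁.mkQ) := finite_map_mkQ h2.fg fun x hx => hr (le_rat hx)
  have h0 : (Nat.card (L₂.map L₁.mkQ) : ℂ) ≠ 0 := by exact_mod_cast Nat.card_pos.ne'
  have hL₂ : L₂ ≤ dual b L₁ := h2.le_dual.trans hd
  have e1 : ThetaProduct.pushFun L₁ L₂ F₂ z = c / (Real.sqrt (Nat.card (disc b L₁)) : ℂ) *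
      csum L₁ fun h => csum L₁ fun m => (L₂ : Set V).indicator (fun h => e (-(b h m))) h *
        (dual b L₁ : Set V).indicator (fun m => e (-(b m z)) * F₁ m) m := by
    rw [ThetaProduct.pushFun, mul_csum]
    refine csum_congr fun x => ?_
    by_cases hx : x ∈ L₂
    · simp only [Set.indicator_of_mem, SetLike.mem_coe, hx]
      rw [h _ ((dual b L₁).add_mem (hd hz) (hL₂ hx)), FT]
      congr 1
      refine csum_congr fun m => ?_
      by_cases hm : m ∈ dual b L₁
      · simp only [Set.indicator_of_mem, SetLike.mem_coe, hm]
        rw [map_add, neg_add, e_add, hb.eq m x]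
        ring
      · simp [hm]
    · simp [hx, csum_zero]
  -- Once the sums are exchanged, the sum over `h ∈ L₂ / L₁` is a character sum that keeps only `m ∈
  -- L₂^∨`.
  have e2 : ∀ m, csum L₁ (fun h => (L₂ : Set V).indicator (fun h => e (-(b h m))) h *
        (dual b L₁ : Set V).indicator (fun m => e (-(b m z)) * F₁ m) m) =
      Nat.card (L₂.map L₁.mkQ) * (dual b L₂ : Set V).indicator (fun m => e (-(b m z)) * F₁ m) m := by
    intro m
    rw [csum_congr fun h => mul_comm _ _, ← mul_csum]
    by_cases hm : m ∈ dual b L₁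
    · rw [csum_character hle fun _ ha => dual_int_right hb hm ha]
      have hcond : (∀ h ∈ L₂, ∃ n : ℤ, b h m = n) ↔ m ∈ dual b L₂ := by
        refine ⟨fun h => mem_dual.2 ⟨rat_mono hle (mem_dual.1 hm).1, fun l hl => ?_⟩,
          fun h x hx => dual_int_right hb h hx⟩
        rw [hb.eq]
        exact h l hl
      simp only [hcond, Set.indicator_apply, SetLike.mem_coe, hm, if_true]
      split_ifs
      · exact mul_comm _ _
      · simp
    · have : m ∉ dual b L₂ := fun h => hm (hd h)
      simp [hm, this]
  have e3 : FT b L₂ (ThetaProduct.pushFun L₁ L₂ F₁) z =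
      csum L₁ ((dual b L₂ : Set V).indicator (fun m => e (-(b m z)) * F₁ m)) := by
    rw [csum_tower hle h1.le_dual
      ((periodic_FT_term hb hF (hd hz)).indicator (hle.trans h2.le_dual))
      (fun x hx => hd (Set.mem_of_indicator_ne_zero hx))]
    refine csum_congr fun m => ?_
    by_cases hm : m ∈ dual b L₂
    · simp only [Set.indicator_of_mem, SetLike.mem_coe, hm, ThetaProduct.pushFun, mul_csum]
      refine csum_congr fun h => ?_
      by_cases hh : h ∈ L₂
      · have hmh : m + h ∈ dual b L₂ := (dual b L₂).add_mem hm (h2.le_dual hh)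
        obtain ⟨n, hn⟩ := dual_int_right hb hz hh
        simp only [Set.indicator_of_mem, SetLike.mem_coe, hh, hmh]
        congr 1
        exact e_congr ⟨n, by rw [map_add, LinearMap.add_apply, hn]; ring⟩
      · simp [hh]
    · have : ∀ h ∈ L₂, m + h ∉ dual b L₂ := fun h hh hmh => hm (by
        have := (dual b L₂).sub_mem hmh (h2.le_dual hh)
        rwa [add_sub_cancel_right] at this)
      rw [Set.indicator_of_notMem (by simpa using hm), ← csum_zero (A := L₁)]
      refine csum_congr fun h => ?_
      by_cases hh : h ∈ L₂ <;> simp [hh, this]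
  rw [e1, csum_comm hle h1.le_dual (fun x y hxy =>
    ⟨Set.mem_of_indicator_ne_zero (left_ne_zero_of_mul hxy),
      Set.mem_of_indicator_ne_zero (right_ne_zero_of_mul hxy)⟩), csum_congr e2, ← mul_csum, e3,
    sqrt_card_disc_of_le hb h1 h2 hle hr]
  have := sqrt_card_disc_ne_zero hb h2
  field_simp

end Fourier

/-! ### Coefficients of linear maps between group rings -/

namespace GroupSpace

variable {A M : Type*} [AddCommGroup M] [Module ℂ M]

theorem coeff_basis [DecidableEq A] (a c : A) : coeff c (basis A a) = if a = c then 1 else 0 := by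
  rw [coeff, Module.Basis.coord_apply, Module.Basis.repr_self, Finsupp.single_apply]

theorem lift_basis (w : A → M) (a : A) : lift w (basis A a) = w a :=
  (basis A).constr_basis ℂ w a

theorem ext_coeff {v w : GroupSpace A} (h : ∀ a, coeff a v = coeff a w) : v = w :=
  (basis A).ext_elem h

theorem lift_apply [Fintype A] (w : A → M) (v : GroupSpace A) :
    lift w v = ∑ a, coeff a v • w a := by
  rw [lift, Module.Basis.constr_apply_fintype]
  rfl

end GroupSpace

open GroupSpace

open Classical in
theorem coeff_transfer {A B : Type*} [Finite A] [Finite B] (R : A → B → Prop) (v : GroupSpace A)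
    (c : B) : coeff c (transfer R v) = ∑ᶠ a, if R a c then coeff a v else 0 := by
  have := Fintype.ofFinite A
  have := Fintype.ofFinite B
  rw [transfer, lift_apply, map_sum, finsum_eq_sum_of_fintype]
  refine Finset.sum_congr rfl fun a _ => ?_
  have : (∑ᶠ (c : B) (_ : R a c), GroupSpace.basis B c) =
      ∑ c, if R a c then GroupSpace.basis B c else 0 := by
    rw [finsum_eq_sum_of_fintype]
    refine Finset.sum_congr rfl fun c _ => ?_
    by_cases h : R a c <;> simp [h]
  rw [map_smul, this, map_sum]
  have h : ∀ x, coeff c (if R a x then GroupSpace.basis B x else 0) =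
      if x = c then (if R a c then 1 else 0) else 0 := by
    intro x
    by_cases hx : x = c
    · subst hx
      by_cases hR : R a x <;> simp [hR, coeff_basis]
    · by_cases hR : R a x <;> simp [hR, coeff_basis, hx]
  simp only [h, Finset.sum_ite_eq', Finset.mem_univ, if_true]
  by_cases hR : R a c <;> simp [hR]

/-! ### Vectors of `ℂA_L` as functions on `V` -/

section Ext

variable {V : Type*} [AddCommGroup V] [Module ℚ V] {b : LinearMap.BilinForm ℚ V}
  {L L₁ L₂ : Submodule ℤ V}

open Classical in
/-- The function on `V` supported on `L^∨` whose value at `z` is the coefficient of `e_{[z]}`. -/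
def ext (v : GroupSpace (disc b L)) (z : V) : ℂ :=
  if h : L.mkQ z ∈ disc b L then coeff ⟨L.mkQ z, h⟩ v else 0

theorem ext_of_mem (v : GroupSpace (disc b L)) {z : V} {l : disc b L} (h : L.mkQ z = l) :
    ext v z = coeff l v := by
  have hm : L.mkQ z ∈ disc b L := h ▸ l.2
  rw [ext, dif_pos hm]
  congr 2
  exact Subtype.ext h

theorem ext_rep (v : GroupSpace (disc b L)) (l : disc b L) : ext v (rep l) = coeff l v :=
  ext_of_mem v (mk_rep l)

theorem ext_congr (v : GroupSpace (disc b L)) {x y : V} (h : L.mkQ x = L.mkQ y) :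
    ext v x = ext v y := by
  by_cases hy : L.mkQ y ∈ disc b L
  · rw [ext_of_mem v (l := ⟨L.mkQ y, hy⟩) h, ext_of_mem v (l := ⟨L.mkQ y, hy⟩) rfl]
  · rw [ext, ext, dif_neg hy, dif_neg (h ▸ hy)]

theorem periodic_ext (v : GroupSpace (disc b L)) : Periodic L (ext v) := fun x a ha =>
  ext_congr v ((Submodule.Quotient.eq L).2 (by simpa using ha))

theorem ext_support (hL : IsEvenLattice b L) (v : GroupSpace (disc b L)) {z : V}
    (h : ext v z ≠ 0) : z ∈ dual b L := by
  by_contra hz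
  exact h (dif_neg (mt (mkQ_mem_disc hL).1 hz))

theorem ext_of_notMem (hL : IsEvenLattice b L) (v : GroupSpace (disc b L)) {z : V}
    (h : z ∉ dual b L) : ext v z = 0 := by
  by_contra hz
  exact h (ext_support hL v hz)

theorem ext_smul (c : ℂ) (v : GroupSpace (disc b L)) (z : V) : ext (c • v) z = c * ext v z := by
  by_cases h : L.mkQ z ∈ disc b L
  · rw [ext_of_mem _ (l := ⟨_, h⟩) rfl, ext_of_mem _ (l := ⟨_, h⟩) rfl, map_smul, smul_eq_mul]
  · rw [ext, ext, dif_neg h, dif_neg h, mul_zero]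

theorem rep_mem_dual (hL : IsEvenLattice b L) (l : disc b L) : rep l ∈ dual b L := by
  rw [← mkQ_mem_disc hL, mk_rep]
  exact l.2

theorem eq_of_ext (hL : IsEvenLattice b L) {v w : GroupSpace (disc b L)}
    (h : ∀ z ∈ dual b L, ext v z = ext w z) : v = w :=
  ext_coeff fun l => by rw [← ext_rep, ← ext_rep, h _ (rep_mem_dual hL l)]

/-- Sums over the discriminant group as sums over cosets. -/
theorem finsum_disc (hL : IsEvenLattice b L) (g : V → ℂ) :
    ∑ᶠ l : disc b L, g (rep l) = csum L ((dual b L : Set V).indicator g) :=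
  finsum_out_eq_csum hL.le_dual

open Classical in
theorem finsum_disc_coeff (hL : IsEvenLattice b L) (v : GroupSpace (disc b L))
    (P : disc b L → Prop) (Q : V → Prop) (h : ∀ l, P l ↔ Q (rep l)) :
    (∑ᶠ l, if P l then coeff l v else 0) = csum L fun x => if Q x then ext v x else 0 := by
  have h1 := finsum_disc hL fun x => if Q x then ext v x else 0
  simp only [ext_rep, ← h] at h1
  rw [h1]
  refine csum_congr fun x => ?_
  by_cases hx : x ∈ dual b L
  · simp [hx]
  · simp [hx, ext_of_notMem hL]

/-- `ρ_L(S)` in terms of the Fourier transform. -/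
theorem sLaw_weilS (hb : b.IsSymm) (hL : IsEvenLattice b L) (c : ℂ) (v : GroupSpace (disc b L)) :
    SLaw b L (c * e (-(sigma b L : ℚ) / 8)) (ext v) (ext (c • weilS b L v)) := by
  classical
  intro z hz
  have := finite_disc hb hL
  have := Fintype.ofFinite (disc b L)
  let m : disc b L := ⟨L.mkQ z, (mkQ_mem_disc hL).2 hz⟩
  have h2 : coeff m (weilS b L v) = ∑ l, coeff l v *
      ((e (-(sigma b L : ℚ) / 8) / (Real.sqrt (Nat.card (disc b L)) : ℂ)) *
        e (-(b (rep l) (rep m)))) := by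
    rw [weilS, lift_apply, map_sum]
    refine Finset.sum_congr rfl fun l _ => ?_
    rw [map_smul, map_smul, finsum_eq_sum_of_fintype, map_sum]
    simp [coeff_basis]
  rw [ext_smul, ext_of_mem _ (l := m) rfl, h2, FT, ← finsum_disc hL, finsum_eq_sum_of_fintype,
    Finset.mul_sum, Finset.mul_sum]
  refine Finset.sum_congr rfl fun l _ => ?_
  have h3 : e (-(b (rep l) (rep m))) = e (-(b (rep l) z)) := by
    have hmem : rep m - z ∈ L := (Submodule.Quotient.eq L).1 (mk_rep m)
    obtain ⟨n, hn⟩ := dual_int_left (rep_mem_dual hL l) hmem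
    rw [map_sub] at hn
    exact e_congr ⟨-n, by push_cast; linarith⟩
  rw [h3, ext_rep]
  ring

/-- Evenness of `L` makes `(z, z)/2` well defined modulo `ℤ` on `L^∨ / L`, so the chosen
representative of the class may be replaced by `z`. -/
theorem ext_weilT (hb : b.IsSymm) (hL : IsEvenLattice b L) (v : GroupSpace (disc b L)) {z : V}
    (hz : z ∈ dual b L) : ext (weilT b L v) z = e (b z z / 2) * ext v z := by
  classical
  have := finite_disc hb hL
  have := Fintype.ofFinite (disc b L)
  let m : disc b L := ⟨L.mkQ z, (mkQ_mem_disc hL).2 hz⟩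
  have h3 : e (b (rep m) (rep m) / 2) = e (b z z / 2) := by
    have hmem : rep m - z ∈ L := (Submodule.Quotient.eq L).1 (mk_rep m)
    obtain ⟨n, hn⟩ := dual_int_left hz hmem
    obtain ⟨k, hk⟩ := hL.even _ hmem
    have h1 : rep m = z + (rep m - z) := (add_sub_cancel _ _).symm
    refine e_congr ⟨n + k, ?_⟩
    rw [h1]
    generalize rep m - z = d at *
    simp only [map_add, LinearMap.add_apply, hb.eq d z, hn, hk]
    push_cast
    ring
  rw [ext_of_mem _ (l := m) rfl, ext_of_mem _ (l := m) rfl, weilT, lift_apply, map_sum]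
  simp only [map_smul, coeff_basis, smul_eq_mul, mul_ite, mul_one, mul_zero]
  rw [Finset.sum_ite_eq' Finset.univ m, if_pos (Finset.mem_univ m), h3, mul_comm]

/-- A class of `A_{L₁}` receives the coefficient of its image in `A_{L₂}`, or `0` if it has none; as
a function on `V` nothing changes. This is the gain from replacing vectors of `ℂA_L` by functions on
`V`. -/
theorem ext_pullback (hb : b.IsSymm) (h1 : IsEvenLattice b L₁) (h2 : IsEvenLattice b L₂)
    (hle : L₁ ≤ L₂) (hr : rat L₂ ≤ rat L₁) (v : GroupSpace (disc b L₂)) (z : V) :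
    ext (pullback b L₁ L₂ v) z = ext v z := by
  classical
  have := finite_disc hb h1
  have := finite_disc hb h2
  by_cases hz : z ∈ dual b L₁
  · let m : disc b L₁ := ⟨L₁.mkQ z, (mkQ_mem_disc h1).2 hz⟩
    have hO : ∀ l : disc b L₂, Over b L₁ L₂ m l ↔ (l : V ⧸ L₂) = L₂.mkQ z := by
      intro l
      refine ⟨?_, fun h => ⟨z, rfl, h.symm⟩⟩
      rintro ⟨x, hx, hl⟩
      rw [← hl]
      exact (Submodule.Quotient.eq L₂).2 (hle ((Submodule.Quotient.eq L₁).1 hx))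
    rw [ext_of_mem _ (l := m) rfl, pullback, coeff_transfer]
    by_cases hz2 : z ∈ dual b L₂
    · let l : disc b L₂ := ⟨L₂.mkQ z, (mkQ_mem_disc h2).2 hz2⟩
      rw [finsum_eq_single _ l, if_pos ((hO l).2 rfl), ext_of_mem _ (l := l) rfl]
      intro l' hl'
      exact if_neg fun h => hl' (Subtype.ext ((hO l').1 h))
    · rw [ext_of_notMem h2 _ hz2]
      refine (finsum_congr fun l => if_neg fun h => hz2 ?_).trans finsum_zero
      rw [← mkQ_mem_disc h2, ← (hO l).1 h]
      exact l.2
  · rw [ext_of_notMem h1 _ hz, ext_of_notMem h2 _ fun h => hz (dual_anti hle hr h)]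

/-- The classes of `A_{L₁}` over the class of `z` are those of the form `z + h` with `h ∈ L₂ / L₁`;
any `z + h` outside `L₁^∨` contributes `0` through `ext`. -/
theorem ext_pushforward (hb : b.IsSymm) (h1 : IsEvenLattice b L₁) (h2 : IsEvenLattice b L₂)
    (hle : L₁ ≤ L₂) (v : GroupSpace (disc b L₁)) {z : V}
    (hz : z ∈ dual b L₂) : ext (pushforward b L₁ L₂ v) z = pushFun L₁ L₂ (ext v) z := by
  classical
  have := finite_disc hb h1
  have := finite_disc hb h2
  let l : disc b L₂ := ⟨L₂.mkQ z, (mkQ_mem_disc h2).2 hz⟩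
  have hO : ∀ m : disc b L₁, Over b L₁ L₂ m l ↔ rep m - z ∈ L₂ := by
    intro m
    refine ⟨?_, fun h => ⟨rep m, mk_rep m, (Submodule.Quotient.eq L₂).2 h⟩⟩
    rintro ⟨x, hx, hl⟩
    have h3 : rep m - x ∈ L₁ := (Submodule.Quotient.eq L₁).1 ((mk_rep m).trans hx.symm)
    have h4 : x - z ∈ L₂ := (Submodule.Quotient.eq L₂).1 hl
    have := L₂.add_mem (hle h3) h4
    rwa [sub_add_sub_cancel] at this
  rw [ext_of_mem _ (l := l) rfl, pushforward, coeff_transfer,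
    finsum_disc_coeff h1 v _ (fun x => x - z ∈ L₂) hO, pushFun]
  have hper : Periodic L₁ fun x => if x - z ∈ L₂ then ext v x else 0 := fun x a ha => by
    have : x + a - z ∈ L₂ ↔ x - z ∈ L₂ := by
      rw [add_sub_right_comm, L₂.add_mem_iff_left (hle ha)]
    simp only [this, periodic_ext v x a ha]
  rw [← csum_translate hper z]
  refine csum_congr fun h => ?_
  simp only [add_sub_cancel_left, Set.indicator_apply, SetLike.mem_coe]

end Ext

/-! ### Signatures -/

section Signature

variable {V : Type*} [AddCommGroup V] [Module ℚ V] {b : LinearMap.BilinForm ℚ V}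
  {L L' I : Submodule ℤ V} {p q : ℕ}

/-- `N` is negative definite. -/
def NegDef (b : LinearMap.BilinForm ℚ V) (N : Submodule ℤ V) : Prop :=
  ∀ x ∈ rat N, x ≠ 0 → b x x < 0

theorem ratForm_apply (x : rat L) : ratForm b L x = b x x := rfl

theorem sigPos_add_sigNeg (hb : b.IsSymm) (hL : IsEvenLattice b L) :
    sigPos (ratForm b L) + sigNeg (ratForm b L) = Module.finrank ℚ (rat L) := by
  have := finiteDimensional_rat hL.fg
  rw [← QuadraticForm.sigPos_add_sigNeg_add_radical (Q := ratForm b L)]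
  have : QuadraticMap.radical (ratForm b L) = ⊥ := by
    rw [Submodule.eq_bot_iff]
    intro x hx
    refine Subtype.ext (hL.rat_nondegenerate x.2 fun y hy => ?_)
    have h := LinearMap.congr_fun hx.2 (⟨y, le_rat hy⟩ : rat L)
    simp only [QuadraticMap.polarBilin_apply_apply, QuadraticMap.polar, ratForm_apply,
      LinearMap.zero_apply, Submodule.coe_add, map_add, LinearMap.add_apply, hb.eq y x] at h
    linarith
  rw [this, finrank_bot, add_zero]

/-- A positive semidefinite subspace has dimension at most `p`. -/
theorem finrank_le_of_nonneg (hb : b.IsSymm) (hL : IsEvenLattice b L) {U : Submodule ℚ V}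
    (hU : U ≤ rat L) (h : ∀ x ∈ U, 0 ≤ b x x) :
    Module.finrank ℚ U ≤ sigPos (ratForm b L) := by
  have := finiteDimensional_rat hL.fg
  -- For the negated form `U` is nonpositive and the positive index is `q`, whence `q + dim U ≤ p +
  -- q`.
  have h1 := QuadraticForm.sigPos_add_finrank_le_of_nonpos (Q := -ratForm b L)
    (V := U.submoduleOf (rat L)) fun x hx => by
      have := h x hx
      rw [neg_apply, ratForm_apply]
      linarith
  rw [(Submodule.submoduleOfEquivOfLe hU).finrank_eq, sigPos_neg,
    ← sigPos_add_sigNeg hb hL] at h1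
  omega

theorem finrank_rat (hI : I.FG) : Module.finrank ℚ (rat I) = Module.finrank ℤ I := by
  have : Module.Finite ℤ I := Module.Finite.iff_fg.2 hI
  have : IsAddTorsionFree V := IsAddTorsionFree.of_module_rat V
  let B := Module.finBasis ℤ I
  have hli : LinearIndependent ℤ fun i => (B i : V) :=
    B.linearIndependent.map' I.subtype (Submodule.ker_subtype I)
  have hli' : LinearIndependent ℚ fun i => (B i : V) :=
    (LinearIndependent.iff_fractionRing ℤ ℚ).1 hli
  have hspan : I = Submodule.span ℤ (Set.range fun i => (B i : V)) := by
    have := congrArg (Submodule.map I.subtype) B.span_eq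
    rw [Submodule.map_span, Submodule.map_top, Submodule.range_subtype, ← Set.range_comp] at this
    exact this.symm
  have hrat : Submodule.span ℚ (Set.range fun i => (B i : V)) = rat I := by
    conv_rhs => rw [hspan]
    exact (Submodule.span_span_of_tower ℤ ℚ _).symm
  rw [← hrat, finrank_span_eq_card hli', Fintype.card_fin]

theorem isotropic_rat (hiso : ∀ x ∈ I, ∀ y ∈ I, b x y = 0) {x y : V} (hx : x ∈ rat I)
    (hy : y ∈ rat I) : b x y = 0 := by
  refine eq_zero_of_forall_mem_rat (fun y hy => ?_) hy
  obtain ⟨n, hn, hnx⟩ := exists_zsmul_mem hx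
  have := hiso _ hnx y hy
  rw [bilin_zsmul_left] at this
  exact (mul_eq_zero.1 this).resolve_left (by exact_mod_cast hn)

theorem mem_ratPerp (hb : b.IsSymm) {x : V} :
    x ∈ ratPerp b L I ↔ x ∈ rat L ∧ ∀ y ∈ rat I, b x y = 0 := by
  refine ⟨fun h => ⟨h.1, fun y hy => (perp_rat b L I ⟨x, h⟩ y hy).1⟩, fun h => ⟨h.1, fun y hy => ?_⟩⟩
  have := h.2 y (le_rat hy)
  exact ⟨this, hb.eq x y ▸ this⟩

/-! ### Maximal isotropic sublattices and their orthogonal spaces -/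

theorem IsMaximalIsotropic.fg (hL : IsEvenLattice b L) (hI : IsMaximalIsotropic b L p I) : I.FG :=
  hL.fg.of_le hI.le

theorem IsMaximalIsotropic.rat_le_ratPerp (hb : b.IsSymm) (hI : IsMaximalIsotropic b L p I) :
    rat I ≤ ratPerp b L I := fun _ hx =>
  (mem_ratPerp hb).2 ⟨rat_mono hI.le hx, fun _ hy => isotropic_rat hI.isotropic hx hy⟩

/-- A vector of `I^⊥` which is not in `I_ℚ` has negative norm. -/
theorem IsMaximalIsotropic.mem_rat_of_nonneg (hb : b.IsSymm) (hL : IsEvenLattice b L)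
    (hsig : HasSignature b L p q) (hI : IsMaximalIsotropic b L p I) {x : V}
    (hx : x ∈ ratPerp b L I) (h0 : 0 ≤ b x x) : x ∈ rat I := by
  have := finiteDimensional_rat hL.fg
  -- `I_ℚ + ℚx` is positive semidefinite, so its dimension is at most `p = rank I`, and it coincides
  -- with `I_ℚ`.
  let U := rat I ⊔ Submodule.span ℚ {x}
  have hUL : U ≤ rat L := sup_le (rat_mono hI.le) (by
    rw [Submodule.span_singleton_le_iff_mem]
    exact hx.1)
  have hU : ∀ y ∈ U, 0 ≤ b y y := by
    intro y hy
    obtain ⟨i, hi, z, hz, rfl⟩ := Submodule.mem_sup.1 hy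
    obtain ⟨c, rfl⟩ := Submodule.mem_span_singleton.1 hz
    have h1 := (perp_rat b L I ⟨x, hx⟩ i hi)
    simp only at h1
    simp only [map_add, LinearMap.add_apply, map_smul, LinearMap.smul_apply, h1.1, h1.2,
      isotropic_rat hI.isotropic hi hi, smul_eq_mul, mul_zero, zero_add]
    have := mul_nonneg (mul_self_nonneg c) h0
    linarith
  have h1 := finrank_le_of_nonneg hb hL hUL hU
  rw [hsig.1, ← hI.rank, ← finrank_rat (hI.fg hL)] at h1
  have : FiniteDimensional ℚ U := Submodule.finiteDimensional_of_le hUL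
  have h2 : rat I = U := Submodule.eq_of_le_of_finrank_le le_sup_left h1
  rw [h2]
  exact le_sup_right (a := rat I) (Submodule.mem_span_singleton_self x)

theorem finrank_ratPerp (hb : b.IsSymm) (hL : IsEvenLattice b L) (hIL : I ≤ L) :
    Module.finrank ℚ (ratPerp b L I) = Module.finrank ℚ (rat L) - Module.finrank ℚ (rat I) := by
  have := finiteDimensional_rat hL.fg
  have h := LinearMap.BilinForm.finrank_orthogonal (restrict_nondegenerate hb hL)
    ((rat I).submoduleOf (rat L))
  rw [(Submodule.submoduleOfEquivOfLe (rat_mono hIL)).finrank_eq] at h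
  rw [← h]
  have h2 : (ratPerp b L I).submoduleOf (rat L) =
      (b.restrict (rat L)).orthogonal ((rat I).submoduleOf (rat L)) := by
    ext x
    rw [LinearMap.BilinForm.mem_orthogonal_iff]
    refine ⟨fun hx y hy => ?_, fun hx => (mem_ratPerp hb).2 ⟨x.2, fun y hy => ?_⟩⟩
    · exact (hb.eq _ _).trans (((mem_ratPerp hb).1 hx).2 y hy)
    · exact (hb.eq _ _).trans (hx ⟨y, rat_mono hIL hy⟩ hy)
  rw [← h2, (Submodule.submoduleOfEquivOfLe (show ratPerp b L I ≤ rat L from inf_le_left)).finrank_eq]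

/-- The double orthogonal complement of `I_ℚ`. -/
theorem mem_rat_of_orthogonal (hb : b.IsSymm) (hL : IsEvenLattice b L) (hIL : I ≤ L) {x : V}
    (hx : x ∈ rat L) (h : ∀ y ∈ ratPerp b L I, b x y = 0) : x ∈ rat I := by
  have := finiteDimensional_rat hL.fg
  have h1 := LinearMap.BilinForm.orthogonal_orthogonal (restrict_nondegenerate hb hL)
    (hb.restrict (rat L)).isRefl ((rat I).submoduleOf (rat L))
  have h2 : (⟨x, hx⟩ : rat L) ∈ (rat I).submoduleOf (rat L) := by
    rw [← h1, LinearMap.BilinForm.mem_orthogonal_iff]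
    intro y hy
    rw [LinearMap.BilinForm.mem_orthogonal_iff] at hy
    refine (hb.eq _ _).trans (h y ((mem_ratPerp hb).2 ⟨y.2, fun z hz => ?_⟩))
    exact (hb.eq _ _).trans (hy ⟨z, rat_mono hIL hz⟩ hz)
  exact h2

/-! ### The orthogonal complement of a sublattice -/

theorem mem_orthIn (hb : b.IsSymm) {x : V} :
    x ∈ orthIn b L L' ↔ x ∈ L ∧ ∀ y ∈ L', b x y = 0 := by
  refine ⟨fun h => ⟨h.1, fun y hy => (h.2 y hy).1⟩, fun h => ⟨h.1, fun y hy => ?_⟩⟩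
  exact ⟨h.2 y hy, (hb.eq _ _).trans (h.2 y hy)⟩

theorem mem_rat_orthIn (hb : b.IsSymm) {x : V} :
    x ∈ rat (orthIn b L L') ↔ x ∈ rat L ∧ ∀ y ∈ rat L', b x y = 0 := by
  constructor
  · intro h
    refine ⟨rat_mono (L₁ := orthIn b L L') (fun _ h => h.1) h, fun y hy =>
      eq_zero_of_forall_mem_rat (fun y hy => ?_) hy⟩
    obtain ⟨n, hn, hnx⟩ := exists_zsmul_mem h
    have := ((mem_orthIn hb).1 hnx).2 y hy
    rw [bilin_zsmul_left] at this
    exact (mul_eq_zero.1 this).resolve_left (by exact_mod_cast hn)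
  · rintro ⟨hx, h⟩
    obtain ⟨n, hn, hnx⟩ := exists_zsmul_mem hx
    refine mem_of_zsmul_mem hn (le_rat ((mem_orthIn hb).2 ⟨hnx, fun y hy => ?_⟩))
    rw [bilin_zsmul_left, h y (le_rat hy), mul_zero]

/-- `L_ℚ = L'_ℚ + N_ℚ`. -/
theorem exists_add_of_mem_rat (hb : b.IsSymm) (hL' : IsEvenLattice b L') (hle : L' ≤ L) {z : V}
    (hz : z ∈ rat L) : ∃ x ∈ rat L', ∃ y ∈ rat (orthIn b L L'), x + y = z := by
  obtain ⟨n, v, w, hv, hw, hvw⟩ := exists_dual_basis hb hL'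
  -- The orthogonal projection of `z` to `L'_ℚ`, written in the dual basis.
  let x := ∑ i, b z (v i) • w i
  have hx : x ∈ rat L' := Submodule.sum_mem _ fun i _ => Submodule.smul_mem _ _ (hw i)
  refine ⟨x, hx, z - x, (mem_rat_orthIn hb).2 ⟨(rat L).sub_mem hz (rat_mono hle hx), ?_⟩,
    add_sub_cancel _ _⟩
  refine fun y hy => eq_zero_of_forall_mem_rat (fun y hy => ?_) hy
  rw [hv] at hy
  induction hy using Submodule.span_induction with
  | mem y hy =>
    obtain ⟨j, rfl⟩ := hy
    simp [x, hvw]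
  | zero => simp
  | add x y _ _ ihx ihy => rw [map_add, ihx, ihy, add_zero]
  | smul c x _ ihx => rw [bilin_zsmul_right, ihx, mul_zero]

theorem inf_orthIn_eq_bot (hb : b.IsSymm) (hL' : IsEvenLattice b L') {x : V} (hx : x ∈ rat L')
    (hx' : x ∈ rat (orthIn b L L')) : x = 0 :=
  hL'.rat_nondegenerate hx fun y hy => ((mem_rat_orthIn hb).1 hx').2 y (le_rat hy)

theorem finrank_rat_orthIn (hb : b.IsSymm) (hL : IsEvenLattice b L) (hL' : IsEvenLattice b L')
    (hle : L' ≤ L) :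
    Module.finrank ℚ (rat L') + Module.finrank ℚ (rat (orthIn b L L')) =
      Module.finrank ℚ (rat L) := by
  have := finiteDimensional_rat hL.fg
  have := finiteDimensional_rat hL'.fg
  have hN : rat (orthIn b L L') ≤ rat L := rat_mono fun _ h => h.1
  have : FiniteDimensional ℚ (rat (orthIn b L L')) := Submodule.finiteDimensional_of_le hN
  rw [← Submodule.finrank_sup_add_finrank_inf_eq]
  have h1 : rat L' ⊔ rat (orthIn b L L') = rat L := by
    refine le_antisymm (sup_le (rat_mono hle) hN) fun z hz => ?_
    obtain ⟨x, hx, y, hy, rfl⟩ := exists_add_of_mem_rat hb hL' hle hz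
    exact Submodule.add_mem_sup hx hy
  have h2 : rat L' ⊓ rat (orthIn b L L') = ⊥ := by
    rw [Submodule.eq_bot_iff]
    exact fun x hx => inf_orthIn_eq_bot hb hL' hx.1 hx.2
  rw [h1, h2, finrank_bot, add_zero]

/-- A nonzero `x ∈ N_ℚ` with `(x, x) ≥ 0`, joined to a positive subspace of `L'_ℚ` of maximal
dimension, would span a positive semidefinite subspace of `L_ℚ` larger than the positive index
allows. -/
theorem negDef_orthIn (hb : b.IsSymm) (hL : IsEvenLattice b L) (hL' : IsEvenLattice b L')
    (hle : L' ≤ L) (hsig : sigPos (ratForm b L') = sigPos (ratForm b L)) :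
    NegDef b (orthIn b L L') := by
  intro x hx hx0
  by_contra hneg
  have h0 : 0 ≤ b x x := not_lt.1 hneg
  have := finiteDimensional_rat hL.fg
  have := finiteDimensional_rat hL'.fg
  obtain ⟨W, hW, hpos⟩ := exists_finrank_eq_sigPos_and_posDef (ratForm b L')
  let P : Submodule ℚ V := W.map (rat L').subtype
  have hPr : Module.finrank ℚ P = sigPos (ratForm b L') := by
    rw [← hW]
    exact (Submodule.equivSubtypeMap (rat L') W).symm.finrank_eq
  have hPL' : P ≤ rat L' := Submodule.map_subtype_le _ _
  have hPpos : ∀ y ∈ P, 0 ≤ b y y := by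
    rintro _ ⟨y, hy, rfl⟩
    by_cases h : (⟨y, hy⟩ : W) = 0
    · have : y = 0 := congrArg Subtype.val h
      simp [this]
    · exact (hpos ⟨y, hy⟩ h).le
  let U := P ⊔ Submodule.span ℚ {x}
  have hxo := (mem_rat_orthIn hb).1 hx
  have hUL : U ≤ rat L := sup_le (hPL'.trans (rat_mono hle)) (by
    rw [Submodule.span_singleton_le_iff_mem]
    exact hxo.1)
  have hU : ∀ y ∈ U, 0 ≤ b y y := by
    intro y hy
    obtain ⟨i, hi, z, hz, rfl⟩ := Submodule.mem_sup.1 hy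
    obtain ⟨c, rfl⟩ := Submodule.mem_span_singleton.1 hz
    have h1 := hxo.2 i (hPL' hi)
    have h2 : b i x = 0 := (hb.eq _ _).trans h1
    simp only [map_add, LinearMap.add_apply, map_smul, LinearMap.smul_apply, h1, h2,
      smul_eq_mul, mul_zero, zero_add, add_zero]
    have := mul_nonneg (mul_self_nonneg c) h0
    have := hPpos i hi
    linarith
  have h1 := finrank_le_of_nonneg hb hL hUL hU
  rw [← hsig, ← hPr] at h1
  have : FiniteDimensional ℚ U := Submodule.finiteDimensional_of_le hUL
  have h2 : P = U := Submodule.eq_of_le_of_finrank_le le_sup_left h1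
  have h3 : x ∈ P := by
    rw [h2]
    exact le_sup_right (a := P) (Submodule.mem_span_singleton_self x)
  exact hx0 (inf_orthIn_eq_bot hb hL' (hPL' h3) hx)

theorem NegDef.isEvenLattice {N : Submodule ℤ V} (hN : NegDef b N) (hL : IsEvenLattice b L)
    (h : N ≤ L) : IsEvenLattice b N :=
  hL.of_le h fun x hx hx0 => by
    by_contra hne
    have := hN x (le_rat hx) hne
    rw [hx0 x hx] at this
    exact lt_irrefl _ this

theorem sup_orthIn_le (hle : L' ≤ L) : L' ⊔ orthIn b L L' ≤ L := sup_le hle inf_le_left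

theorem rat_le_rat_sup_orthIn (hb : b.IsSymm) (hL' : IsEvenLattice b L') (hle : L' ≤ L) :
    rat L ≤ rat (L' ⊔ orthIn b L L') := fun z hz => by
  obtain ⟨x, hx, y, hy, rfl⟩ := exists_add_of_mem_rat hb hL' hle hz
  exact Submodule.add_mem _ (rat_mono le_sup_left hx) (rat_mono le_sup_right hy)

theorem isEvenLattice_sup_orthIn (hb : b.IsSymm) (hL : IsEvenLattice b L)
    (hL' : IsEvenLattice b L') (hle : L' ≤ L) : IsEvenLattice b (L' ⊔ orthIn b L L') :=
  hL.of_le (sup_orthIn_le hle) fun _ hx h =>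
    hL.rat_nondegenerate (le_rat (sup_orthIn_le hle hx)) fun _ hy =>
      eq_zero_of_forall_mem_rat h (rat_le_rat_sup_orthIn hb hL' hle (le_rat hy))

end Signature

open GroupSpace

/-! ### The lattices `L^*` and `K` -/

/-- An integral linear form on a primitive sublattice extends. -/
theorem exists_extension {V : Type*} [AddCommGroup V] {A M : Submodule ℤ V} (hM : M.FG)
    (hA : A ≤ M) (hprim : ∀ x ∈ M, ∀ n : ℤ, n ≠ 0 → n • x ∈ A → x ∈ A) (φ : A →ₗ[ℤ] ℤ) :
    ∃ ψ : M →ₗ[ℤ] ℤ, ∀ a : A, ψ ⟨a, hA a.2⟩ = φ a := by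
  have : Module.Finite ℤ M := Module.Finite.iff_fg.2 hM
  let A' := A.submoduleOf M
  have : IsAddTorsionFree (M ⧸ A') := by
    rw [← Module.isTorsionFree_int_iff_isAddTorsionFree]
    rw [Module.isTorsionFree_iff_smul_eq_zero]
    intro n c hc
    by_contra! hne
    obtain ⟨x, rfl⟩ := A'.mkQ_surjective c
    rw [← map_zsmul] at hc
    have h1 : n • x ∈ A' := (Submodule.Quotient.mk_eq_zero A').1 hc
    exact hne.2 ((Submodule.Quotient.mk_eq_zero A').2 (hprim x x.2 n hne.1 h1))
  have : Module.Free ℤ (M ⧸ A') := Module.free_of_finite_type_torsion_free'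
  -- Primitivity makes `M / A` torsion free, hence free. A section `s` gives the retraction `m ↦ m -
  -- s[m]` of `M` onto `A`, and composing `φ` with it extends `φ`.
  obtain ⟨s, hs⟩ := Module.projective_lifting_property A'.mkQ LinearMap.id A'.mkQ_surjective
  have hmem (m : M) : ((m - s (A'.mkQ m) : M) : V) ∈ A := by
    have : m - s (A'.mkQ m) ∈ A' := by
      rw [← Submodule.Quotient.mk_eq_zero]
      have h1 := LinearMap.congr_fun hs (A'.mkQ m)
      change A'.mkQ (m - s (A'.mkQ m)) = 0
      rw [map_sub]
      exact sub_eq_zero.2 h1.symm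
    exact this
  let r : M →ₗ[ℤ] A := (M.subtype ∘ₗ (LinearMap.id - s ∘ₗ A'.mkQ)).codRestrict A hmem
  refine ⟨φ ∘ₗ r, fun a => ?_⟩
  have h0 : A'.mkQ ⟨a, hA a.2⟩ = 0 := (Submodule.Quotient.mk_eq_zero A').2 a.2
  have : r ⟨a, hA a.2⟩ = a := by
    refine Subtype.ext ?_
    change ((⟨a, hA a.2⟩ - s (A'.mkQ ⟨a, hA a.2⟩) : M) : V) = a
    rw [h0, map_zero, sub_zero]
  rw [LinearMap.comp_apply, this]

section Reduction

variable {V : Type*} [AddCommGroup V] [Module ℚ V] {b : LinearMap.BilinForm ℚ V}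
  {L I : Submodule ℤ V} {p q : ℕ}

theorem mem_starI {x : V} : x ∈ starI b L I ↔ x ∈ rat I ∧ x ∈ dual b L := Iff.rfl

theorem le_starL : L ≤ starL b L I := le_sup_left

theorem starI_le_dual : starI b L I ≤ dual b L := inf_le_right

theorem rat_starL_le : rat (starL b L I) ≤ rat L := by
  rw [Submodule.span_le]
  intro x hx
  obtain ⟨l, hl, i, hi, rfl⟩ := Submodule.mem_sup.1 hx
  exact (rat L).add_mem (le_rat hl) (mem_dual.1 hi.2).1

/-- `I^*` is isotropic and contained in `L^∨`. Thus the cross terms with `L` are integers, and the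
norm `(l + i, l + i) = (l, l) + 2(l, i)` is even. -/
theorem isEvenLattice_starL (hb : b.IsSymm) (hL : IsEvenLattice b L)
    (hI : IsMaximalIsotropic b L p I) : IsEvenLattice b (starL b L I) where
  fg := hL.fg.sup ((dual_fg hb hL).of_le starI_le_dual)
  integral x hx y hy := by
    obtain ⟨l, hl, i, hi, rfl⟩ := Submodule.mem_sup.1 hx
    obtain ⟨l', hl', i', hi', rfl⟩ := Submodule.mem_sup.1 hy
    obtain ⟨n₁, h₁⟩ := hL.integral l hl l' hl'
    obtain ⟨n₂, h₂⟩ := dual_int_right hb hi'.2 hl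
    obtain ⟨n₃, h₃⟩ := dual_int_left hi.2 hl'
    refine ⟨n₁ + n₂ + n₃, ?_⟩
    simp only [map_add, LinearMap.add_apply, h₁, h₂, h₃,
      isotropic_rat hI.isotropic hi.1 hi'.1]
    push_cast
    ring
  even x hx := by
    obtain ⟨l, hl, i, hi, rfl⟩ := Submodule.mem_sup.1 hx
    obtain ⟨n₁, h₁⟩ := hL.even l hl
    obtain ⟨n₂, h₂⟩ := dual_int_right hb hi.2 hl
    refine ⟨n₁ + n₂, ?_⟩
    simp only [map_add, LinearMap.add_apply, h₁, h₂, isotropic_rat hI.isotropic hi.1 hi.1,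
      hb.eq i l]
    push_cast
    ring
  nondegenerate x hx h :=
    hL.rat_nondegenerate (rat_starL_le (le_rat hx)) fun y hy => h y (le_starL hy)

theorem mem_dual_starL (hb : b.IsSymm) {x : V} (hx : x ∈ dual b L) (hp : x ∈ ratPerp b L I) :
    x ∈ dual b (starL b L I) := by
  refine mem_dual.2 ⟨rat_mono le_starL (mem_dual.1 hx).1, fun l hl => ?_⟩
  obtain ⟨l, hl₁, i, hi, rfl⟩ := Submodule.mem_sup.1 hl
  rw [map_add, ((mem_ratPerp hb).1 hp).2 i hi.1, add_zero]
  exact dual_int_left hx hl₁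

/-- Every class in the discriminant group of `L^*` meets `I^⊥`. -/
theorem exists_ratPerp_sub_mem (hb : b.IsSymm) (hL : IsEvenLattice b L) (hIL : I ≤ L) {x : V}
    (hx : x ∈ dual b (starL b L I)) : ∃ y ∈ ratPerp b L I, y - x ∈ L := by
  have hxi : ∀ i ∈ starI b L I, ∃ n : ℤ, b x i = n := fun i hi =>
    dual_int_left hx (Submodule.mem_sup_right hi)
  have hxL : x ∈ rat L := rat_starL_le (mem_dual.1 hx).1
  choose! f hf using hxi
  let φ : starI b L I →ₗ[ℤ] ℤ := AddMonoidHom.toIntLinearMap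
    { toFun := fun i => f i
      map_zero' := by
        have := hf 0 (Submodule.zero_mem _)
        rw [map_zero] at this
        exact_mod_cast this.symm
      map_add' := fun i j => by
        have := hf (i + j : V) (Submodule.add_mem _ i.2 j.2)
        rw [map_add, hf i i.2, hf j j.2] at this
        exact_mod_cast this.symm }
  -- `I^*` is primitive in `L^∨`, so the integral form `(x, ·)` on `I^*` extends to `L^∨`. An
  -- integral form on `L^∨` is the pairing with some `z ∈ L^{∨∨} = L`, and then `x - z` is
  -- orthogonal to `I`.
  obtain ⟨ψ, hψ⟩ := exists_extension (dual_fg hb hL) (starI_le_dual (I := I))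
    (fun y hy n hn hny => ⟨mem_of_zsmul_mem hn hny.1, hy⟩) φ
  obtain ⟨z, hz, hzL⟩ := exists_mem_dual hb hL (ψ ∘ₗ Submodule.inclusion hL.le_dual)
  -- By construction `z` represents `ψ` only on `L`; clearing denominators gives the same on `L^∨`.
  have hzd : ∀ m (hm : m ∈ dual b L), b z m = ψ ⟨m, hm⟩ := by
    intro m hm
    obtain ⟨n, hn, hnm⟩ := exists_zsmul_mem (mem_dual.1 hm).1
    have h1 := hzL ⟨n • m, hnm⟩
    have h2 : Submodule.inclusion hL.le_dual ⟨n • m, hnm⟩ = n • (⟨m, hm⟩ : dual b L) := rfl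
    rw [LinearMap.comp_apply, h2, LinearMap.map_smul, smul_eq_mul, Int.cast_mul] at h1
    rw [bilin_zsmul_right] at h1
    exact mul_left_cancel₀ (by exact_mod_cast hn) h1
  have hzLmem : z ∈ L := mem_of_forall_dual hb hL (mem_dual.1 hz).1 fun y hy => ⟨_, hzd y hy⟩
  refine ⟨x - z, (mem_ratPerp hb).2 ⟨(rat L).sub_mem hxL (le_rat hzLmem), fun y hy => ?_⟩, ?_⟩
  · obtain ⟨n, hn, hny⟩ : ∃ n : ℤ, n ≠ 0 ∧ n • y ∈ starI b L I := by
      obtain ⟨n, hn, hny⟩ := exists_zsmul_mem hy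
      exact ⟨n, hn, zsmul_mem_rat n hy, hL.le_dual (hIL hny)⟩
    have h1 : b (x - z) (n • y) = 0 := by
      rw [map_sub, LinearMap.sub_apply, hf _ hny, hzd _ hny.2, sub_eq_zero]
      exact_mod_cast (hψ ⟨_, hny⟩).symm
    rw [bilin_zsmul_right] at h1
    exact (mul_eq_zero.1 h1).resolve_left (by exact_mod_cast hn)
  · simpa using hzLmem

/-- The map `I^⊥ ∩ L_ℚ → K_ℚ`. -/
abbrev toRed (b : LinearMap.BilinForm ℚ V) (L I : Submodule ℤ V) :
    ratPerp b L I →ₗ[ℚ] redSpace b L I := (ratIn b L I).mkQ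

theorem toRed_eq_iff {x y : ratPerp b L I} :
    toRed b L I x = toRed b L I y ↔ (x - y : V) ∈ rat I := Submodule.Quotient.eq _

theorem redForm_toRed (x y : ratPerp b L I) :
    redForm b L I (toRed b L I x) (toRed b L I y) = b x y := rfl

theorem mem_redLattice {k : redSpace b L I} :
    k ∈ redLattice b L I ↔ ∃ x : ratPerp b L I, (x : V) ∈ L ∧ toRed b L I x = k := Iff.rfl

theorem redForm_isSymm (hb : b.IsSymm) : (redForm b L I).IsSymm := by
  refine ⟨fun k l => ?_⟩
  obtain ⟨x, rfl⟩ := (ratIn b L I).mkQ_surjective k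
  obtain ⟨y, rfl⟩ := (ratIn b L I).mkQ_surjective l
  exact hb.eq x y

theorem rat_redLattice (k : redSpace b L I) : k ∈ rat (redLattice b L I) := by
  obtain ⟨x, rfl⟩ := (ratIn b L I).mkQ_surjective k
  obtain ⟨n, hn, hnx⟩ := exists_zsmul_mem x.2.1
  refine mem_of_zsmul_mem hn (le_rat ⟨n • x, hnx, ?_⟩)
  exact map_zsmul (toRed b L I) n x

theorem negDef_red (hb : b.IsSymm) (hL : IsEvenLattice b L) (hsig : HasSignature b L p q)
    (hI : IsMaximalIsotropic b L p I) : NegDef (redForm b L I) (redLattice b L I) := by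
  intro k _ hk
  obtain ⟨x, rfl⟩ := (ratIn b L I).mkQ_surjective k
  by_contra hneg
  refine hk ((Submodule.Quotient.mk_eq_zero _).2 ?_)
  exact hI.mem_rat_of_nonneg hb hL hsig x.2 (not_lt.1 hneg)

theorem isEvenLattice_red (hb : b.IsSymm) (hL : IsEvenLattice b L) (hsig : HasSignature b L p q)
    (hI : IsMaximalIsotropic b L p I) : IsEvenLattice (redForm b L I) (redLattice b L I) where
  fg := by
    refine Submodule.FG.map _ ?_
    have h1 : (L.comap ((ratPerp b L I).subtype.restrictScalars ℤ)).map
        ((ratPerp b L I).subtype.restrictScalars ℤ) ≤ L := Submodule.map_comap_le _ _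
    exact Submodule.fg_of_fg_map_injective _ Subtype.val_injective (hL.fg.of_le h1)
  integral := by
    rintro _ ⟨x, hx, rfl⟩ _ ⟨y, hy, rfl⟩
    exact hL.integral x hx y hy
  even := by
    rintro _ ⟨x, hx, rfl⟩
    exact hL.even x hx
  nondegenerate k hk h := by
    by_contra hne
    have := negDef_red hb hL hsig hI k (le_rat hk) hne
    rw [h k hk] at this
    exact lt_irrefl _ this

/-- `σ(L) = - rank K`. -/
theorem sigma_eq_neg_finrank_red (hb : b.IsSymm) (hL : IsEvenLattice b L)
    (hsig : HasSignature b L p q) (hI : IsMaximalIsotropic b L p I) :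
    sigma b L = -(Module.finrank ℚ (redSpace b L I) : ℤ) := by
  have := finiteDimensional_rat hL.fg
  have : FiniteDimensional ℚ (ratPerp b L I) :=
    Submodule.finiteDimensional_of_le (show ratPerp b L I ≤ rat L from inf_le_left)
  have h1 := sigPos_add_sigNeg hb hL
  have h2 := finrank_ratPerp hb hL hI.le
  have h3 := Submodule.finrank_quotient_add_finrank (ratIn b L I)
  rw [ratIn, (Submodule.submoduleOfEquivOfLe (hI.rat_le_ratPerp hb)).finrank_eq] at h3
  rw [finrank_rat (hI.fg hL), hI.rank] at h2 h3
  change Module.finrank ℚ (redSpace b L I) + p = _ at h3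
  -- The count is `dim K_ℚ = (p + q) - p - p = q - p`.
  rw [sigma, hsig.1, hsig.2]
  rw [hsig.1, hsig.2] at h1
  omega

theorem toRed_mem_dual {x : ratPerp b L I} (hx : (x : V) ∈ dual b L) :
    toRed b L I x ∈ dual (redForm b L I) (redLattice b L I) := by
  refine mem_dual.2 ⟨rat_redLattice _, ?_⟩
  rintro _ ⟨y, hy, rfl⟩
  exact (mem_dual.1 hx).2 y hy

/-- Vectors of `K^∨` lift to `L^∨ ∩ I^⊥`. -/
theorem exists_lift_dual_red (hb : b.IsSymm) (hL : IsEvenLattice b L)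
    (hI : IsMaximalIsotropic b L p I) {k : redSpace b L I}
    (hk : k ∈ dual (redForm b L I) (redLattice b L I)) :
    ∃ x : ratPerp b L I, (x : V) ∈ dual b L ∧ toRed b L I x = k := by
  obtain ⟨x₀, rfl⟩ := (ratIn b L I).mkQ_surjective k
  -- `(x₀, ·)` is integral on the primitive sublattice `L ∩ I^⊥`, hence extends to `L` and is
  -- represented by some `z ∈ L^∨`. Then `z - x₀` is orthogonal to `I^⊥`, so it lies in the double
  -- complement `I_ℚ` and `z` is the lift sought.
  let A : Submodule ℤ V := L ⊓ (ratPerp b L I).restrictScalars ℤ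
  have hx₀ : ∀ a ∈ A, ∃ n : ℤ, b x₀ a = n := fun a ha =>
    (mem_dual.1 hk).2 (toRed b L I ⟨a, ha.2⟩) ⟨⟨a, ha.2⟩, ha.1, rfl⟩
  choose! f hf using hx₀
  let φ : A →ₗ[ℤ] ℤ := AddMonoidHom.toIntLinearMap
    { toFun := fun i => f i
      map_zero' := by
        have := hf 0 (Submodule.zero_mem _)
        rw [map_zero] at this
        exact_mod_cast this.symm
      map_add' := fun i j => by
        have := hf (i + j : V) (Submodule.add_mem _ i.2 j.2)
        rw [map_add, hf i i.2, hf j j.2] at this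
        exact_mod_cast this.symm }
  obtain ⟨ψ, hψ⟩ := exists_extension hL.fg (inf_le_left : A ≤ L)
    (fun y hy n hn hny => ⟨hy, mem_of_zsmul_mem hn hny.2⟩) φ
  obtain ⟨z, hz, hzL⟩ := exists_mem_dual hb hL ψ
  have hdiff : z - x₀ ∈ rat I := by
    refine mem_rat_of_orthogonal hb hL hI.le ((rat L).sub_mem (mem_dual.1 hz).1 x₀.2.1)
      fun y hy => ?_
    obtain ⟨n, hn, hny⟩ := exists_zsmul_mem hy.1
    have hA : n • y ∈ A := ⟨hny, zsmul_mem_rat n hy⟩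
    have h1 : b (z - x₀) (n • y) = 0 := by
      rw [map_sub, LinearMap.sub_apply, hf _ hA, hzL ⟨_, hny⟩, sub_eq_zero]
      exact_mod_cast hψ ⟨_, hA⟩
    rw [bilin_zsmul_right] at h1
    exact (mul_eq_zero.1 h1).resolve_left (by exact_mod_cast hn)
  have hzp : z ∈ ratPerp b L I := by
    have := (ratPerp b L I).add_mem (hI.rat_le_ratPerp hb hdiff) x₀.2
    rwa [sub_add_cancel] at this
  exact ⟨⟨z, hzp⟩, hz, toRed_eq_iff.2 hdiff⟩

/-- A difference of representatives in `L^* ∩ I^⊥` has the form `a + i` with `i ∈ I^*` and `a ∈ L ∩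
I^⊥`; modulo `I_ℚ` only the class of `a` is left, and it lies in `K`. -/
theorem DiscIso.unique_right (hb : b.IsSymm) (hI : IsMaximalIsotropic b L p I)
    {l : disc b (starL b L I)} {k k' : disc (redForm b L I) (redLattice b L I)}
    (h : DiscIso b L I l k) (h' : DiscIso b L I l k') : k = k' := by
  obtain ⟨x, hxl, hxk⟩ := h
  obtain ⟨y, hyl, hyk⟩ := h'
  refine Subtype.ext ?_
  rw [← hxk, ← hyk]
  refine (Submodule.Quotient.eq _).2 ?_
  have h1 : (x - y : V) ∈ starL b L I := (Submodule.Quotient.eq _).1 (hxl.trans hyl.symm)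
  obtain ⟨a, ha, i, hi, hai⟩ := Submodule.mem_sup.1 h1
  have hap : a ∈ ratPerp b L I := by
    have := (ratPerp b L I).sub_mem (x - y).2 (hI.rat_le_ratPerp hb hi.1)
    rw [Submodule.coe_sub, ← hai, add_sub_cancel_right] at this
    exact this
  refine ⟨⟨a, hap⟩, ha, ?_⟩
  refine (toRed_eq_iff (x := ⟨a, hap⟩) (y := x - y)).2 ?_
  rw [Submodule.coe_sub, ← hai]
  simpa using (rat I).neg_mem hi.1

/-- If `x` and `y` agree modulo `K`, then `x - y = a + i` with `a ∈ L` and `i ∈ I_ℚ`. Since `x`,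
`y`, `a` all lie in `L^∨`, so does `i`; hence `i ∈ I^*`. -/
theorem DiscIso.unique_left (hb : b.IsSymm) (hL : IsEvenLattice b L)
    (hI : IsMaximalIsotropic b L p I) {l l' : disc b (starL b L I)}
    {k : disc (redForm b L I) (redLattice b L I)}
    (h : DiscIso b L I l k) (h' : DiscIso b L I l' k) : l = l' := by
  obtain ⟨x, hxl, hxk⟩ := h
  obtain ⟨y, hyl, hyk⟩ := h'
  have hS := isEvenLattice_starL hb hL hI
  have hd : ∀ {z : V} {l : disc b (starL b L I)}, (starL b L I).mkQ z = l → z ∈ dual b L :=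
    fun {z l} hz => dual_anti le_starL rat_starL_le ((mkQ_mem_disc hS).1 (hz ▸ l.2))
  refine Subtype.ext ?_
  rw [← hxl, ← hyl]
  refine (Submodule.Quotient.eq _).2 ?_
  have h1 : toRed b L I x - toRed b L I y ∈ redLattice b L I :=
    (Submodule.Quotient.eq _).1 (hxk.trans hyk.symm)
  rw [← map_sub] at h1
  obtain ⟨a, ha, hax⟩ := mem_redLattice.1 h1
  have h2 := toRed_eq_iff.1 hax
  have h3 : (x - y : V) = a + -(a - (x - y)) := by abel
  rw [h3]
  refine Submodule.add_mem_sup ha (Submodule.neg_mem _ ⟨h2, ?_⟩)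
  exact Submodule.sub_mem _ (hL.le_dual ha) (Submodule.sub_mem _ (hd hxl) (hd hyl))

theorem DiscIso.exists_right (hb : b.IsSymm) (hL : IsEvenLattice b L)
    (hI : IsMaximalIsotropic b L p I) (l : disc b (starL b L I)) :
    ∃ k, DiscIso b L I l k := by
  have hS := isEvenLattice_starL hb hL hI
  obtain ⟨y, hy, hyx⟩ := exists_ratPerp_sub_mem hb hL hI.le (rep_mem_dual hS l)
  have hyl : (starL b L I).mkQ y = l := by
    rw [← mk_rep l]
    exact (Submodule.Quotient.eq _).2 (le_starL hyx)
  have hyd : y ∈ dual b L :=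
    dual_anti le_starL rat_starL_le ((mkQ_mem_disc hS).1 (hyl ▸ l.2))
  exact ⟨⟨_, _, toRed_mem_dual (x := ⟨y, hy⟩) hyd, rfl⟩, ⟨y, hy⟩, hyl, rfl⟩

theorem DiscIso.exists_left (hb : b.IsSymm) (hL : IsEvenLattice b L)
    (hI : IsMaximalIsotropic b L p I) (k : disc (redForm b L I) (redLattice b L I)) :
    ∃ l, DiscIso b L I l k := by
  obtain ⟨_, k, hk, rfl⟩ := k
  obtain ⟨x, hx, rfl⟩ := exists_lift_dual_red hb hL hI hk
  exact ⟨⟨_, x, mem_dual_starL hb hx x.2, rfl⟩, x, rfl, rfl⟩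

/-- The isomorphism `A_{L^*} ≃ A_K`. -/
theorem exists_equiv_disc (hb : b.IsSymm) (hL : IsEvenLattice b L)
    (hI : IsMaximalIsotropic b L p I) :
    ∃ φ : disc b (starL b L I) ≃ disc (redForm b L I) (redLattice b L I),
      ∀ l k, DiscIso b L I l k ↔ φ l = k := by
  choose f hf using DiscIso.exists_right hb hL hI
  have hbij : Function.Bijective f := by
    refine ⟨fun l l' h => DiscIso.unique_left hb hL hI (hf l) (h ▸ hf l'), fun k => ?_⟩
    obtain ⟨l, hl⟩ := DiscIso.exists_left hb hL hI k
    exact ⟨l, (hf l).unique_right hb hI hl⟩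
  refine ⟨Equiv.ofBijective f hbij, fun l k => ⟨fun h => (hf l).unique_right hb hI h, ?_⟩⟩
  rintro rfl
  exact hf l

theorem ext_pushK (hb : b.IsSymm) (hL : IsEvenLattice b L) (hsig : HasSignature b L p q)
    (hI : IsMaximalIsotropic b L p I) (v : GroupSpace (disc b L)) {x : ratPerp b L I}
    (hx : (x : V) ∈ dual b L) :
    ext (pushK b L I v) (toRed b L I x) = pushFun L (starL b L I) (ext v) x := by
  classical
  have hS := isEvenLattice_starL hb hL hI
  have hK := isEvenLattice_red hb hL hsig hI
  have := finite_disc hb hS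
  have := finite_disc (redForm_isSymm hb) hK
  obtain ⟨φ, hφ⟩ := exists_equiv_disc hb hL hI
  have hxS := mem_dual_starL hb hx x.2
  let l : disc b (starL b L I) := ⟨(starL b L I).mkQ x, x, hxS, rfl⟩
  let k : disc (redForm b L I) (redLattice b L I) :=
    ⟨(redLattice b L I).mkQ (toRed b L I x), _, toRed_mem_dual hx, rfl⟩
  have hlk : φ l = k := (hφ l k).1 ⟨x, rfl, rfl⟩
  rw [ext_of_mem _ (l := k) rfl, pushK, LinearMap.comp_apply, coeff_transfer,
    finsum_eq_single _ l]
  · rw [if_pos ((hφ l k).2 hlk), ← ext_pushforward hb hL hS le_starL v hxS,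
      ext_of_mem _ (l := l) rfl]
  · intro l' hl'
    refine if_neg fun h => hl' (φ.injective ?_)
    rw [hlk]
    exact (hφ _ _).1 h

/-- Pushforward to `L^*` preserves the law, and the bijection `A_{L^*} ≃ A_K` preserves pairings
because the form on `I^⊥` is insensitive to `I_ℚ`; the two Fourier transforms therefore agree term
by term. -/
theorem sLaw_pushK (hb : b.IsSymm) (hL : IsEvenLattice b L) (hsig : HasSignature b L p q)
    (hI : IsMaximalIsotropic b L p I) {c : ℂ} {v w : GroupSpace (disc b L)}
    (h : SLaw b L c (ext v) (ext w)) :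
    SLaw (redForm b L I) (redLattice b L I) c (ext (pushK b L I v)) (ext (pushK b L I w)) := by
  have hS := isEvenLattice_starL hb hL hI
  have hK := isEvenLattice_red hb hL hsig hI
  obtain ⟨φ, hφ⟩ := exists_equiv_disc hb hL hI
  intro k hk
  obtain ⟨x, hx, rfl⟩ := exists_lift_dual_red hb hL hI hk
  have hxS := mem_dual_starL hb hx x.2
  rw [ext_pushK hb hL hsig hI w hx,
    SLaw.pushFun hb hL hS le_starL rat_starL_le (periodic_ext v) h _ hxS, Nat.card_congr φ]
  congr 1
  rw [FT, FT, ← finsum_disc hS, ← finsum_disc hK, ← finsum_comp_equiv φ]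
  refine finsum_congr fun l => ?_
  -- A single `y ∈ I^⊥` represents both `l` and `φ l`; every factor on either side is moved to it by
  -- periodicity.
  obtain ⟨y, hyl, hyk⟩ := (hφ l (φ l)).2 rfl
  have hyS : (y : V) ∈ dual b (starL b L I) := (mkQ_mem_disc hS).1 (hyl ▸ l.2)
  have hyd : (y : V) ∈ dual b L := dual_anti le_starL rat_starL_le hyS
  have e1 : ext (pushK b L I v) (rep (φ l)) = ext (pushK b L I v) (toRed b L I y) :=
    ext_congr _ ((mk_rep _).trans hyk.symm)
  have e2 : pushFun L (starL b L I) (ext v) (rep l) = pushFun L (starL b L I) (ext v) y := by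
    rw [← ext_pushforward hb hL hS le_starL v (rep_mem_dual hS l),
      ← ext_pushforward hb hL hS le_starL v hyS]
    exact ext_congr _ ((mk_rep _).trans hyl.symm)
  have e3 : e (-(b (rep l) x)) = e (-(b y x)) := by
    have := periodic_character (b := b) (A := starL b L I) (z := x)
      (fun _ ha => dual_int_right hb hxS ha) y _
      ((Submodule.Quotient.eq _).1 ((mk_rep l).trans hyl.symm))
    simpa using this
  have e4 : e (-(redForm b L I (rep (φ l)) (toRed b L I x))) = e (-(b y x)) := by
    have := periodic_character (b := redForm b L I) (A := redLattice b L I) (z := toRed b L I x)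
      (fun _ ha => dual_int_right (redForm_isSymm hb) (toRed_mem_dual hx) ha) (toRed b L I y) _
      ((Submodule.Quotient.eq _).1 ((mk_rep (φ l)).trans hyk.symm))
    rwa [add_sub_cancel] at this
  rw [e1, e2, e3, e4, ext_pushK hb hL hsig hI v hyd]

end Reduction

/-! ### Products of one-dimensional theta series -/

theorem summable_norm_prod {n : ℕ} (f : Fin n → ℤ → ℂ) (hf : ∀ i, Summable fun k => ‖f i k‖) :
    Summable fun k : Fin n → ℤ => ‖∏ i, f i (k i)‖ := by
  induction n with
  | zero => exact Summable.of_finite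
  | succ n ih =>
    rw [← (Fin.consEquiv fun _ : Fin (n + 1) => ℤ).summable_iff]
    have h1 := (hf 0).mul_norm (ih (fun i => f i.succ) fun i => hf i.succ) 
    refine h1.congr fun x => ?_
    simp [Fin.consEquiv, Fin.prod_univ_succ]

theorem tsum_prod_eq_prod_tsum {n : ℕ} (f : Fin n → ℤ → ℂ)
    (hf : ∀ i, Summable fun k => ‖f i k‖) :
    ∑' k : Fin n → ℤ, ∏ i, f i (k i) = ∏ i, ∑' k, f i k := by
  induction n with
  | zero => simp
  | succ n ih =>
    rw [← (Fin.consEquiv fun _ : Fin (n + 1) => ℤ).tsum_eq, Fin.prod_univ_succ,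
      ← ih (fun i => f i.succ) fun i => hf i.succ,
      tsum_mul_tsum_of_summable_norm (hf 0) (summable_norm_prod _ fun i => hf i.succ)]
    refine tsum_congr fun x => ?_
    simp [Fin.consEquiv, Fin.prod_univ_succ]

/-- The term `exp(πiτk²/a)`. -/
def gaussTerm (a : ℕ) (τ : ℍ) (k : ℤ) : ℂ :=
  Complex.exp (Real.pi * Complex.I * (k ^ 2 / a : ℂ) * τ)

theorem norm_gaussTerm (a : ℕ) (τ : ℍ) (k : ℤ) :
    ‖gaussTerm a τ k‖ = Real.exp (-Real.pi * (τ.im / a) * k ^ 2) := by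
  rw [gaussTerm, Complex.norm_exp]
  congr 1
  have : (Real.pi * Complex.I * (k ^ 2 / a : ℂ) * τ : ℂ) =
      ((Real.pi * (k ^ 2 / a) : ℝ) : ℂ) * (Complex.I * τ) := by
    push_cast
    ring
  rw [this, Complex.re_ofReal_mul, Complex.I_mul_re, coe_im]
  ring

theorem summable_norm_gaussTerm {a : ℕ} (ha : 0 < a) (τ : ℍ) :
    Summable fun k => ‖gaussTerm a τ k‖ := by
  have hT : 0 < τ.im / a := div_pos τ.im_pos (by exact_mod_cast ha)
  refine (summable_pow_mul_jacobiTheta₂_term_bound 0 hT 0).congr fun k => ?_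
  rw [norm_gaussTerm]
  simp
  ring_nf

/-- The factor `√(-iτ)`. -/
def sqrtNegI (τ : ℍ) : ℂ := (-Complex.I * τ) ^ (1 / 2 : ℂ)

theorem negI_mul_ne_zero (τ : ℍ) : -Complex.I * (τ : ℂ) ≠ 0 :=
  mul_ne_zero (neg_ne_zero.2 Complex.I_ne_zero) (ne_zero τ)

theorem sqrtNegI_ne_zero (τ : ℍ) : sqrtNegI τ ≠ 0 := by
  rw [sqrtNegI, Complex.cpow_def_of_ne_zero (negI_mul_ne_zero τ)]
  exact Complex.exp_ne_zero _

theorem cpow_half_natCast_mul {a : ℕ} (ha : 0 < a) (τ : ℍ) :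
    (-Complex.I * (a * τ)) ^ (1 / 2 : ℂ) = (Real.sqrt a : ℂ) * sqrtNegI τ := by
  have ha' : (0 : ℝ) < a := by exact_mod_cast ha
  have h0 := negI_mul_ne_zero τ
  have h1 : -Complex.I * (a * τ) = ((a : ℝ) : ℂ) * (-Complex.I * τ) := by
    push_cast
    ring
  have h2 : ((a : ℝ) : ℂ) ≠ 0 := by exact_mod_cast ha'.ne'
  rw [h1, sqrtNegI, Complex.cpow_def_of_ne_zero (mul_ne_zero h2 h0),
    Complex.cpow_def_of_ne_zero h0, Complex.log_ofReal_mul ha' h0, add_mul, Complex.exp_add]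
  congr 1
  rw [Real.sqrt_eq_rpow, Complex.ofReal_cpow ha'.le, Complex.cpow_def_of_ne_zero h2,
    Complex.ofReal_log ha'.le]
  norm_num

/-- The one-dimensional theta inversion formula. -/
theorem tsum_character_gaussTerm {a : ℕ} (ha : 0 < a) (τ : ℍ) (r : ℤ) :
    ∑' k : ℤ, e (r * k / a) * gaussTerm a (ModularGroup.S • τ) k =
      Real.sqrt a * sqrtNegI τ * ∑' m : ℤ, gaussTerm a τ (r + a * m) := by
  have ha' : (a : ℂ) ≠ 0 := by exact_mod_cast ha.ne'
  have hτ := ne_zero τ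
  -- At `(rτ, aτ)` one side is the sum over `r + aℤ` without its factor `exp(πir²τ/a)`; the other is
  -- evaluated at `(r/a, -1/(aτ))`, which is the character sum.
  have hf := jacobiTheta₂_functional_equation (r * τ) (a * τ)
  have h1 : ∑' m : ℤ, gaussTerm a τ (r + a * m) =
      Complex.exp (Real.pi * Complex.I * r ^ 2 / a * τ) * jacobiTheta₂ (r * τ) (a * τ) := by
    rw [jacobiTheta₂, ← tsum_mul_left]
    refine tsum_congr fun m => ?_
    rw [gaussTerm, jacobiTheta₂_term, ← Complex.exp_add]
    congr 1
    push_cast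
    field_simp
    ring
  have h2 : ∑' k : ℤ, e (r * k / a) * gaussTerm a (ModularGroup.S • τ) k =
      jacobiTheta₂ (r * τ / (a * τ)) (-1 / (a * τ)) := by
    rw [jacobiTheta₂]
    refine tsum_congr fun k => ?_
    rw [gaussTerm, jacobiTheta₂_term, e, ← Complex.exp_add, modular_S_smul]
    congr 1
    push_cast
    field_simp
  have hsq := mul_ne_zero (a := (Real.sqrt a : ℂ)) (b := sqrtNegI τ)
    (by exact_mod_cast (Real.sqrt_pos.2 (by exact_mod_cast ha : (0 : ℝ) < a)).ne')
    (sqrtNegI_ne_zero τ)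
  rw [h1, h2, hf, cpow_half_natCast_mul ha]
  have h3 : Complex.exp (-Real.pi * Complex.I * (r * τ) ^ 2 / (a * τ)) =
      (Complex.exp (Real.pi * Complex.I * r ^ 2 / a * τ))⁻¹ := by
    rw [← Complex.exp_neg]
    congr 1
    field_simp
  rw [h3]
  have hE := Complex.exp_ne_zero (Real.pi * Complex.I * r ^ 2 / a * τ)
  generalize Complex.exp (Real.pi * Complex.I * r ^ 2 / a * τ) = E at hE ⊢
  generalize (Real.sqrt a : ℂ) * sqrtNegI τ = s at hsq ⊢
  generalize jacobiTheta₂ (r * τ / (a * τ)) (-1 / (a * τ)) = J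
  field_simp

/-! ### Orthogonal frames of negative definite lattices -/

section Frame

variable {V : Type*} [AddCommGroup V] [Module ℚ V] {b : LinearMap.BilinForm ℚ V}
  {N : Submodule ℤ V} {n : ℕ} {u : Fin n → V} {a : Fin n → ℕ}

/-- Orthogonal vectors `u i ∈ N` of norm `-a i` which span `N_ℚ`. -/
structure OrthFrame (b : LinearMap.BilinForm ℚ V) (N : Submodule ℤ V) {n : ℕ} (u : Fin n → V)
    (a : Fin n → ℕ) : Prop where
  mem : ∀ i, u i ∈ N
  pos : ∀ i, 0 < a i
  inner : ∀ i j, b (u i) (u j) = if i = j then -(a i : ℚ) else 0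
  le_span : rat N ≤ Submodule.span ℚ (Set.range u)

/-- An orthogonal basis of `N_ℚ`, scaled into `N`. It spans a sublattice that is an orthogonal sum
of rank one lattices, so theta inversion reduces to dimension one. -/
theorem exists_orthFrame (hb : b.IsSymm) (hN : IsEvenLattice b N) (hneg : NegDef b N) :
    ∃ (u : Fin (Module.finrank ℚ (rat N)) → V) (a : Fin (Module.finrank ℚ (rat N)) → ℕ),
      OrthFrame b N u a := by
  have := finiteDimensional_rat hN.fg
  have : Invertible (2 : ℚ) := invertibleOfNonzero two_ne_zero
  obtain ⟨v, hv⟩ := LinearMap.BilinForm.exists_orthogonal_basis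
    (B := b.restrict (rat N)) ⟨(hb.restrict (rat N)).eq⟩
  choose m hm hmv using fun i => exists_zsmul_mem (v i).2
  have hne (i) : m i • (v i : V) ≠ 0 := by
    intro h
    have h1 : (v i : V) ∈ (⊥ : Submodule ℚ V) := mem_of_zsmul_mem (hm i) (by rw [h]; exact zero_mem _)
    exact v.ne_zero i (Subtype.ext h1)
  have hna (i) : ∃ k : ℕ, 0 < k ∧ b (m i • (v i : V)) (m i • (v i : V)) = -(k : ℚ) := by
    obtain ⟨k, hk⟩ := hN.integral _ (hmv i) _ (hmv i)
    have hlt := hneg _ (le_rat (hmv i)) (hne i)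
    rw [hk] at hlt ⊢
    have hlt' : k < 0 := by exact_mod_cast hlt
    refine ⟨(-k).toNat, by omega, ?_⟩
    have : (((-k).toNat : ℤ) : ℚ) = ((-k : ℤ) : ℚ) := by rw [Int.toNat_of_nonneg (by omega)]
    rw [← Int.cast_natCast, this]
    simp
  choose a ha hab using hna
  refine ⟨fun i => m i • (v i : V), a, hmv, ha, fun i j => ?_, ?_⟩
  · split_ifs with h
    · subst h
      exact hab i
    · have h1 : b (v i : V) (v j : V) = 0 := hv h
      rw [bilin_zsmul_left, bilin_zsmul_right, h1, mul_zero, mul_zero]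
  · intro x hx
    have h1 := v.sum_repr ⟨x, hx⟩
    have h2 : x = ∑ i, v.repr ⟨x, hx⟩ i • (v i : V) := by
      have h2 := congrArg Subtype.val h1
      simpa only [Submodule.coe_sum, Submodule.coe_smul] using h2.symm
    rw [h2]
    refine Submodule.sum_mem _ fun i _ => Submodule.smul_mem _ _ ?_
    exact mem_of_zsmul_mem (hm i) (Submodule.subset_span ⟨i, rfl⟩)

/-- The lattice spanned by an orthogonal frame. -/
abbrev frameLattice (u : Fin n → V) : Submodule ℤ V := Submodule.span ℤ (Set.range u)

/-- The vector of the dual of the frame lattice with coordinates `k`. -/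
def framePt (u : Fin n → V) (a : Fin n → ℕ) (k : Fin n → ℤ) : V := ∑ i, (k i / a i : ℚ) • u i

theorem framePt_add (k l : Fin n → ℤ) :
    framePt u a (k + l) = framePt u a k + framePt u a l := by
  simp only [framePt, Pi.add_apply, Int.cast_add, add_div, add_smul, Finset.sum_add_distrib]

namespace OrthFrame

theorem natCast_ne_zero (h : OrthFrame b N u a) (i : Fin n) : (a i : ℚ) ≠ 0 := by
  exact_mod_cast (h.pos i).ne'

theorem lattice_le (h : OrthFrame b N u a) : frameLattice u ≤ N := by
  rw [Submodule.span_le]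
  rintro _ ⟨i, rfl⟩
  exact h.mem i

theorem rat_lattice (h : OrthFrame b N u a) : rat (frameLattice u) = rat N := by
  refine le_antisymm (rat_mono h.lattice_le) (h.le_span.trans ?_)
  exact (Submodule.span_span_of_tower ℤ ℚ (Set.range u)).ge

theorem bilin_framePt (h : OrthFrame b N u a) (k : Fin n → ℤ) (i : Fin n) :
    b (framePt u a k) (u i) = -(k i : ℚ) := by
  have := h.natCast_ne_zero i
  simp only [framePt, map_sum, LinearMap.sum_apply, map_smul, LinearMap.smul_apply, h.inner,
    smul_eq_mul, mul_ite, mul_zero, Finset.sum_ite_eq', Finset.mem_univ, if_true]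
  field_simp

theorem framePt_mul (h : OrthFrame b N u a) (m : Fin n → ℤ) :
    framePt u a (fun i => a i * m i) = ∑ i, m i • u i := by
  refine Finset.sum_congr rfl fun i _ => ?_
  have := h.natCast_ne_zero i
  rw [← Int.cast_smul_eq_zsmul ℚ]
  congr 1
  push_cast
  field_simp

theorem bilin_framePt_framePt (h : OrthFrame b N u a) (k l : Fin n → ℤ) :
    b (framePt u a k) (framePt u a l) = -∑ i, (k i * l i / a i : ℚ) := by
  conv_lhs => rw [framePt.eq_def u a l]
  simp only [map_sum, map_smul, h.bilin_framePt, smul_eq_mul, ← Finset.sum_neg_distrib]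
  refine Finset.sum_congr rfl fun i _ => ?_
  ring

theorem isEvenLattice (h : OrthFrame b N u a) (hN : IsEvenLattice b N) (hneg : NegDef b N) :
    IsEvenLattice b (frameLattice u) := by
  refine NegDef.isEvenLattice (fun x hx => hneg x ?_) hN h.lattice_le
  rw [← h.rat_lattice]
  exact hx

theorem framePt_mem_rat (k : Fin n → ℤ) : framePt u a k ∈ rat (frameLattice u) :=
  Submodule.sum_mem _ fun i _ => Submodule.smul_mem _ _ (le_rat (Submodule.subset_span ⟨i, rfl⟩))

theorem framePt_mem_dual (h : OrthFrame b N u a) (k : Fin n → ℤ) :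
    framePt u a k ∈ dual b (frameLattice u) := by
  refine mem_dual.2 ⟨framePt_mem_rat k, fun l hl => ?_⟩
  induction hl using Submodule.span_induction with
  | mem x hx =>
    obtain ⟨j, rfl⟩ := hx
    exact ⟨-k j, by rw [h.bilin_framePt]; simp⟩
  | zero => exact ⟨0, by simp⟩
  | add x y _ _ ihx ihy =>
    obtain ⟨m, hm⟩ := ihx
    obtain ⟨k, hk⟩ := ihy
    exact ⟨m + k, by rw [map_add, hm, hk]; simp⟩
  | smul c x _ ihx =>
    obtain ⟨m, hm⟩ := ihx
    exact ⟨c * m, by rw [bilin_zsmul_right, hm]; simp⟩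

theorem exists_framePt (h : OrthFrame b N u a) (hN : IsEvenLattice b N) (hneg : NegDef b N) {y : V}
    (hy : y ∈ dual b (frameLattice u)) : ∃ k, framePt u a k = y := by
  choose m hm using fun i => dual_int_left hy (Submodule.subset_span ⟨i, rfl⟩ : u i ∈ frameLattice u)
  refine ⟨fun i => -m i, ?_⟩
  refine sub_eq_zero.1 ((h.isEvenLattice hN hneg).rat_nondegenerate
    (Submodule.sub_mem _ (framePt_mem_rat _) (mem_dual.1 hy).1) fun x hx => ?_)
  induction hx using Submodule.span_induction with
  | mem x hx =>
    obtain ⟨j, rfl⟩ := hx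
    rw [map_sub, LinearMap.sub_apply, h.bilin_framePt, hm]
    simp
  | zero => simp
  | add x y _ _ ihx ihy => rw [map_add, ihx, ihy, add_zero]
  | smul c x _ ihx => rw [bilin_zsmul_right, ihx, mul_zero]

theorem framePt_injective (h : OrthFrame b N u a) : Function.Injective (framePt u a) := fun k l hkl => by
  funext i
  have h1 := h.bilin_framePt k i
  rw [hkl, h.bilin_framePt] at h1
  exact_mod_cast (neg_injective h1).symm

theorem framePt_mem_lattice (h : OrthFrame b N u a) (k : Fin n → ℤ) :
    framePt u a k ∈ frameLattice u ↔ ∃ m : Fin n → ℤ, k = fun i => a i * m i := by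
  constructor
  · intro hk
    obtain ⟨m, hm⟩ := (Submodule.mem_span_range_iff_exists_fun ℤ).1 hk
    refine ⟨m, h.framePt_injective ?_⟩
    rw [h.framePt_mul, hm]
  · rintro ⟨m, rfl⟩
    rw [h.framePt_mul]
    exact Submodule.sum_mem _ fun i _ => Submodule.smul_mem _ _ (Submodule.subset_span ⟨i, rfl⟩)

/-- The discriminant of the frame lattice is the product of the norms. -/
theorem card_disc (h : OrthFrame b N u a) (hN : IsEvenLattice b N) (hneg : NegDef b N) :
    Nat.card (disc b (frameLattice u)) = ∏ i, a i := by
  -- The dual of the frame lattice is `⊕ ℤ u_i / a_i`, so classes are given by the residues of the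
  -- coordinates modulo `a_i`.
  let f : (∀ i, Fin (a i)) → disc b (frameLattice u) := fun r =>
    ⟨(frameLattice u).mkQ (framePt u a fun i => (r i : ℤ)), _, h.framePt_mem_dual _, rfl⟩
  have hf : Function.Bijective f := by
    constructor
    · intro r s hrs
      have h1 := (Submodule.Quotient.eq _).1 (congrArg Subtype.val hrs)
      have h2 : framePt u a (fun i => (r i : ℤ)) - framePt u a (fun i => (s i : ℤ)) =
          framePt u a (fun i => (r i : ℤ) - s i) := by
        rw [sub_eq_iff_eq_add, ← framePt_add]
        congr 1
        funext i
        simp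
      rw [h2, h.framePt_mem_lattice] at h1
      obtain ⟨m, hm⟩ := h1
      funext i
      have h3 := congrFun hm i
      have h4 := (r i).2
      have h5 := (s i).2
      have h6 : ((r i : ℕ) : ℤ) ≡ (s i : ℕ) [ZMOD a i] := by
        rw [Int.modEq_comm, Int.modEq_iff_dvd]
        exact ⟨m i, h3⟩
      have h7 := Int.ModEq.eq h6
      rw [Int.emod_eq_of_lt (by omega) (by omega), Int.emod_eq_of_lt (by omega) (by omega)] at h7
      exact Fin.ext (by exact_mod_cast h7)
    · rintro ⟨_, y, hy, rfl⟩
      obtain ⟨k, rfl⟩ := h.exists_framePt hN hneg hy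
      have hpos (i) : (0 : ℤ) < a i := by exact_mod_cast h.pos i
      refine ⟨fun i => ⟨(k i % a i).toNat, ?_⟩, Subtype.ext ((Submodule.Quotient.eq _).2 ?_)⟩
      · have := Int.emod_lt_of_pos (k i) (hpos i)
        have := Int.emod_nonneg (k i) (hpos i).ne'
        omega
      · have h2 : framePt u a (fun i => ((k i % a i).toNat : ℤ)) - framePt u a k =
            framePt u a (fun i => a i * -(k i / a i)) := by
          rw [sub_eq_iff_eq_add, ← framePt_add]
          congr 1
          funext i
          rw [Int.toNat_of_nonneg (Int.emod_nonneg (k i) (hpos i).ne'), Pi.add_apply,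
            Int.emod_def]
          ring
        exact h2 ▸ (h.framePt_mem_lattice _).2 ⟨_, rfl⟩
  rw [← Nat.card_congr (Equiv.ofBijective f hf), Nat.card_pi]
  simp

end OrthFrame

end Frame

/-! ### Theta series of negative definite lattices -/

theorem norm_e (x : ℚ) : ‖e x‖ = 1 := by
  rw [e, show (2 * Real.pi * Complex.I * (x : ℂ) : ℂ) = ((2 * Real.pi * x : ℝ) : ℂ) * Complex.I by
    push_cast; ring]
  exact Complex.norm_exp_ofReal_mul_I _

theorem e_sum {ι : Type*} (s : Finset ι) (f : ι → ℚ) : e (∑ i ∈ s, f i) = ∏ i ∈ s, e (f i) := by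
  classical
  induction s using Finset.induction_on with
  | empty => simp [e_zero]
  | insert i s hi ih => rw [Finset.sum_insert hi, Finset.prod_insert hi, e_add, ih]

section Gauss

variable {V : Type*} [AddCommGroup V] [Module ℚ V] {b : LinearMap.BilinForm ℚ V}
  {N : Submodule ℤ V} {n : ℕ} {u : Fin n → V} {a : Fin n → ℕ}

/-- The function `exp(-πiτ(y,y))`. -/
def gauss (b : LinearMap.BilinForm ℚ V) (τ : ℍ) (y : V) : ℂ :=
  Complex.exp (2 * Real.pi * Complex.I * (((-b) y y / 2 : ℚ) : ℂ) * (τ : ℂ))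

theorem theta_eq_tsum_gauss (τ : ℍ) (l : V ⧸ N) :
    theta (-b) N τ l = ∑' x : {x : V // N.mkQ x = l}, gauss b τ x := rfl

theorem gauss_eq_exp (τ : ℍ) (y : V) :
    gauss b τ y = Complex.exp (-(Real.pi * Complex.I * (b y y : ℂ) * τ)) := by
  rw [gauss]
  congr 1
  simp only [LinearMap.neg_apply]
  push_cast
  ring

theorem norm_gauss (τ : ℍ) (y : V) : ‖gauss b τ y‖ = Real.exp (Real.pi * b y y * τ.im) := by
  rw [gauss_eq_exp, Complex.norm_exp]
  congr 1
  have : (-(Real.pi * Complex.I * (b y y : ℂ) * τ) : ℂ) =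
      ((-(Real.pi * b y y) : ℝ) : ℂ) * (Complex.I * τ) := by
    push_cast
    ring
  rw [this, Complex.re_ofReal_mul, Complex.I_mul_re, coe_im]
  ring

theorem OrthFrame.gauss_framePt (h : OrthFrame b N u a) (τ : ℍ) (k : Fin n → ℤ) :
    gauss b τ (framePt u a k) = ∏ i, gaussTerm (a i) τ (k i) := by
  rw [gauss_eq_exp, h.bilin_framePt_framePt]
  simp only [gaussTerm]
  rw [← Complex.exp_sum]
  congr 1
  push_cast
  rw [mul_neg, neg_mul, neg_neg, Finset.mul_sum, Finset.sum_mul]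
  refine Finset.sum_congr rfl fun i _ => ?_
  ring

theorem OrthFrame.range_framePt (h : OrthFrame b N u a) (hN : IsEvenLattice b N)
    (hneg : NegDef b N) : Set.range (framePt u a) = dual b (frameLattice u) := by
  ext y
  refine ⟨?_, fun hy => h.exists_framePt hN hneg hy⟩
  rintro ⟨k, rfl⟩
  exact h.framePt_mem_dual k

theorem OrthFrame.summable_gauss_framePt (h : OrthFrame b N u a) (τ : ℍ) :
    Summable fun k => ‖gauss b τ (framePt u a k)‖ :=
  (summable_norm_prod (fun i => gaussTerm (a i) τ) fun i =>
    summable_norm_gaussTerm (h.pos i) τ).congr fun k => by rw [h.gauss_framePt]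

theorem OrthFrame.dual_le (h : OrthFrame b N u a) : dual b N ≤ dual b (frameLattice u) :=
  dual_anti h.lattice_le h.rat_lattice.ge

/-- `N^∨` is contained in the dual of a frame lattice, over which the sum is a product of convergent
one-dimensional theta series. -/
theorem summable_gauss (hb : b.IsSymm) (hN : IsEvenLattice b N) (hneg : NegDef b N) (τ : ℍ) :
    Summable ((dual b N : Set V).indicator fun y => ‖gauss b τ y‖) := by
  obtain ⟨u, a, h⟩ := exists_orthFrame hb hN hneg
  have h1 : Summable ((dual b (frameLattice u) : Set V).indicator fun y => ‖gauss b τ y‖) := by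
    rw [← h.framePt_injective.summable_iff]
    · refine (h.summable_gauss_framePt τ).congr fun k => ?_
      rw [Function.comp_apply, Set.indicator_of_mem (h.framePt_mem_dual k)]
    · intro y hy
      rw [h.range_framePt hN hneg] at hy
      exact Set.indicator_of_notMem hy _
  refine Summable.of_nonneg_of_le (fun y => Set.indicator_nonneg (fun _ _ => norm_nonneg _) y)
    (fun y => ?_) h1
  exact Set.indicator_le_indicator_of_subset h.dual_le (fun _ => norm_nonneg _) y

/-- A periodic function on the dual lattice is bounded. -/
theorem exists_bound (hb : b.IsSymm) (hN : IsEvenLattice b N) {F : V → ℂ} (hF : Periodic N F) :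
    ∃ C, ∀ y ∈ dual b N, ‖F y‖ ≤ C := by
  have := finite_disc hb hN
  obtain ⟨C, hC⟩ := (Set.finite_range fun l : disc b N => ‖F (rep l)‖).bddAbove
  refine ⟨C, fun y hy => ?_⟩
  have h1 : ‖F (rep (⟨N.mkQ y, y, hy, rfl⟩ : disc b N))‖ ≤ C := hC ⟨_, rfl⟩
  have h2 : F (rep (⟨N.mkQ y, y, hy, rfl⟩ : disc b N)) = F y := hF.out_mkQ y
  rwa [h2] at h1

theorem summable_mul_gauss (hb : b.IsSymm) (hN : IsEvenLattice b N) (hneg : NegDef b N)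
    {F : V → ℂ} (hF : Periodic N F) (hs : ∀ y, F y ≠ 0 → y ∈ dual b N) (τ : ℍ) :
    Summable fun y => F y * gauss b τ y := by
  obtain ⟨C, hC⟩ := exists_bound hb hN hF
  refine ((summable_gauss hb hN hneg τ).mul_left C).of_norm_bounded fun y => ?_
  by_cases hy : y ∈ dual b N
  · rw [Set.indicator_of_mem (SetLike.mem_coe.2 hy), norm_mul]
    gcongr
    exact hC y hy
  · have : F y = 0 := by
      by_contra h0
      exact hy (hs y h0)
    simp [this, hy]

/-- Unfolding the pairing of a function on the discriminant group with the theta series. -/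
theorem finsum_mul_theta (hb : b.IsSymm) (hN : IsEvenLattice b N) (hneg : NegDef b N)
    {F : V → ℂ} (hF : Periodic N F) (hs : ∀ y, F y ≠ 0 → y ∈ dual b N) (τ : ℍ) :
    ∑ᶠ l : disc b N, F (rep l) * theta (-b) N τ l = ∑' y, F y * gauss b τ y := by
  have hsum := summable_mul_gauss hb hN hneg hF hs τ
  have hfin := finite_disc hb hN
  have h0 : ∑' y, F y * gauss b τ y = ∑' c : V ⧸ N, ∑' x : {x : V // N.mkQ x = c},
      F ((Equiv.sigmaFiberEquiv N.mkQ) ⟨c, x⟩) *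
        gauss b τ ((Equiv.sigmaFiberEquiv N.mkQ) ⟨c, x⟩) :=
    ((Equiv.sigmaFiberEquiv N.mkQ).tsum_eq fun y => F y * gauss b τ y).symm.trans
      (((Equiv.sigmaFiberEquiv N.mkQ).summable_iff.2 hsum).tsum_sigma)
  rw [h0]
  have h1 : ∀ c : V ⧸ N, ∑' x : {x : V // N.mkQ x = c},
      F ((Equiv.sigmaFiberEquiv N.mkQ) ⟨c, x⟩) * gauss b τ ((Equiv.sigmaFiberEquiv N.mkQ) ⟨c, x⟩) =
      F (Quotient.out c) * theta (-b) N τ c := by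
    intro c
    rw [theta_eq_tsum_gauss, ← tsum_mul_left]
    refine tsum_congr fun x => ?_
    change F x * _ = _
    rw [← hF.out_mkQ x, x.2]
    rfl
  rw [tsum_congr h1]
  have hsupp : Function.HasFiniteSupport fun c : V ⧸ N =>
      F (Quotient.out c) * theta (-b) N τ c := by
    refine (Set.toFinite (disc b N : Set (V ⧸ N))).subset fun c hc => ?_
    exact (out_mem_iff hN.le_dual).1 (hs _ (left_ne_zero_of_mul hc))
  rw [tsum_eq_finsum hsupp]
  have h2 := finsum_set_coe_eq_finsum_mem (f := fun c : V ⧸ N =>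
    F (Quotient.out c) * theta (-b) N τ c) (disc b N : Set (V ⧸ N))
  refine h2.trans ?_
  rw [finsum_mem_def]
  refine finsum_congr fun c => ?_
  by_cases hc : c ∈ disc b N
  · rw [Set.indicator_of_mem (SetLike.mem_coe.2 hc)]
  · rw [Set.indicator_of_notMem (by simpa using hc)]
    by_contra h0
    exact hc ((out_mem_iff hN.le_dual).1 (hs _ (left_ne_zero_of_mul (Ne.symm h0))))

/-- Poisson summation for the lattice of an orthogonal frame. -/
theorem OrthFrame.tsum_character (h : OrthFrame b N u a) (hN : IsEvenLattice b N)
    (hneg : NegDef b N) (τ : ℍ) (l : disc b (frameLattice u)) :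
    ∑' k, e (-(b (rep l) (framePt u a k))) * gauss b (ModularGroup.S • τ) (framePt u a k) =
      Real.sqrt (Nat.card (disc b (frameLattice u))) * sqrtNegI τ ^ n *
        theta (-b) (frameLattice u) τ l := by
  obtain ⟨r, hr⟩ := h.exists_framePt hN hneg (rep_mem_dual (h.isEvenLattice hN hneg) l)
  have h1 : ∀ k, e (-(b (rep l) (framePt u a k))) * gauss b (ModularGroup.S • τ) (framePt u a k) =
      ∏ i, (e (r i * k i / a i) * gaussTerm (a i) (ModularGroup.S • τ) (k i)) := by
    intro k
    rw [← hr, h.bilin_framePt_framePt, neg_neg, e_sum, h.gauss_framePt, Finset.prod_mul_distrib]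
  have h2 : ∀ i, Summable fun k : ℤ =>
      ‖e (r i * k / a i) * gaussTerm (a i) (ModularGroup.S • τ) k‖ := fun i =>
    (summable_norm_gaussTerm (h.pos i) _).congr fun k => by rw [norm_mul, norm_e, one_mul]
  have h3 : ∀ i, Summable fun m : ℤ => ‖gaussTerm (a i) τ (r i + a i * m)‖ := fun i =>
    (summable_norm_gaussTerm (h.pos i) τ).comp_injective (i := fun m : ℤ => r i + a i * m)
      fun m m' hm => by
        have := h.pos i
        have h0 : (a i : ℤ) ≠ 0 := by omega
        exact mul_left_cancel₀ h0 (add_left_cancel hm)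
  -- The vectors in the class `l` are those with coordinates `r i + a i * m i`, so the theta series
  -- also factors.
  have h4 : theta (-b) (frameLattice u) τ l =
      ∑' m : Fin n → ℤ, ∏ i, gaussTerm (a i) τ (r i + a i * m i) := by
    let f : (Fin n → ℤ) → {x : V // (frameLattice u).mkQ x = l} := fun m =>
      ⟨framePt u a (r + fun i => a i * m i), by
        rw [← mk_rep l, ← hr]
        refine (Submodule.Quotient.eq _).2 ?_
        rw [framePt_add, add_sub_cancel_left]
        exact (h.framePt_mem_lattice _).2 ⟨m, rfl⟩⟩
    have hf : Function.Bijective f := by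
      constructor
      · intro m m' hmm
        have h5 := h.framePt_injective (congrArg Subtype.val hmm)
        funext i
        have h6 := congrFun h5 i
        have := h.pos i
        have h0 : (a i : ℤ) ≠ 0 := by omega
        exact mul_left_cancel₀ h0 (add_left_cancel h6)
      · rintro ⟨x, hx⟩
        have h5 : x - rep l ∈ frameLattice u :=
          (Submodule.Quotient.eq _).1 (hx.trans (mk_rep l).symm)
        obtain ⟨m, hm⟩ := (Submodule.mem_span_range_iff_exists_fun ℤ).1 h5
        refine ⟨m, Subtype.ext ?_⟩
        change framePt u a (r + fun i => a i * m i) = x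
        rw [framePt_add, h.framePt_mul, hm, hr, add_sub_cancel]
    rw [theta_eq_tsum_gauss, ← (Equiv.ofBijective f hf).tsum_eq]
    refine tsum_congr fun m => ?_
    exact h.gauss_framePt τ _
  rw [tsum_congr h1, tsum_prod_eq_prod_tsum _ h2, h4,
    tsum_prod_eq_prod_tsum (fun i m => gaussTerm (a i) τ (r i + a i * m)) h3,
    h.card_disc hN hneg]
  have h5 : ((Real.sqrt ((∏ i, a i : ℕ) : ℝ) : ℝ) : ℂ) = ∏ i, (Real.sqrt (a i) : ℂ) := by
    rw [← Complex.ofReal_prod, Nat.cast_prod, Real.sqrt_eq_rpow,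
      ← Real.finsetProd_rpow _ _ fun i _ => Nat.cast_nonneg _]
    simp only [Real.sqrt_eq_rpow]
  have h6 : sqrtNegI τ ^ n = ∏ _i : Fin n, sqrtNegI τ := by simp
  rw [h5, h6, ← Finset.prod_mul_distrib, ← Finset.prod_mul_distrib]
  exact Finset.prod_congr rfl fun i _ => tsum_character_gaussTerm (h.pos i) τ (r i)

/-- Contraction with the theta series of a negative definite lattice under `τ ↦ -1/τ`. -/
theorem tsum_mul_gauss_S (hb : b.IsSymm) (hN : IsEvenLattice b N) (hneg : NegDef b N)
    {c : ℂ} {F₁ F₂ : V → ℂ} (hF₁ : Periodic N F₁) (hs₁ : ∀ y, F₁ y ≠ 0 → y ∈ dual b N)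
    (hs₂ : ∀ y, F₂ y ≠ 0 → y ∈ dual b N) (hlaw : SLaw b N c F₁ F₂) (τ : ℍ) :
    ∑' y, F₂ y * gauss b (ModularGroup.S • τ) y =
      c * sqrtNegI τ ^ Module.finrank ℚ (rat N) * ∑' y, F₁ y * gauss b τ y := by
  obtain ⟨u, a, h⟩ := exists_orthFrame hb hN hneg
  have hD := h.isEvenLattice hN hneg
  have hnegD : NegDef b (frameLattice u) := fun x hx => hneg x (h.rat_lattice ▸ hx)
  -- The law passes to the frame lattice while `F₁` and `F₂` stay the same functions on `V`, so both
  -- sums over `V` are untouched.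
  have hlaw' := SLaw.of_le hb hD hN h.lattice_le h.rat_lattice.ge hF₁ hs₁ hs₂ hlaw
  have hF₁' := hF₁.mono h.lattice_le
  have := finite_disc hb hD
  have := Fintype.ofFinite (disc b (frameLattice u))
  have h1 : ∑' y, F₂ y * gauss b (ModularGroup.S • τ) y =
      ∑' k, F₂ (framePt u a k) * gauss b (ModularGroup.S • τ) (framePt u a k) := by
    refine (h.framePt_injective.tsum_eq fun y hy => ?_).symm
    rw [h.range_framePt hN hneg]
    exact h.dual_le (hs₂ y (left_ne_zero_of_mul hy))
  -- Inserting the law for `F₂` turns the sum into a finite combination of Poisson sums, one per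
  -- class `l`; the square root of the discriminant produced by each cancels the one in the law.
  have h2 : ∀ k, F₂ (framePt u a k) * gauss b (ModularGroup.S • τ) (framePt u a k) =
      ∑ l : disc b (frameLattice u), c / (Real.sqrt (Nat.card (disc b (frameLattice u))) : ℂ) *
        F₁ (rep l) * (e (-(b (rep l) (framePt u a k))) *
          gauss b (ModularGroup.S • τ) (framePt u a k)) := by
    intro k
    rw [hlaw' _ (h.framePt_mem_dual k), FT, ← finsum_disc hD, finsum_eq_sum_of_fintype,
      Finset.mul_sum, Finset.sum_mul]
    refine Finset.sum_congr rfl fun l _ => ?_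
    ring
  rw [h1, tsum_congr h2, Summable.tsum_finsetSum]
  · have h3 : ∀ l : disc b (frameLattice u),
        ∑' k, c / (Real.sqrt (Nat.card (disc b (frameLattice u))) : ℂ) *
          F₁ (rep l) * (e (-(b (rep l) (framePt u a k))) *
            gauss b (ModularGroup.S • τ) (framePt u a k)) =
        c * sqrtNegI τ ^ Module.finrank ℚ (rat N) *
          (F₁ (rep l) * theta (-b) (frameLattice u) τ l) := by
      intro l
      rw [tsum_mul_left, h.tsum_character hN hneg]
      have := sqrt_card_disc_ne_zero hb hD
      field_simp
    rw [Finset.sum_congr rfl fun l _ => h3 l, ← Finset.mul_sum, ← finsum_eq_sum_of_fintype,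
      finsum_mul_theta hb hD hnegD hF₁' fun y hy => h.dual_le (hs₁ y hy)]
  · intro l _
    refine Summable.mul_left _ ?_
    refine (h.summable_gauss_framePt (ModularGroup.S • τ)).of_norm_bounded fun k => ?_
    rw [norm_mul, norm_e, one_mul]

end Gauss

/-! ### Holomorphic functions on `ℍ` that are meromorphic at the cusp -/

/-- Holomorphic on `ℍ` and meromorphic at the cusp. -/
def WeaklyHolomorphic (f : ℍ → ℂ) : Prop :=
  MDifferentiable 𝓘(ℂ) 𝓘(ℂ) f ∧ MeromorphicAtCusp f

namespace WeaklyHolomorphic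

theorem const (c : ℂ) : WeaklyHolomorphic fun _ => c :=
  ⟨mdifferentiable_const, MeromorphicAtCusp.const c⟩

theorem mul {f g : ℍ → ℂ} (hf : WeaklyHolomorphic f) (hg : WeaklyHolomorphic g) :
    WeaklyHolomorphic fun τ => f τ * g τ :=
  ⟨hf.1.mul hg.1, hf.2.mul hg.2⟩

theorem finset_sum {ι : Type*} (s : Finset ι) {f : ι → ℍ → ℂ}
    (hf : ∀ i, WeaklyHolomorphic (f i)) : WeaklyHolomorphic fun τ => ∑ i ∈ s, f i τ := by
  classical
  induction s using Finset.induction_on with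
  | empty => simpa using const 0
  | insert i s hi ih =>
    simp only [Finset.sum_insert hi]
    exact ⟨(hf i).1.add ih.1, (hf i).2.add ih.2⟩

theorem finsum {ι : Type*} [Finite ι] {f : ι → ℍ → ℂ}
    (hf : ∀ i, WeaklyHolomorphic (f i)) : WeaklyHolomorphic fun τ => ∑ᶠ i, f i τ := by
  have := Fintype.ofFinite ι
  simp only [finsum_eq_sum_of_fintype]
  exact finset_sum _ hf

theorem linear {A : Type*} [Finite A] {f : ℍ → GroupSpace A}
    (hf : ∀ a, WeaklyHolomorphic fun τ => GroupSpace.coeff a (f τ))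
    (Φ : GroupSpace A →ₗ[ℂ] ℂ) : WeaklyHolomorphic fun τ => Φ (f τ) := by
  have := Fintype.ofFinite A
  have h : Φ = GroupSpace.lift fun a => Φ (GroupSpace.basis A a) :=
    (GroupSpace.basis A).ext fun a => by rw [GroupSpace.lift_basis]
  rw [h]
  simp only [GroupSpace.lift_apply, smul_eq_mul]
  exact finset_sum _ fun a => (hf a).mul (const _)

end WeaklyHolomorphic

/-! ### Theta series of negative definite lattices as weakly holomorphic functions -/

section Theta

variable {V : Type*} [AddCommGroup V] [Module ℚ V] {b : LinearMap.BilinForm ℚ V}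
  {N : Submodule ℤ V}

theorem summable_gauss_fiber (hb : b.IsSymm) (hN : IsEvenLattice b N) (hneg : NegDef b N) (τ : ℍ)
    (l : disc b N) : Summable fun x : {x : V // N.mkQ x = l} => ‖gauss b τ x‖ := by
  refine ((summable_gauss hb hN hneg τ).comp_injective Subtype.val_injective).congr fun x => ?_
  have hx : (x : V) ∈ dual b N := (mkQ_mem_disc hN).1 (x.2.symm ▸ l.2 : N.mkQ (x : V) ∈ disc b N)
  rw [Function.comp_apply, Set.indicator_of_mem (SetLike.mem_coe.2 hx)]

theorem norm_gauss_le (hN : IsEvenLattice b N) (hneg : NegDef b N) {l : disc b N}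
    (x : {x : V // N.mkQ x = l}) {τ τ' : ℍ} (h : τ.im ≤ τ'.im) :
    ‖gauss b τ' (x : V)‖ ≤ ‖gauss b τ (x : V)‖ := by
  have hx : (x : V) ∈ dual b N := (mkQ_mem_disc hN).1 (x.2.symm ▸ l.2 : N.mkQ (x : V) ∈ disc b N)
  have h0 : b x x ≤ 0 := by
    by_cases hz : (x : V) = 0
    · simp [hz]
    · exact (hneg x (mem_dual.1 hx).1 hz).le
  have h1 : (b x x : ℝ) ≤ 0 := by exact_mod_cast h0
  rw [norm_gauss, norm_gauss]
  refine Real.exp_le_exp.2 (mul_le_mul_of_nonpos_left h ?_)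
  exact mul_nonpos_of_nonneg_of_nonpos Real.pi_pos.le h1

theorem weaklyHolomorphic_theta (hb : b.IsSymm) (hN : IsEvenLattice b N) (hneg : NegDef b N)
    (l : disc b N) : WeaklyHolomorphic fun τ => theta (-b) N τ l := by
  constructor
  · rw [UpperHalfPlane.mdifferentiable_iff]
    intro z hz
    have hz' : 0 < z.im := hz
    -- The terms decrease in norm as `Im τ` grows, so their norms at half the height of `z` are a
    -- summable majorant on the neighbourhood `Im w > Im z / 2`.
    let τ₀ : ℍ := ⟨(z.im / 2 : ℝ) * Complex.I, by simpa using hz'⟩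
    have hτ₀ : τ₀.im = z.im / 2 := by
      rw [← coe_im]
      simp [τ₀]
    have hU : IsOpen {w : ℂ | z.im / 2 < w.im} := isOpen_lt continuous_const Complex.continuous_im
    have hpos : ∀ w : ℂ, z.im / 2 < w.im → 0 < w.im := fun w hw => by linarith
    have key := Complex.differentiableOn_tsum_of_summable_norm
      (F := fun (x : {x : V // N.mkQ x = l}) (w : ℂ) =>
        Complex.exp (2 * Real.pi * Complex.I * (((-b) x x / 2 : ℚ) : ℂ) * w))
      (summable_gauss_fiber hb hN hneg τ₀ l) (fun x => by fun_prop) hU (fun x w hw => by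
        have := norm_gauss_le (τ := τ₀) (τ' := ⟨w, hpos w hw⟩) hN hneg x (by
          rw [hτ₀]
          exact le_of_lt hw)
        exact this)
    have hzU : z ∈ {w : ℂ | z.im / 2 < w.im} := by
      change z.im / 2 < z.im
      linarith
    refine (((key z hzU).differentiableAt (hU.mem_nhds hzU)).congr_of_eventuallyEq
      ?_).differentiableWithinAt
    filter_upwards [isOpen_upperHalfPlaneSet.mem_nhds hz] with w hw
    rw [Function.comp_apply, theta, ofComplex_apply_of_im_pos hw]
  -- There is no pole: for `Im τ ≥ 1` the series is dominated by the sum of its absolute values at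
  -- `τ = i`.
  · refine ⟨0, Asymptotics.IsBigO.of_bound
      (∑' x : {x : V // N.mkQ x = l}, ‖gauss b UpperHalfPlane.I x‖) ?_⟩
    refine (atImInfty_mem _).2 ⟨1, fun τ hτ => ?_⟩
    simp only [Set.mem_ofPred_eq, CharP.cast_eq_zero, mul_zero, zero_mul, Real.exp_zero, norm_one,
      mul_one]
    rw [theta_eq_tsum_gauss]
    refine (norm_tsum_le_tsum_norm (summable_gauss_fiber hb hN hneg τ l)).trans ?_
    refine (summable_gauss_fiber hb hN hneg τ l).tsum_le_tsum (fun x => ?_)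
      (summable_gauss_fiber hb hN hneg _ l)
    exact norm_gauss_le hN hneg x (by simpa using hτ)

theorem gauss_T (τ : ℍ) (y : V) :
    gauss b (ModularGroup.T • τ) y = e (-(b y y / 2)) * gauss b τ y := by
  rw [gauss, gauss, e, ← Complex.exp_add, UpperHalfPlane.modular_T_smul, coe_vadd]
  congr 1
  simp only [LinearMap.neg_apply]
  push_cast
  ring

end Theta

/-! ### The branches of `√τ` and `√(-iτ)` -/

theorem cpow_half_eq (τ : ℍ) : (τ : ℂ) ^ (1 / 2 : ℂ) = e (1 / 8) * sqrtNegI τ := by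
  have h0 := negI_mul_ne_zero τ
  have hre : 0 < (-Complex.I * (τ : ℂ)).re := by
    simpa using τ.im_pos
  have harg := abs_lt.1 (Complex.abs_arg_lt_pi_div_two_iff.2 (Or.inl hre))
  have hlog : Complex.log (τ : ℂ) = Real.pi / 2 * Complex.I + Complex.log (-Complex.I * τ) := by
    have h1 : (τ : ℂ) = Complex.I * (-Complex.I * τ) := by
      rw [← mul_assoc, mul_neg, Complex.I_mul_I, neg_neg, one_mul]
    conv_lhs => rw [h1]
    -- As `-iτ` has positive real part, its argument lies in `(-π/2, π/2)`, and adding `arg i = π/2`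
    -- stays within the principal branch.
    rw [Complex.log_mul Complex.I_ne_zero h0, Complex.log_I]
    rw [Complex.arg_I]
    have := Real.pi_pos
    constructor <;> linarith [harg.1, harg.2]
  rw [sqrtNegI, Complex.cpow_def_of_ne_zero (ne_zero τ), Complex.cpow_def_of_ne_zero h0, hlog, e,
    ← Complex.exp_add]
  congr 1
  push_cast
  ring

/-- The eighth root of unity in `ρ_L(S)` is exactly what converts the automorphy factor `√τ` into
the factor `√(-iτ)` of Poisson summation. -/
theorem cpow_half_zpow_mul_e (τ : ℍ) (s : ℤ) :
    ((τ : ℂ) ^ (1 / 2 : ℂ)) ^ s * e (-(s : ℚ) / 8) = sqrtNegI τ ^ s := by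
  have h : e (-(s : ℚ) / 8) = (e (1 / 8) ^ s)⁻¹ := by
    rw [e, e, ← Complex.exp_int_mul, ← Complex.exp_neg]
    congr 1
    push_cast
    ring
  rw [cpow_half_eq, mul_zpow, h]
  have := zpow_ne_zero s (e_ne_zero (1 / 8))
  field_simp

/-! ### The map `ξ` -/

section Xi

variable {V : Type*} [AddCommGroup V] [Module ℚ V] {b : LinearMap.BilinForm ℚ V}
  {L I : Submodule ℤ V} {p q : ℕ}

theorem xi_apply_eq (b : LinearMap.BilinForm ℚ V) (L I : Submodule ℤ V)
    (f : ℍ → GroupSpace (disc b L)) (τ : ℍ) :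
    xi b L I f τ = GroupSpace.lift (fun k : disc (redForm b L I) (redLattice b L I) =>
      theta (-redForm b L I) (redLattice b L I) τ k) (pushK b L I (f τ)) := rfl

theorem xi_apply_finsum (hb : b.IsSymm) (hL : IsEvenLattice b L) (hsig : HasSignature b L p q)
    (hI : IsMaximalIsotropic b L p I) (f : ℍ → GroupSpace (disc b L)) (τ : ℍ) :
    xi b L I f τ = ∑ᶠ k : disc (redForm b L I) (redLattice b L I),
      ext (pushK b L I (f τ)) (rep k) * theta (-redForm b L I) (redLattice b L I) τ k := by
  have := finite_disc (redForm_isSymm hb) (isEvenLattice_red hb hL hsig hI)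
  have := Fintype.ofFinite (disc (redForm b L I) (redLattice b L I))
  rw [xi_apply_eq, GroupSpace.lift_apply, finsum_eq_sum_of_fintype]
  simp only [ext_rep, smul_eq_mul]

/-- Unfolding the theta series removes the discriminant group: a single sum over `K_ℚ`, the form in
which `ξ` and `ξ'` are compared. -/
theorem xi_apply (hb : b.IsSymm) (hL : IsEvenLattice b L) (hsig : HasSignature b L p q)
    (hI : IsMaximalIsotropic b L p I) (f : ℍ → GroupSpace (disc b L)) (τ : ℍ) :
    xi b L I f τ = ∑' k, ext (pushK b L I (f τ)) k * gauss (redForm b L I) τ k := by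
  have hK := isEvenLattice_red hb hL hsig hI
  rw [xi_apply_finsum hb hL hsig hI, finsum_mul_theta (redForm_isSymm hb) hK
    (negDef_red hb hL hsig hI) (periodic_ext _) fun y hy => ext_support hK _ hy]

/-- All `x + h` with `h ∈ L^*` share the phase of `x`: `(x, h)` is an integer because `x ∈ (L^*)^∨`,
and `(h, h)/2` is one because `L^*` is even. -/
theorem ext_pushK_weilT (hb : b.IsSymm) (hL : IsEvenLattice b L) (hsig : HasSignature b L p q)
    (hI : IsMaximalIsotropic b L p I) (v : GroupSpace (disc b L)) {k : redSpace b L I}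
    (hk : k ∈ dual (redForm b L I) (redLattice b L I)) :
    ext (pushK b L I (weilT b L v)) k = e (redForm b L I k k / 2) * ext (pushK b L I v) k := by
  obtain ⟨x, hx, rfl⟩ := exists_lift_dual_red hb hL hI hk
  have hL' := isEvenLattice_starL hb hL hI
  have hx' := mem_dual_starL hb hx x.2
  rw [ext_pushK hb hL hsig hI _ hx, ext_pushK hb hL hsig hI _ hx, redForm_toRed, pushFun, pushFun,
    mul_csum]
  refine csum_congr fun h => ?_
  by_cases hh : h ∈ starL b L I
  swap
  · rw [Set.indicator_of_notMem (by simpa using hh), Set.indicator_of_notMem (by simpa using hh),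
      mul_zero]
  rw [Set.indicator_of_mem (SetLike.mem_coe.2 hh), Set.indicator_of_mem (SetLike.mem_coe.2 hh)]
  by_cases hxh : (x : V) + h ∈ dual b L
  swap
  · rw [ext_of_notMem hL _ hxh, ext_of_notMem hL _ hxh, mul_zero]
  rw [ext_weilT hb hL v hxh]
  congr 1
  obtain ⟨n, hn⟩ := dual_int_left hx' hh
  obtain ⟨m, hm⟩ := hL'.even h hh
  refine e_congr ⟨n + m, ?_⟩
  have hs : b h x = b x h := hb.eq h x
  simp only [map_add, LinearMap.add_apply, hs, hn, hm]
  push_cast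
  ring

/-- Under `S`, `f` contributes `√(-iτ)^{σ(L)}` and theta inversion `√(-iτ)^{rank K}`, which cancel
since `σ(L) = -rank K`. Under `T` the phases `e(±(k, k)/2)` cancel. `S` and `T` generate `SL₂(ℤ)`.
-/
theorem xi_mem_scalarForms (hb : b.IsSymm) (hL : IsEvenLattice b L) (hsig : HasSignature b L p q)
    (hI : IsMaximalIsotropic b L p I) {f : ℍ → GroupSpace (disc b L)} (hf : f ∈ forms b L) :
    xi b L I f ∈ scalarForms := by
  have hK := isEvenLattice_red hb hL hsig hI
  have hKs := redForm_isSymm (L := L) (I := I) hb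
  have hKn := negDef_red hb hL hsig hI
  have := finite_disc hb hL
  have := finite_disc hKs hK
  have hw : WeaklyHolomorphic (xi b L I f) := by
    have h1 : WeaklyHolomorphic fun τ => ∑ᶠ k : disc (redForm b L I) (redLattice b L I),
        ext (pushK b L I (f τ)) (rep k) * theta (-redForm b L I) (redLattice b L I) τ k := by
      refine WeaklyHolomorphic.finsum fun k => WeaklyHolomorphic.mul ?_
        (weaklyHolomorphic_theta hKs hK hKn k)
      simp only [ext_rep]
      exact WeaklyHolomorphic.linear (fun a => ⟨hf.1 a, hf.2.2 a⟩)
        (GroupSpace.coeff k ∘ₗ pushK b L I)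
    convert h1 using 1
    funext τ
    exact xi_apply_finsum hb hL hsig hI f τ
  have hS : ∀ τ, xi b L I f (ModularGroup.S • τ) = xi b L I f τ := by
    intro τ
    have h1 : f (ModularGroup.S • τ) = ((τ : ℂ) ^ (1 / 2 : ℂ)) ^ sigma b L • weilS b L (f τ) :=
      hf.2.1 Mp2.S _ Weil.S τ
    have h2 := sLaw_weilS hb hL (((τ : ℂ) ^ (1 / 2 : ℂ)) ^ sigma b L) (f τ)
    rw [← h1, cpow_half_zpow_mul_e] at h2
    rw [xi_apply hb hL hsig hI, xi_apply hb hL hsig hI,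
      tsum_mul_gauss_S hKs hK hKn (periodic_ext _) (fun y hy => ext_support hK _ hy)
        (fun y hy => ext_support hK _ hy) (sLaw_pushK hb hL hsig hI h2)]
    have h3 : rat (redLattice b L I) = ⊤ := eq_top_iff.2 fun k _ => rat_redLattice k
    rw [h3, finrank_top, sigma_eq_neg_finrank_red hb hL hsig hI, zpow_neg, zpow_natCast,
      inv_mul_cancel₀ (pow_ne_zero _ (sqrtNegI_ne_zero τ)), one_mul]
  have hT : ∀ τ, xi b L I f (ModularGroup.T • τ) = xi b L I f τ := by
    intro τ
    have h1 : f (ModularGroup.T • τ) = (1 : ℂ) ^ sigma b L • weilT b L (f τ) :=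
      hf.2.1 Mp2.T _ Weil.T τ
    rw [one_zpow, one_smul] at h1
    rw [xi_apply hb hL hsig hI, xi_apply hb hL hsig hI, h1]
    refine tsum_congr fun k => ?_
    by_cases hk : k ∈ dual (redForm b L I) (redLattice b L I)
    · rw [ext_pushK_weilT hb hL hsig hI _ hk, gauss_T, mul_mul_mul_comm, ← e_add,
        add_neg_cancel, e_zero, one_mul]
    · rw [ext_of_notMem hK _ hk, ext_of_notMem hK _ hk, zero_mul, zero_mul]
  refine ⟨hw.1, fun g => ?_, hw.2⟩
  have hg : g ∈ Subgroup.closure {ModularGroup.S, ModularGroup.T} := by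
    simp [SpecialLinearGroup.SL2Z_generators]
  induction hg using Subgroup.closure_induction with
  | mem g hg =>
    rcases hg with rfl | rfl
    · exact hS
    · exact hT
  | one => intro τ; rw [one_smul]
  | mul g h _ _ ihg ihh => intro τ; rw [mul_smul, ihg, ihh]
  | inv g _ ih => intro τ; rw [← ih (g⁻¹ • τ), smul_inv_smul]

end Xi

/-! ### Contraction with the theta series of an orthogonal summand -/

section Contract

variable {V : Type*} [AddCommGroup V] [Module ℚ V] {b : LinearMap.BilinForm ℚ V}
  {L L' N : Submodule ℤ V}

/-- `L'` and `N` are orthogonal even lattices, so that their sum is an even lattice. -/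
structure OrthPair (b : LinearMap.BilinForm ℚ V) (L' N : Submodule ℤ V) : Prop where
  left : IsEvenLattice b L'
  right : IsEvenLattice b N
  sup : IsEvenLattice b (L' ⊔ N)
  orth : ∀ x ∈ rat L', ∀ y ∈ rat N, b x y = 0

namespace OrthPair

theorem orth' (h : OrthPair b L' N) (hb : b.IsSymm) {x y : V} (hx : x ∈ rat N) (hy : y ∈ rat L') :
    b x y = 0 := by
  have : b x y = b y x := hb.eq x y
  rw [this, h.orth y hy x hx]

theorem eq_zero (h : OrthPair b L' N) {x : V} (hx : x ∈ rat L') (hx' : x ∈ rat N) : x = 0 :=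
  h.right.rat_nondegenerate hx' fun y hy => h.orth x hx y (le_rat hy)

theorem mem_sup_iff (h : OrthPair b L' N) {x y : V} (hx : x ∈ rat L') (hy : y ∈ rat N) :
    x + y ∈ L' ⊔ N ↔ x ∈ L' ∧ y ∈ N := by
  refine ⟨fun hxy => ?_, fun hxy => Submodule.add_mem_sup hxy.1 hxy.2⟩
  obtain ⟨x', hx', y', hy', he⟩ := Submodule.mem_sup.1 hxy
  have h1 : x - x' = y' - y := by
    rw [sub_eq_sub_iff_add_eq_add, ← he, add_comm]
  have h2 : x - x' = 0 := by
    refine h.eq_zero (Submodule.sub_mem _ hx (le_rat hx')) ?_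
    rw [h1]
    exact Submodule.sub_mem _ (le_rat hy') hy
  have h3 : y' - y = 0 := h1.symm.trans h2
  exact ⟨sub_eq_zero.1 h2 ▸ hx', sub_eq_zero.1 h3 ▸ hy'⟩

theorem mem_dual_sup_iff (h : OrthPair b L' N) (hb : b.IsSymm) {x y : V} (hx : x ∈ rat L')
    (hy : y ∈ rat N) : x + y ∈ dual b (L' ⊔ N) ↔ x ∈ dual b L' ∧ y ∈ dual b N := by
  constructor
  · intro hxy
    refine ⟨mem_dual.2 ⟨hx, fun l hl => ?_⟩, mem_dual.2 ⟨hy, fun l hl => ?_⟩⟩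
    · obtain ⟨n, hn⟩ := dual_int_left hxy (Submodule.mem_sup_left hl)
      refine ⟨n, ?_⟩
      rw [← hn, map_add, LinearMap.add_apply, h.orth' hb hy (le_rat hl), add_zero]
    · obtain ⟨n, hn⟩ := dual_int_left hxy (Submodule.mem_sup_right hl)
      refine ⟨n, ?_⟩
      rw [← hn, map_add, LinearMap.add_apply, h.orth x hx l (le_rat hl), zero_add]
  · rintro ⟨hx', hy'⟩
    refine mem_dual.2 ⟨Submodule.add_mem _ (rat_mono le_sup_left hx) (rat_mono le_sup_right hy),
      fun l hl => ?_⟩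
    obtain ⟨l₁, hl₁, l₂, hl₂, rfl⟩ := Submodule.mem_sup.1 hl
    obtain ⟨n, hn⟩ := dual_int_left hx' hl₁
    obtain ⟨m, hm⟩ := dual_int_left hy' hl₂
    refine ⟨n + m, ?_⟩
    simp only [map_add, LinearMap.add_apply, hn, hm, h.orth x hx l₂ (le_rat hl₂),
      h.orth' hb hy (le_rat hl₁)]
    push_cast
    ring

theorem exists_add (h : OrthPair b L' N) (hb : b.IsSymm) {z : V} (hz : z ∈ dual b (L' ⊔ N)) :
    ∃ x ∈ dual b L', ∃ y ∈ dual b N, x + y = z := by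
  have h1 : rat (L' ⊔ N) ≤ rat L' ⊔ rat N := by
    refine Submodule.span_le.2 fun w hw => ?_
    obtain ⟨x, hx, y, hy, rfl⟩ := Submodule.mem_sup.1 hw
    exact Submodule.add_mem_sup (le_rat hx) (le_rat hy)
  obtain ⟨x, hx, y, hy, rfl⟩ := Submodule.mem_sup.1 (h1 (mem_dual.1 hz).1)
  have := (h.mem_dual_sup_iff hb hx hy).1 hz
  exact ⟨x, this.1, y, this.2, rfl⟩

/-- The isomorphism `A_{L'} × A_N → A_{L' ⊕ N}`. -/
def discAdd (h : OrthPair b L' N) (hb : b.IsSymm) (c : disc b L' × disc b N) :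
    disc b (L' ⊔ N) :=
  ⟨(L' ⊔ N).mkQ (rep c.1 + rep c.2), (mkQ_mem_disc h.sup).2
    ((h.mem_dual_sup_iff hb (mem_dual.1 (rep_mem_dual h.left c.1)).1
      (mem_dual.1 (rep_mem_dual h.right c.2)).1).2
      ⟨rep_mem_dual h.left c.1, rep_mem_dual h.right c.2⟩)⟩

theorem discAdd_bijective (h : OrthPair b L' N) (hb : b.IsSymm) :
    Function.Bijective (h.discAdd hb) := by
  have hm : ∀ m : disc b L', rep m ∈ rat L' := fun m => (mem_dual.1 (rep_mem_dual h.left m)).1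
  have hn : ∀ n : disc b N, rep n ∈ rat N := fun n => (mem_dual.1 (rep_mem_dual h.right n)).1
  constructor
  · rintro ⟨m, n⟩ ⟨m', n'⟩ heq
    have h1 := (Submodule.Quotient.eq _).1 (congrArg Subtype.val heq)
    simp only at h1
    rw [add_sub_add_comm] at h1
    have h2 := (h.mem_sup_iff (Submodule.sub_mem _ (hm m) (hm m'))
      (Submodule.sub_mem _ (hn n) (hn n'))).1 h1
    refine Prod.ext (Subtype.ext ?_) (Subtype.ext ?_)
    · rw [← mk_rep m, ← mk_rep m']
      exact (Submodule.Quotient.eq _).2 h2.1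
    · rw [← mk_rep n, ← mk_rep n']
      exact (Submodule.Quotient.eq _).2 h2.2
  · intro k
    obtain ⟨x, hx, y, hy, hxy⟩ := h.exists_add hb (rep_mem_dual h.sup k)
    refine ⟨(⟨L'.mkQ x, x, hx, rfl⟩, ⟨N.mkQ y, y, hy, rfl⟩), Subtype.ext ?_⟩
    rw [← mk_rep k, ← hxy]
    refine (Submodule.Quotient.eq _).2 ?_
    rw [add_sub_add_comm]
    exact Submodule.add_mem_sup (out_sub_mem x) (out_sub_mem y)

theorem over_iff (h : OrthPair b L' N) (hb : b.IsSymm) (c : disc b L' × disc b N)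
    (k : disc b (L' ⊔ N)) :
    (∃ x y : V, L'.mkQ x = c.1 ∧ N.mkQ y = c.2 ∧ (L' ⊔ N).mkQ (x + y) = k) ↔
      h.discAdd hb c = k := by
  constructor
  · rintro ⟨x, y, hx, hy, hk⟩
    refine Subtype.ext ?_
    rw [← hk]
    refine (Submodule.Quotient.eq _).2 ?_
    rw [add_sub_add_comm]
    exact Submodule.add_mem_sup ((Submodule.Quotient.eq _).1 ((mk_rep c.1).trans hx.symm))
      ((Submodule.Quotient.eq _).1 ((mk_rep c.2).trans hy.symm))
  · rintro rfl
    exact ⟨rep c.1, rep c.2, mk_rep _, mk_rep _, rfl⟩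

/-- Sums over `A_{L' ⊕ N}` are double sums over `A_N` and `A_{L'}`. -/
theorem csum_sup (h : OrthPair b L' N) (hb : b.IsSymm) {g : V → ℂ} (hg : Periodic (L' ⊔ N) g) :
    csum (L' ⊔ N) ((dual b (L' ⊔ N) : Set V).indicator g) =
      csum N ((dual b N : Set V).indicator fun y =>
        csum L' ((dual b L' : Set V).indicator fun x => g (x + y))) := by
  have := finite_disc hb h.left
  have := finite_disc hb h.right
  have := finite_disc hb h.sup
  have := Fintype.ofFinite (disc b L')
  have := Fintype.ofFinite (disc b N)
  have := Fintype.ofFinite (disc b (L' ⊔ N))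
  simp only [← finsum_disc h.sup, ← finsum_disc h.right, ← finsum_disc h.left,
    finsum_eq_sum_of_fintype]
  rw [← (Equiv.ofBijective _ (h.discAdd_bijective hb)).sum_comp, Fintype.sum_prod_type_right]
  refine Finset.sum_congr rfl fun n _ => Finset.sum_congr rfl fun m _ => ?_
  exact hg.out_mkQ _

theorem card_disc_sup (h : OrthPair b L' N) (hb : b.IsSymm) :
    Nat.card (disc b (L' ⊔ N)) = Nat.card (disc b L') * Nat.card (disc b N) := by
  rw [← Nat.card_prod]
  exact (Nat.card_congr (Equiv.ofBijective _ (h.discAdd_bijective hb))).symm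

theorem coeff_contractTheta (h : OrthPair b L' N) (hb : b.IsSymm) (τ : ℍ)
    (v : GroupSpace (disc b (L' ⊔ N))) (m : disc b L') :
    GroupSpace.coeff m (contractTheta b L' N τ v) =
      ∑ᶠ n : disc b N, ext v (rep m + rep n) * theta (-b) N τ n := by
  classical
  have := finite_disc hb h.left
  have := finite_disc hb h.right
  have := finite_disc hb h.sup
  have := Fintype.ofFinite (disc b L')
  have := Fintype.ofFinite (disc b N)
  have := Fintype.ofFinite (disc b (L' ⊔ N))
  rw [contractTheta, GroupSpace.lift_apply, map_sum, finsum_eq_sum_of_fintype]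
  have h1 : ∀ k : disc b (L' ⊔ N), GroupSpace.coeff m (GroupSpace.coeff k v •
      ∑ᶠ (c : disc b L' × disc b N)
        (_ : ∃ x y : V, L'.mkQ x = c.1 ∧ N.mkQ y = c.2 ∧ (L' ⊔ N).mkQ (x + y) = k),
        theta (-b) N τ c.2 • GroupSpace.basis _ c.1) =
      ∑ c : disc b L' × disc b N, if h.discAdd hb c = k then
        (if c.1 = m then GroupSpace.coeff k v * theta (-b) N τ c.2 else 0) else 0 := by
    intro k
    simp only [h.over_iff hb, finsum_eq_if]
    rw [finsum_eq_sum_of_fintype, map_smul, map_sum, smul_eq_mul, Finset.mul_sum]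
    refine Finset.sum_congr rfl fun c _ => ?_
    by_cases h2 : h.discAdd hb c = k <;> by_cases h3 : c.1 = m <;>
      simp [GroupSpace.coeff_basis, h2, h3]
  rw [Finset.sum_congr rfl fun k _ => h1 k, Finset.sum_comm]
  simp only [Finset.sum_ite_eq, Finset.mem_univ, if_true]
  rw [Fintype.sum_prod_type_right]
  refine Finset.sum_congr rfl fun n _ => ?_
  rw [Finset.sum_ite_eq' , if_pos (Finset.mem_univ _), ext_of_mem v (l := h.discAdd hb (m, n)) rfl]

/-- The restriction of a function to `x + N^∨`. -/
def _root_.ThetaProduct.slice (b : LinearMap.BilinForm ℚ V) (N : Submodule ℤ V) (F : V → ℂ)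
    (x : V) : V → ℂ :=
  (dual b N : Set V).indicator fun y => F (x + y)

theorem _root_.ThetaProduct.slice_support {F : V → ℂ} {x y : V} (hy : slice b N F x y ≠ 0) :
    y ∈ dual b N :=
  Set.mem_of_indicator_ne_zero hy

theorem periodic_slice (h : OrthPair b L' N) {F : V → ℂ} (hF : Periodic (L' ⊔ N) F) (x : V) :
    Periodic N (slice b N F x) :=
  Periodic.indicator (fun y a ha => by rw [← add_assoc, hF _ _ (Submodule.mem_sup_right ha)])
    h.right.le_dual

theorem ext_contractTheta (h : OrthPair b L' N) (hb : b.IsSymm) (hneg : NegDef b N) (τ : ℍ)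
    (v : GroupSpace (disc b (L' ⊔ N))) {x : V} (hx : x ∈ dual b L') :
    ext (contractTheta b L' N τ v) x = ∑' y, slice b N (ext v) x y * gauss b τ y := by
  rw [ext_of_mem _ (l := ⟨L'.mkQ x, x, hx, rfl⟩) rfl, h.coeff_contractTheta hb,
    ← finsum_mul_theta hb h.right hneg (h.periodic_slice (periodic_ext v) x)
      fun y hy => slice_support hy]
  refine finsum_congr fun n => ?_
  rw [slice, Set.indicator_of_mem (SetLike.mem_coe.2 (rep_mem_dual h.right n))]
  congr 1
  refine ext_congr v ((Submodule.Quotient.eq _).2 ?_)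
  rw [add_sub_add_right_eq_sub]
  exact Submodule.mem_sup_left (out_sub_mem x)

/-- The Fourier transform on `A_{L'} × A_N` is carried out in two stages. With the `A_{L'}` stage
absorbed into `G`, the slice of `w` through `x` is the `A_N`-transform of `G`, and theta inversion
for `N` supplies the power of `√(-iτ)`. -/
theorem sLaw_contractTheta (h : OrthPair b L' N) (hb : b.IsSymm) (hneg : NegDef b N) {c : ℂ}
    {v w : GroupSpace (disc b (L' ⊔ N))} (hlaw : SLaw b (L' ⊔ N) c (ext v) (ext w)) (τ : ℍ) :
    SLaw b L' (c * sqrtNegI τ ^ Module.finrank ℚ (rat N)) (ext (contractTheta b L' N τ v))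
      (ext (contractTheta b L' N (ModularGroup.S • τ) w)) := by
  intro x hx
  have := finite_disc hb h.left
  have := Fintype.ofFinite (disc b L')
  let G : V → ℂ := (dual b N : Set V).indicator fun y =>
    csum L' ((dual b L' : Set V).indicator fun m => e (-(b m x)) * ext v (m + y))
  have hG : Periodic N G := by
    refine Periodic.indicator (fun y a ha => ?_) h.right.le_dual
    refine csum_congr fun m => ?_
    congr 1
    funext m
    rw [← add_assoc, periodic_ext v _ _ (Submodule.mem_sup_right ha)]
  -- Orthogonality splits the phase of `(m + n, x + y)` into those of `(m, x)` and `(n, y)`, and the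
  -- discriminant of `L' ⊕ N` is the product of the two.
  have hlaw' : SLaw b N (c / (Real.sqrt (Nat.card (disc b L')) : ℂ)) G
      (slice b N (ext w) x) := by
    intro y hy
    have hxy := (h.mem_dual_sup_iff hb (mem_dual.1 hx).1 (mem_dual.1 hy).1).2 ⟨hx, hy⟩
    rw [slice, Set.indicator_of_mem (SetLike.mem_coe.2 hy), hlaw _ hxy, FT,
      h.csum_sup hb (periodic_FT_term hb (periodic_ext v) hxy), h.card_disc_sup hb, Nat.cast_mul,
      Real.sqrt_mul (Nat.cast_nonneg _), Complex.ofReal_mul, FT, div_div]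
    congr 1
    refine csum_congr fun n => ?_
    by_cases hn : n ∈ dual b N
    swap
    · rw [Set.indicator_of_notMem (by simpa using hn), Set.indicator_of_notMem (by simpa using hn)]
    simp only [G, Set.indicator_of_mem (SetLike.mem_coe.2 hn)]
    rw [mul_csum]
    refine csum_congr fun m => ?_
    by_cases hm : m ∈ dual b L'
    swap
    · rw [Set.indicator_of_notMem (by simpa using hm), Set.indicator_of_notMem (by simpa using hm),
        mul_zero]
    rw [Set.indicator_of_mem (SetLike.mem_coe.2 hm), Set.indicator_of_mem (SetLike.mem_coe.2 hm),
      ← mul_assoc, ← e_add]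
    congr 2
    simp only [map_add, LinearMap.add_apply, h.orth m (mem_dual.1 hm).1 y (mem_dual.1 hy).1,
      h.orth' hb (mem_dual.1 hn).1 (mem_dual.1 hx).1]
    ring
  rw [h.ext_contractTheta hb hneg _ _ hx, tsum_mul_gauss_S hb h.right hneg hG
    (fun y hy => Set.mem_of_indicator_ne_zero hy) (fun y hy => slice_support hy) hlaw' τ]
  have h1 : ∀ y, G y * gauss b τ y = ∑ m : disc b L',
      e (-(b (rep m) x)) * (slice b N (ext v) (rep m) y * gauss b τ y) := by
    intro y
    by_cases hy : y ∈ dual b N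
    · simp only [G, slice, Set.indicator_of_mem (SetLike.mem_coe.2 hy)]
      rw [← finsum_disc h.left, finsum_eq_sum_of_fintype, Finset.sum_mul]
      exact Finset.sum_congr rfl fun m _ => mul_assoc _ _ _
    · have hy' : y ∉ (dual b N : Set V) := by simpa using hy
      simp only [G, slice, Set.indicator_of_notMem hy', zero_mul, mul_zero, Finset.sum_const_zero]
  rw [tsum_congr h1, Summable.tsum_finsetSum fun m _ => (summable_mul_gauss hb h.right hneg
    (h.periodic_slice (periodic_ext v) _) (fun y hy => slice_support hy) τ).mul_left _]
  rw [FT, ← finsum_disc h.left, finsum_eq_sum_of_fintype]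
  have h2 : ∀ m : disc b L',
      ∑' y, e (-(b (rep m) x)) * (slice b N (ext v) (rep m) y * gauss b τ y) =
      e (-(b (rep m) x)) * ext (contractTheta b L' N τ v) (rep m) := by
    intro m
    rw [tsum_mul_left, h.ext_contractTheta hb hneg _ _ (rep_mem_dual h.left m)]
  rw [Finset.sum_congr rfl fun m _ => h2 m]
  ring

theorem ext_contractTheta_T (h : OrthPair b L' N) (hb : b.IsSymm) (hneg : NegDef b N)
    {v w : GroupSpace (disc b (L' ⊔ N))} (hvw : ∀ z, ext w z = e (b z z / 2) * ext v z) (τ : ℍ)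
    {x : V} (hx : x ∈ dual b L') :
    ext (contractTheta b L' N (ModularGroup.T • τ) w) x =
      e (b x x / 2) * ext (contractTheta b L' N τ v) x := by
  rw [h.ext_contractTheta hb hneg _ _ hx, h.ext_contractTheta hb hneg _ _ hx, ← tsum_mul_left]
  refine tsum_congr fun y => ?_
  by_cases hy : y ∈ dual b N
  · rw [slice, slice, Set.indicator_of_mem (SetLike.mem_coe.2 hy),
      Set.indicator_of_mem (SetLike.mem_coe.2 hy), hvw, gauss_T, mul_mul_mul_comm, ← e_add,
      ← mul_assoc (e (b x x / 2)), mul_assoc (e (b x x / 2))]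
    congr 2
    simp only [map_add, LinearMap.add_apply, h.orth x (mem_dual.1 hx).1 y (mem_dual.1 hy).1,
      h.orth' hb (mem_dual.1 hy).1 (mem_dual.1 hx).1]
    ring
  · rw [slice, slice, Set.indicator_of_notMem (by simpa using hy),
      Set.indicator_of_notMem (by simpa using hy), zero_mul, zero_mul, mul_zero]

end OrthPair

end Contract

/-! ### Quasi-pullback of modular forms -/

section QuasiPullback

variable {V : Type*} [AddCommGroup V] [Module ℚ V] {b : LinearMap.BilinForm ℚ V}
  {L L' : Submodule ℤ V} {p q q' : ℕ}

theorem eq_smul_weilS (hb : b.IsSymm) (hL : IsEvenLattice b L) {c : ℂ}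
    {v w : GroupSpace (disc b L)}
    (h : SLaw b L (c * e (-(sigma b L : ℚ) / 8)) (ext v) (ext w)) : w = c • weilS b L v :=
  eq_of_ext hL fun z hz => (h z hz).trans (sLaw_weilS hb hL c v z hz).symm

theorem orthPair_orthIn (hb : b.IsSymm) (hL : IsEvenLattice b L) (hL' : IsEvenLattice b L')
    (hle : L' ≤ L) (hsig : sigPos (ratForm b L') = sigPos (ratForm b L)) :
    OrthPair b L' (orthIn b L L') where
  left := hL'
  right := (negDef_orthIn hb hL hL' hle hsig).isEvenLattice hL inf_le_left
  sup := isEvenLattice_sup_orthIn hb hL hL' hle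
  orth x hx y hy := by
    have h : b x y = b y x := hb.eq x y
    rw [h, ((mem_rat_orthIn hb).1 hy).2 x hx]

theorem sigma_add_finrank_orthIn (hb : b.IsSymm) (hL : IsEvenLattice b L)
    (hL' : IsEvenLattice b L') (hle : L' ≤ L)
    (hsig : sigPos (ratForm b L') = sigPos (ratForm b L)) :
    sigma b L + Module.finrank ℚ (rat (orthIn b L L')) = sigma b L' := by
  have h1 := sigPos_add_sigNeg hb hL
  have h2 := sigPos_add_sigNeg hb hL'
  have h3 := finrank_rat_orthIn hb hL hL' hle
  rw [sigma, sigma]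
  omega

theorem quasiPullback_apply (f : ℍ → GroupSpace (disc b L)) (τ : ℍ) :
    quasiPullback b L L' f τ = contractTheta b L' (orthIn b L L') τ
      (pullback b (L' ⊔ orthIn b L L') L (f τ)) := rfl

theorem WeaklyHolomorphic.ext {f : ℍ → GroupSpace (disc b L)} (hf : f ∈ forms b L) (z : V) :
    WeaklyHolomorphic fun τ => ext (f τ) z := by
  by_cases hz : L.mkQ z ∈ disc b L
  · simp only [ThetaProduct.ext, dif_pos hz]
    exact ⟨hf.1 _, hf.2.2 _⟩
  · simp only [ThetaProduct.ext, dif_neg hz]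
    exact WeaklyHolomorphic.const 0

/-- Pullback keeps the law of `S`, and contraction multiplies its constant by `√(-iτ)^{rank N}`;
this is the law for `L'` because `σ(L) + rank N = σ(L')`. For `T`, the phase of `x + y` times that
of the theta term is the phase of `x`. -/
theorem quasiPullback_mem_forms (hb : b.IsSymm) (hL : IsEvenLattice b L)
    (hL' : IsEvenLattice b L') (hle : L' ≤ L)
    (hsig : sigPos (ratForm b L') = sigPos (ratForm b L))
    {f : ℍ → GroupSpace (disc b L)} (hf : f ∈ forms b L) :
    quasiPullback b L L' f ∈ forms b L' := by
  have h := orthPair_orthIn hb hL hL' hle hsig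
  have hneg := negDef_orthIn hb hL hL' hle hsig
  have := finite_disc hb h.right
  have hr := rat_le_rat_sup_orthIn hb hL' hle
  have hle₁ := sup_orthIn_le (b := b) hle
  have hpull : ∀ τ z, ext (pullback b (L' ⊔ orthIn b L L') L (f τ)) z = ext (f τ) z :=
    fun τ z => ext_pullback hb h.sup hL hle₁ hr (f τ) z
  have hw : ∀ m, WeaklyHolomorphic fun τ => GroupSpace.coeff m (quasiPullback b L L' f τ) := by
    intro m
    simp only [quasiPullback_apply, h.coeff_contractTheta hb, hpull]
    exact WeaklyHolomorphic.finsum fun n => WeaklyHolomorphic.mul (WeaklyHolomorphic.ext hf _)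
      (weaklyHolomorphic_theta hb h.right hneg n)
  have hS : ∀ τ, quasiPullback b L L' f (ModularGroup.S • τ) =
      ((τ : ℂ) ^ (1 / 2 : ℂ)) ^ sigma b L' • weilS b L' (quasiPullback b L L' f τ) := by
    intro τ
    refine eq_smul_weilS hb hL' ?_
    have h1 : f (ModularGroup.S • τ) = ((τ : ℂ) ^ (1 / 2 : ℂ)) ^ sigma b L • weilS b L (f τ) :=
      hf.2.1 Mp2.S _ Weil.S τ
    have h2 := sLaw_weilS hb hL (((τ : ℂ) ^ (1 / 2 : ℂ)) ^ sigma b L) (f τ)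
    rw [← h1, cpow_half_zpow_mul_e] at h2
    have h3 := SLaw.of_le hb h.sup hL hle₁ hr (periodic_ext _) (fun x hx => ext_support hL _ hx)
      (fun x hx => ext_support hL _ hx) h2
    have h4 : SLaw b (L' ⊔ orthIn b L L') (sqrtNegI τ ^ sigma b L)
        (ext (pullback b (L' ⊔ orthIn b L L') L (f τ)))
        (ext (pullback b (L' ⊔ orthIn b L L') L (f (ModularGroup.S • τ)))) := by
      rwa [funext (hpull τ), funext (hpull _)]
    have h5 := h.sLaw_contractTheta hb hneg h4 τ
    rwa [← zpow_natCast, ← zpow_add₀ (sqrtNegI_ne_zero τ),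
      sigma_add_finrank_orthIn hb hL hL' hle hsig, ← cpow_half_zpow_mul_e] at h5
  have hT : ∀ τ, quasiPullback b L L' f (ModularGroup.T • τ) =
      weilT b L' (quasiPullback b L L' f τ) := by
    intro τ
    have h1 : f (ModularGroup.T • τ) = (1 : ℂ) ^ sigma b L • weilT b L (f τ) :=
      hf.2.1 Mp2.T _ Weil.T τ
    rw [one_zpow, one_smul] at h1
    refine eq_of_ext hL' fun x hx => ?_
    rw [ext_weilT hb hL' _ hx, quasiPullback_apply, quasiPullback_apply]
    refine h.ext_contractTheta_T hb hneg (fun z => ?_) τ hx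
    rw [hpull, hpull, h1]
    by_cases hz : z ∈ dual b L
    · exact ext_weilT hb hL _ hz
    · rw [ext_of_notMem hL _ hz, ext_of_notMem hL _ hz, mul_zero]
  refine ⟨fun m => (hw m).1, fun g R hR => ?_, fun m => (hw m).2⟩
  -- Only `S` and `T` need an argument; products are handled by the cocycle rule `φ(M'τ) φ'(τ)` of
  -- the metaplectic group.
  induction hR with
  | one =>
    intro τ
    change _ = (1 : ℂ) ^ _ • _
    rw [one_zpow, one_smul, Module.End.one_apply]
    exact congrArg _ (one_smul SL(2, ℤ) τ)
  | S => exact hS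
  | T =>
    intro τ
    change _ = (1 : ℂ) ^ _ • _
    rw [one_zpow, one_smul]
    exact hT τ
  | @mul g k P R _ _ ihg ihk =>
    intro τ
    change quasiPullback b L L' f ((g.M * k.M) • τ) = (g.phi (k.M • τ) * k.phi τ) ^ _ • P (R _)
    rw [mul_smul, ihg, ihk, map_smul, smul_smul, mul_zpow]

end QuasiPullback

/-! ### The pushforward to `K` as a sum over `I_ℚ / I` -/

section IsoSum

variable {V : Type*} [AddCommGroup V] [Module ℚ V] {b : LinearMap.BilinForm ℚ V}
  {L I : Submodule ℤ V} {p q : ℕ}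

/-- For `I = L ∩ J`, sums over `(L + J) / L` are sums over `J / I`. -/
theorem csum_sup_eq {V : Type*} [AddCommGroup V] {L I J : Submodule ℤ V}
    (hI : I = L ⊓ J) {g : V → ℂ} (hg : Periodic L g) :
    csum L (((L ⊔ J : Submodule ℤ V) : Set V).indicator g) = csum I ((J : Set V).indicator g) := by
  have hIJ : I ≤ J := hI ▸ inf_le_right
  have hIL : I ≤ L := hI ▸ inf_le_left
  rw [← finsum_out_eq_csum le_sup_left, ← finsum_out_eq_csum hIJ]
  have hout : ∀ c : J.map I.mkQ, Quotient.out (c : V ⧸ I) ∈ J := fun c => (out_mem_iff hIJ).2 c.2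
  symm
  refine finsum_eq_of_bijective (fun c : J.map I.mkQ =>
    (⟨L.mkQ (Quotient.out (c : V ⧸ I)), Submodule.mem_map_of_mem
      (Submodule.mem_sup_right (hout c))⟩ : (L ⊔ J).map L.mkQ)) ⟨fun c c' hc => ?_, ?_⟩ fun c => ?_
  · have h1 := (Submodule.Quotient.eq _).1 (congrArg Subtype.val hc)
    have h2 : Quotient.out (c : V ⧸ I) - Quotient.out (c' : V ⧸ I) ∈ I :=
      hI.ge ⟨h1, J.sub_mem (hout c) (hout c')⟩
    refine Subtype.ext ?_
    rw [← mkQ_out (c : V ⧸ I), ← mkQ_out (c' : V ⧸ I)]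
    exact (Submodule.Quotient.eq _).2 h2
  · rintro ⟨_, z, hz, rfl⟩
    obtain ⟨l, hl, j, hj, rfl⟩ := Submodule.mem_sup.1 hz
    refine ⟨⟨I.mkQ j, Submodule.mem_map_of_mem hj⟩, Subtype.ext ?_⟩
    refine (Submodule.Quotient.eq _).2 ?_
    have h1 := L.sub_mem (hIL (out_sub_mem (A := I) j)) hl
    convert h1 using 1
    simp only
    abel
  · exact (hg.out_mkQ _).symm

/-- The sum of `F` over the classes modulo `I` in `x + I_ℚ`. -/
def isoSum (I : Submodule ℤ V) (F : V → ℂ) (x : V) : ℂ :=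
  csum I ((rat I : Set V).indicator fun i => F (x + i))

theorem periodic_isoSum_term {F : V → ℂ} (hF : Periodic I F) (x : V) :
    Periodic I ((rat I : Set V).indicator fun i => F (x + i)) :=
  Periodic.indicator (B := (rat I).restrictScalars ℤ) (hF.translate x) fun _ hi => le_rat hi

theorem isoSum_add {F : V → ℂ} (hF : Periodic I F) (x : V) {j : V} (hj : j ∈ rat I) :
    isoSum I F (x + j) = isoSum I F x := by
  rw [isoSum, isoSum, ← csum_translate (periodic_isoSum_term hF x) j]
  refine csum_congr fun i => ?_
  by_cases hi : i ∈ rat I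
  · rw [Set.indicator_of_mem (SetLike.mem_coe.2 hi),
      Set.indicator_of_mem (SetLike.mem_coe.2 (Submodule.add_mem _ hj hi)), add_assoc]
  · rw [Set.indicator_of_notMem (by simpa using hi), Set.indicator_of_notMem]
    intro h
    exact hi ((Submodule.add_mem_iff_right _ hj).1 h)

/-- Primitivity gives `L ∩ I_ℚ = I`; consequently `L^* / L` is `I^* / I`. -/
theorem IsMaximalIsotropic.eq_inf_starI (hL : IsEvenLattice b L)
    (hI : IsMaximalIsotropic b L p I) : I = L ⊓ starI b L I := by
  refine le_antisymm (fun x hx => ⟨hI.le hx, mem_starI.2 ⟨le_rat hx, hL.le_dual (hI.le hx)⟩⟩) ?_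
  rintro x ⟨hx, hx'⟩
  obtain ⟨n, hn, hnx⟩ := exists_zsmul_mem (mem_starI.1 hx').1
  exact hI.primitive x hx n hn hnx

/-- Extending the sum from `I^* / I` to `I_ℚ / I` adds only zeros: for `x ∈ L^∨` and `i ∉ I^*`, `x +
i` is not in `L^∨`. If the class of `x` is outside `K^∨`, then no `x + i` is in `L^∨` and both sides
vanish. In this form the dual lattices no longer appear. -/
theorem ext_pushK_toRed (hb : b.IsSymm) (hL : IsEvenLattice b L) (hsig : HasSignature b L p q)
    (hI : IsMaximalIsotropic b L p I) (v : GroupSpace (disc b L)) (x : ratPerp b L I) :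
    ext (pushK b L I v) (toRed b L I x) = isoSum I (ext v) x := by
  have hK := isEvenLattice_red hb hL hsig hI
  have hper : Periodic I (ext v) := (periodic_ext v).mono hI.le
  by_cases hk : toRed b L I x ∈ dual (redForm b L I) (redLattice b L I)
  · obtain ⟨y, hy, hyx⟩ := exists_lift_dual_red hb hL hI hk
    rw [← hyx, ext_pushK hb hL hsig hI v hy]
    have h1 := isoSum_add hper (x : V) (toRed_eq_iff.1 hyx)
    rw [add_sub_cancel] at h1
    rw [← h1, pushFun, starL, csum_sup_eq (hI.eq_inf_starI hL) ((periodic_ext v).translate y),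
      isoSum]
    refine csum_congr fun i => ?_
    by_cases hi : i ∈ rat I
    · by_cases hi' : i ∈ dual b L
      · rw [Set.indicator_of_mem (SetLike.mem_coe.2 hi),
          Set.indicator_of_mem (SetLike.mem_coe.2 (mem_starI.2 ⟨hi, hi'⟩))]
      · rw [Set.indicator_of_mem (SetLike.mem_coe.2 hi), Set.indicator_of_notMem fun h =>
          hi' (mem_starI.1 h).2, ext_of_notMem hL]
        intro h
        exact hi' ((Submodule.add_mem_iff_right _ hy).1 h)
    · rw [Set.indicator_of_notMem fun h => hi (mem_starI.1 h).1,
        Set.indicator_of_notMem (by simpa using hi)]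
  · rw [ext_of_notMem hK _ hk, isoSum, ← csum_zero (A := I)]
    refine csum_congr fun i => ?_
    by_cases hi : i ∈ rat I
    swap
    · rw [Set.indicator_of_notMem (by simpa using hi)]
    rw [Set.indicator_of_mem (SetLike.mem_coe.2 hi), ext_of_notMem hL]
    intro h
    have hi' := hI.rat_le_ratPerp hb hi
    have h2 := toRed_mem_dual (x := x + ⟨i, hi'⟩) h
    have h3 : toRed b L I (x + ⟨i, hi'⟩) = toRed b L I x := by
      rw [toRed_eq_iff]
      simpa using hi
    exact hk (h3 ▸ h2)

theorem fg_of_le {V : Type*} [AddCommGroup V] {A B : Submodule ℤ V} (hB : B.FG)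
    (h : A ≤ B) : A.FG := by
  have := isNoetherian_of_fg_of_noetherian B hB
  exact (isNoetherian_submodule.1 this) A h

/-- A finitely generated subgroup of `I_ℚ` which contains all `i ∈ I_ℚ` with `x + i ∈ D`. -/
def shiftSupport (I D : Submodule ℤ V) (x : V) : Submodule ℤ V :=
  (rat I).restrictScalars ℤ ⊓ (D ⊔ Submodule.span ℤ {x})

theorem mem_shiftSupport {D : Submodule ℤ V} {x i : V} (hi : i ∈ rat I) (h : x + i ∈ D) :
    i ∈ shiftSupport I D x := by
  refine ⟨hi, ?_⟩
  have h1 : x + i - x ∈ D ⊔ Submodule.span ℤ {x} := Submodule.sub_mem _ (Submodule.mem_sup_left h)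
    (Submodule.mem_sup_right (Submodule.mem_span_singleton_self x))
  rwa [add_sub_cancel_left] at h1

theorem finite_map_shiftSupport {D : Submodule ℤ V} (hD : D.FG) {x : V} {I' : Submodule ℤ V}
    (hr : rat I ≤ rat I') : Finite ((shiftSupport I D x).map I'.mkQ) :=
  finite_map_mkQ (fg_of_le (hD.sup (Submodule.fg_span_singleton x)) inf_le_right)
    fun _ hy => hr hy.1

theorem le_shiftSupport {D : Submodule ℤ V} {I' : Submodule ℤ V} (x : V) (h : I' ≤ D)
    (h' : I' ≤ I) : I' ≤ shiftSupport I D x :=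
  fun _ hy => ⟨le_rat (h' hy), Submodule.mem_sup_left (h hy)⟩

/-- An `I`-periodic `F` is constant on the `|I / I'|` classes modulo `I'` inside each class modulo
`I`; this is the origin of the constant in the comparison of `ξ` and `ξ'`. -/
theorem isoSum_of_le {I' D : Submodule ℤ V} (hD : D.FG) (hle : I' ≤ I) (hr : rat I ≤ rat I')
    (hID : I' ≤ D) {F : V → ℂ} (hF : Periodic I F) (hs : ∀ z, F z ≠ 0 → z ∈ D) (x : V) :
    isoSum I' F x = Nat.card (I.map I'.mkQ) * isoSum I F x := by
  have := finite_map_shiftSupport hD (x := x) hr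
  have h1 : rat I' = rat I := le_antisymm (rat_mono hle) hr
  rw [isoSum, isoSum, h1, csum_of_periodic hle (le_shiftSupport x hID hle)
    (periodic_isoSum_term hF x)]
  intro i hi
  have h2 := Set.mem_of_indicator_ne_zero hi
  rw [Set.indicator_of_mem h2] at hi
  exact mem_shiftSupport h2 (hs _ hi)

end IsoSum

/-! ### Comparison of `ξ` and `ξ'` -/

section Comparison

variable {V : Type*} [AddCommGroup V] [Module ℚ V] {b : LinearMap.BilinForm ℚ V}
  {L L' I : Submodule ℤ V} {p q q' : ℕ}

theorem rat_inf_eq (hIL' : rat I ≤ rat L') : rat (I ⊓ L') = rat I := by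
  refine le_antisymm (rat_mono inf_le_left) (Submodule.span_le.2 fun x hx => ?_)
  obtain ⟨n, hn, hnx⟩ := exists_zsmul_mem (hIL' (le_rat hx))
  exact mem_of_zsmul_mem hn (le_rat (L := I ⊓ L') ⟨I.smul_mem n hx, hnx⟩)

/-- Since `I_ℚ ⊂ L'_ℚ`, intersecting with `L'` does not change the rational span of `I`, so the rank
is still `p`. -/
theorem IsMaximalIsotropic.inf (hL : IsEvenLattice b L) (hle : L' ≤ L)
    (hI : IsMaximalIsotropic b L p I) (hIL' : rat I ≤ rat L') :
    IsMaximalIsotropic b L' p (I ⊓ L') where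
  le := inf_le_right
  isotropic x hx y hy := hI.isotropic x hx.1 y hy.1
  primitive x hx n hn hnx := ⟨hI.primitive x (hle hx) n hn hnx.1, hx⟩
  rank := by
    have hfg := hI.fg hL
    rw [← finrank_rat (fg_of_le hfg inf_le_left), rat_inf_eq hIL', finrank_rat hfg, hI.rank]

theorem card_map_mkQ {V : Type*} [AddCommGroup V] (A B : Submodule ℤ V) :
    Nat.card (B.map A.mkQ) = Nat.card (B ⧸ A.submoduleOf B) := by
  let φ : B →ₗ[ℤ] V ⧸ A := A.mkQ ∘ₗ B.subtype
  have h1 : LinearMap.range φ = B.map A.mkQ := by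
    rw [LinearMap.range_comp, Submodule.range_subtype]
  have h2 : LinearMap.ker φ = A.submoduleOf B := by
    rw [LinearMap.ker_comp, Submodule.ker_mkQ]
    rfl
  rw [← h1, ← h2]
  exact (Nat.card_congr φ.quotKerEquivRange.toEquiv).symm

/-- The formula is needed on all of `L'_ℚ`: if `z ∉ L'^∨`, then `z + y ∉ L^∨` for every `y ∈ N_ℚ`,
so both sides are `0`. -/
theorem ext_quasiPullback (hb : b.IsSymm) (hL : IsEvenLattice b L) (hL' : IsEvenLattice b L')
    (hle : L' ≤ L) (hsig : sigPos (ratForm b L') = sigPos (ratForm b L))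
    (f : ℍ → GroupSpace (disc b L)) (τ : ℍ) {z : V} (hz : z ∈ rat L') :
    ext (quasiPullback b L L' f τ) z =
      ∑' y, slice b (orthIn b L L') (ext (f τ)) z y * gauss b τ y := by
  have h := orthPair_orthIn hb hL hL' hle hsig
  have hr := rat_le_rat_sup_orthIn hb hL' hle
  have hle₁ := sup_orthIn_le (b := b) hle
  by_cases hz' : z ∈ dual b L'
  · rw [quasiPullback_apply, h.ext_contractTheta hb (negDef_orthIn hb hL hL' hle hsig) _ _ hz',
      funext (ext_pullback hb h.sup hL hle₁ hr (f τ))]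
  · rw [ext_of_notMem hL' _ hz']
    symm
    refine (tsum_congr fun y => ?_).trans tsum_zero
    by_cases hy : y ∈ dual b (orthIn b L L')
    · rw [slice, Set.indicator_of_mem (SetLike.mem_coe.2 hy), ext_of_notMem hL, zero_mul]
      intro h1
      exact hz' ((h.mem_dual_sup_iff hb hz (mem_dual.1 hy).1).1 (dual_anti hle₁ hr h1)).1
    · rw [slice, Set.indicator_of_notMem (by simpa using hy), zero_mul]

/-- The sum over `I_ℚ / I'` of the quasi-pullback, as a theta series of `N`. -/
theorem isoSum_quasiPullback (hb : b.IsSymm) (hL : IsEvenLattice b L) (hL' : IsEvenLattice b L')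
    (hle : L' ≤ L) (hsig : sigPos (ratForm b L') = sigPos (ratForm b L))
    (hI : IsMaximalIsotropic b L p I) (hIL' : rat I ≤ rat L')
    (f : ℍ → GroupSpace (disc b L)) (τ : ℍ) {x : V} (hx : x ∈ rat L') :
    isoSum (I ⊓ L') (ext (quasiPullback b L L' f τ)) x =
      ∑' y : rat (orthIn b L L'), Nat.card (I.map (I ⊓ L').mkQ) *
        isoSum I (ext (f τ)) (x + y) * gauss b τ y := by
  have h := orthPair_orthIn hb hL hL' hle hsig
  have hneg := negDef_orthIn hb hL hL' hle hsig
  have hr := rat_le_rat_sup_orthIn hb hL' hle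
  have hle₁ := sup_orthIn_le (b := b) hle
  have hI' := rat_inf_eq hIL'
  -- Whatever `y ∈ N_ℚ`, the condition `x + i + y ∈ L^∨` forces `x + i ∈ L'^∨`, hence `i ∈ C`. The
  -- sum over `I_ℚ / I'` is thus over the finite group `C / I'`, uniformly in `y`, and may be
  -- exchanged with the sum over `N`.
  set C := shiftSupport (I ⊓ L') (dual b L') x with hC
  have hle' : I ⊓ L' ≤ C := le_shiftSupport x (inf_le_right.trans hL'.le_dual) le_rfl
  have hfin : Finite (C.map (I ⊓ L').mkQ) := finite_map_shiftSupport (dual_fg hb hL') le_rfl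
  have := Fintype.ofFinite (C.map (I ⊓ L').mkQ)
  have hout : ∀ c : C.map (I ⊓ L').mkQ, x + Quotient.out (c : V ⧸ I ⊓ L') ∈ rat L' := fun c =>
    Submodule.add_mem _ hx (rat_mono inf_le_right ((out_mem_iff hle').2 c.2).1)
  have h1 : ∀ F : V → ℂ, (∀ i, i ∈ rat (I ⊓ L') → i ∉ C → F i = 0) →
      csum (I ⊓ L') ((rat (I ⊓ L') : Set V).indicator F) =
        ∑ c : C.map (I ⊓ L').mkQ, F (Quotient.out (c : V ⧸ I ⊓ L')) := by
    intro F hF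
    rw [← finsum_eq_sum_of_fintype, finsum_out_eq_csum hle']
    refine csum_congr fun i => ?_
    by_cases hi : i ∈ rat (I ⊓ L')
    · rw [Set.indicator_of_mem (SetLike.mem_coe.2 hi)]
      by_cases hiC : i ∈ C
      · rw [Set.indicator_of_mem (SetLike.mem_coe.2 hiC)]
      · rw [Set.indicator_of_notMem (by simpa using hiC), hF i hi hiC]
    · rw [Set.indicator_of_notMem (by simpa using hi), Set.indicator_of_notMem fun h => hi h.1]
  rw [isoSum, h1 _ fun i hi hiC => ext_of_notMem hL' _ fun h2 => hiC (mem_shiftSupport hi h2),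
    Finset.sum_congr rfl fun c _ => ext_quasiPullback hb hL hL' hle hsig f τ (hout c),
    ← Summable.tsum_finsetSum fun c _ => summable_mul_gauss hb h.right hneg
      (h.periodic_slice ((periodic_ext (f τ)).mono hle₁) _) (fun y hy => slice_support hy) τ]
  have h2 := tsum_subtype (rat (orthIn b L L') : Set V) fun y => Nat.card (I.map (I ⊓ L').mkQ) *
        isoSum I (ext (f τ)) (x + y) * gauss b τ y
  refine Eq.trans (tsum_congr fun y => ?_) h2.symm
  by_cases hy : y ∈ rat (orthIn b L L')
  swap
  · rw [Set.indicator_of_notMem (by simpa using hy)]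
    refine Finset.sum_eq_zero fun c _ => ?_
    rw [slice, Set.indicator_of_notMem fun h => hy (mem_dual.1 h).1, zero_mul]
  have h3 : ∀ z ∈ rat L', slice b (orthIn b L L') (ext (f τ)) z y = ext (f τ) (z + y) := by
    intro z hz
    by_cases hy' : y ∈ dual b (orthIn b L L')
    · rw [slice, Set.indicator_of_mem (SetLike.mem_coe.2 hy')]
    · rw [slice, Set.indicator_of_notMem (by simpa using hy'), ext_of_notMem hL]
      intro h4
      exact hy' ((h.mem_dual_sup_iff hb hz hy).1 (dual_anti hle₁ hr h4)).2
  -- On the other side, `|I / I'|` times the sum over `I_ℚ / I` is rewritten as a sum over `I_ℚ /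
  -- I'`.
  rw [Set.indicator_of_mem (SetLike.mem_coe.2 hy), ← Finset.sum_mul,
    Finset.sum_congr rfl fun c _ => h3 _ (hout c),
    ← isoSum_of_le (dual_fg hb hL) inf_le_left hI'.ge (inf_le_left.trans (hI.le.trans hL.le_dual))
      ((periodic_ext (f τ)).mono hI.le) fun z hz => ext_support hL _ hz, isoSum,
    h1 _ fun i hi hiC => ext_of_notMem hL _ fun h4 => hiC ?_]
  · simp only [add_right_comm]
  · rw [add_right_comm] at h4
    exact mem_shiftSupport hi ((h.mem_dual_sup_iff hb (Submodule.add_mem _ hx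
      (rat_mono inf_le_right hi)) hy).1 (dual_anti hle₁ hr h4)).1

/-- Because `I_ℚ ⊂ L'_ℚ`, the space `N_ℚ` is orthogonal to `I` and `K_ℚ = K'_ℚ ⊕ N_ℚ`, with `(k, k)`
additive. Splitting the sum for `ξ(f)` accordingly, the sum over `N_ℚ` is the one in
`isoSum_quasiPullback`, and the sum over `K'_ℚ` is `ξ'`. -/
theorem xi_quasiPullback (hb : b.IsSymm) (hL : IsEvenLattice b L) (hLsig : HasSignature b L p q)
    (hL' : IsEvenLattice b L') (hL'sig : HasSignature b L' p q') (hle : L' ≤ L)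
    (hI : IsMaximalIsotropic b L p I) (hIL' : rat I ≤ rat L')
    (f : ℍ → GroupSpace (disc b L)) (τ : ℍ) :
    xi b L' (I ⊓ L') (quasiPullback b L L' f) τ =
      Nat.card (I.map (I ⊓ L').mkQ) * xi b L I f τ := by
  have hsig : sigPos (ratForm b L') = sigPos (ratForm b L) := hL'sig.1.trans hLsig.1.symm
  have hImax := hI.inf hL hle hIL'
  have h := orthPair_orthIn hb hL hL' hle hsig
  have hI' := rat_inf_eq hIL'
  have hK := isEvenLattice_red hb hL hLsig hI
  -- A set-theoretic section suffices: another choice of `r k` differs by `I_ℚ`, which affects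
  -- neither the form nor the sums over `I_ℚ / I`.
  obtain ⟨r, hr⟩ := (Submodule.mkQ_surjective (ratIn b L' (I ⊓ L'))).hasRightInverse
  have hrL : ∀ k, (r k : V) ∈ rat L' := fun k => ((mem_ratPerp hb).1 (r k).2).1
  have hmem : ∀ (k : redSpace b L' (I ⊓ L')) (y : rat (orthIn b L L')),
      (r k : V) + y ∈ ratPerp b L I := by
    intro k y
    have h1 := (mem_ratPerp hb).1 (r k).2
    have h2 := (mem_rat_orthIn hb).1 y.2
    refine (mem_ratPerp hb).2 ⟨Submodule.add_mem _ (rat_mono hle h1.1) h2.1, fun i hi => ?_⟩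
    rw [map_add, LinearMap.add_apply, h1.2 i (hI'.symm ▸ hi), h2.2 i (hIL' hi), add_zero]
  -- The splitting `K'_ℚ ⊕ N_ℚ → K_ℚ`; injectivity uses `L'_ℚ ∩ N_ℚ = 0`, and surjectivity the
  -- decomposition `L_ℚ = L'_ℚ + N_ℚ`.
  let Ψ : redSpace b L' (I ⊓ L') × rat (orthIn b L L') → redSpace b L I := fun c =>
    toRed b L I ⟨(r c.1 : V) + c.2, hmem c.1 c.2⟩
  have hΨ : Function.Bijective Ψ := by
    constructor
    · rintro ⟨k, y⟩ ⟨k', y'⟩ hk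
      have h1 : ((r k : V) + y) - (r k' + y') ∈ rat I := toRed_eq_iff.1 hk
      have h2 : (y : V) - y' = 0 := by
        refine h.eq_zero ?_ (Submodule.sub_mem _ y.2 y'.2)
        have h3 := Submodule.sub_mem _ (hIL' h1) (Submodule.sub_mem _ (hrL k) (hrL k'))
        convert h3 using 1
        abel
      have h3 : (r k : V) - r k' ∈ rat (I ⊓ L') := by
        rw [hI']
        rwa [add_sub_add_comm, h2, add_zero] at h1
      refine Prod.ext ?_ (Subtype.ext (sub_eq_zero.1 h2))
      rw [← hr k, ← hr k']
      exact toRed_eq_iff.2 h3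
    · intro k
      obtain ⟨z, rfl⟩ := Submodule.mkQ_surjective (ratIn b L I) k
      have hz := (mem_ratPerp hb).1 z.2
      obtain ⟨x, hx, y, hy, hxy⟩ := exists_add_of_mem_rat hb hL' hle hz.1
      have hxp : x ∈ ratPerp b L' (I ⊓ L') := by
        refine (mem_ratPerp hb).2 ⟨hx, fun i hi => ?_⟩
        rw [hI'] at hi
        have h1 := hz.2 i hi
        rwa [← hxy, map_add, LinearMap.add_apply,
          ((mem_rat_orthIn hb).1 hy).2 i (hIL' hi), add_zero] at h1
      refine ⟨(toRed b L' (I ⊓ L') ⟨x, hxp⟩, ⟨y, hy⟩), toRed_eq_iff.2 ?_⟩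
      have h1 := toRed_eq_iff.1 (hr (toRed b L' (I ⊓ L') ⟨x, hxp⟩))
      rw [hI'] at h1
      change (r (toRed b L' (I ⊓ L') ⟨x, hxp⟩) : V) + y - z ∈ rat I
      rw [← hxy, add_sub_add_right_eq_sub]
      exact h1
  have hgauss : ∀ c, gauss (redForm b L I) τ (Ψ c) =
      gauss (redForm b L' (I ⊓ L')) τ c.1 * gauss b τ c.2 := by
    rintro ⟨k, y⟩
    rw [gauss_eq_exp, gauss_eq_exp, gauss_eq_exp, ← Complex.exp_add]
    congr 1
    have h1 : redForm b L' (I ⊓ L') k k = b (r k) (r k) := by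
      conv_lhs => rw [← hr k]
      rfl
    have h2 : redForm b L I (Ψ (k, y)) (Ψ (k, y)) = b (r k + y) (r k + y) := rfl
    rw [h1, h2]
    simp only [map_add, LinearMap.add_apply, h.orth _ (hrL k) y y.2, h.orth' hb y.2 (hrL k)]
    push_cast
    ring
  have hsum := summable_mul_gauss (redForm_isSymm hb) hK (negDef_red hb hL hLsig hI)
    (periodic_ext (pushK b L I (f τ))) (fun y hy => ext_support hK _ hy) τ
  have h1 : xi b L I f τ = ∑' k, ∑' y, ext (pushK b L I (f τ)) (Ψ (k, y)) *
      gauss (redForm b L I) τ (Ψ (k, y)) := by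
    rw [xi_apply hb hL hLsig hI]
    exact ((Equiv.ofBijective Ψ hΨ).tsum_eq fun k => ext (pushK b L I (f τ)) k *
      gauss (redForm b L I) τ k).symm.trans
        (((Equiv.ofBijective Ψ hΨ).summable_iff.2 hsum).tsum_prod)
  rw [h1, xi_apply hb hL' hL'sig hImax, ← tsum_mul_left]
  refine tsum_congr fun k => ?_
  have h2 : ext (pushK b L' (I ⊓ L') (quasiPullback b L L' f τ)) k =
      isoSum (I ⊓ L') (ext (quasiPullback b L L' f τ)) (r k) := by
    conv_lhs => rw [← hr k]
    exact ext_pushK_toRed hb hL' hL'sig hImax _ _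
  rw [h2, isoSum_quasiPullback hb hL hL' hle hsig hI hIL' f τ (hrL k), ← tsum_mul_left,
    ← tsum_mul_right]
  refine tsum_congr fun y => ?_
  rw [hgauss, ext_pushK_toRed hb hL hLsig hI]
  ring

end Comparison

/-! ### The `Θ`-product and its left annihilator -/

section ThetaProd

variable {V : Type*} [AddCommGroup V] [Module ℚ V] {b : LinearMap.BilinForm ℚ V}
  {L I : Submodule ℤ V} {p q : ℕ}

theorem smul_mem_forms {h : ℍ → ℂ} (hh : h ∈ scalarForms) {f : ℍ → GroupSpace (disc b L)}
    (hf : f ∈ forms b L) : (fun τ => h τ • f τ) ∈ forms b L := by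
  refine ⟨fun l => ?_, fun g R hR τ => ?_, fun l => ?_⟩
  · simp only [map_smul, smul_eq_mul]
    exact hh.1.mul (hf.1 l)
  · simp only [map_smul]
    rw [hh.2.1, hf.2.1 g R hR, smul_comm]
  · simp only [map_smul, smul_eq_mul]
    exact hh.2.2.mul (hf.2.2 l)

/-- Multiplication of vector-valued modular forms by scalar-valued ones. -/
def formsSMul (b : LinearMap.BilinForm ℚ V) (L : Submodule ℤ V) :
    scalarForms →ₗ[ℂ] forms b L →ₗ[ℂ] forms b L :=
  LinearMap.mk₂ ℂ (fun h f => ⟨fun τ => (h : ℍ → ℂ) τ • (f : ℍ → GroupSpace (disc b L)) τ,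
      smul_mem_forms h.2 f.2⟩)
    (fun _ _ _ => Subtype.ext (funext fun _ => add_smul _ _ _))
    (fun _ _ _ => Subtype.ext (funext fun _ => mul_smul _ _ _))
    (fun _ _ _ => Subtype.ext (funext fun _ => smul_add _ _ _))
    (fun c h f => Subtype.ext (funext fun τ =>
      smul_comm ((h : ℍ → ℂ) τ) c ((f : ℍ → GroupSpace (disc b L)) τ)))

theorem coe_formsSMul (h : scalarForms) (f : forms b L) :
    (formsSMul b L h f : ℍ → GroupSpace (disc b L)) =
      fun τ => (h : ℍ → ℂ) τ • (f : ℍ → GroupSpace (disc b L)) τ := rfl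

theorem xi_smul_apply (h : ℍ → ℂ) (f : ℍ → GroupSpace (disc b L)) (τ : ℍ) :
    xi b L I (fun τ => h τ • f τ) τ = h τ * xi b L I f τ := by
  rw [xi_apply_eq, xi_apply_eq, map_smul, map_smul, smul_eq_mul]

theorem exists_xi (hb : b.IsSymm) (hL : IsEvenLattice b L) (hsig : HasSignature b L p q)
    (hI : IsMaximalIsotropic b L p I) :
    ∃ ξ : forms b L →ₗ[ℂ] scalarForms, ∀ f, (ξ f : ℍ → ℂ) = xi b L I f :=
  ⟨{ toFun := fun f => ⟨xi b L I f, xi_mem_scalarForms hb hL hsig hI f.2⟩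
     map_add' := fun _ _ => Subtype.ext (map_add _ _ _)
     map_smul' := fun _ _ => Subtype.ext (map_smul _ _ _) }, fun _ => rfl⟩

/-- Testing against `g = f` is enough: applying `ξ` to `ξ(f) f = 0` gives `ξ(f)² = 0` at every
point. -/
theorem mem_leftAnn_iff {f : forms b L} : f ∈ leftAnn b L I ↔ xi b L I f = 0 := by
  refine ⟨fun hf => funext fun τ => ?_, fun hf g => funext fun τ => ?_⟩
  · have h1 : thetaMul b L I f f = 0 := hf f
    have h2 := xi_smul_apply (I := I) (xi b L I f) (f : ℍ → GroupSpace (disc b L)) τ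
    have h3 : (fun τ => xi b L I f τ • (f : ℍ → GroupSpace (disc b L)) τ) = 0 := h1
    rw [h3, map_zero, Pi.zero_apply, zero_eq_mul_self] at h2
    exact h2
  · simp [thetaMul, hf]

theorem leftAnn_eq_ker {ξ : forms b L →ₗ[ℂ] scalarForms} (hξ : ∀ f, (ξ f : ℍ → ℂ) = xi b L I f) :
    leftAnn b L I = LinearMap.ker ξ := by
  ext f
  rw [mem_leftAnn_iff, LinearMap.mem_ker, ← hξ]
  exact ZeroMemClass.coe_eq_zero

/-- With `h = ξ(f)` this is the multiplicativity of `ξ` for the `Θ`-product; with arbitrary `h` it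
makes the image of `ξ` an ideal. -/
theorem xi_formsSMul {ξ : forms b L →ₗ[ℂ] scalarForms}
    (hξ : ∀ f, (ξ f : ℍ → ℂ) = xi b L I f) (h : scalarForms) (f : forms b L) :
    ξ (formsSMul b L h f) = h * ξ f := by
  refine Subtype.ext (funext fun τ => ?_)
  rw [hξ, coe_formsSMul, xi_smul_apply, ← hξ, Subalgebra.coe_mul, Pi.mul_apply]

/-- The image of `ξ` is an ideal. -/
theorem exists_ideal_range {ξ : forms b L →ₗ[ℂ] scalarForms}
    (hξ : ∀ f, (ξ f : ℍ → ℂ) = xi b L I f) :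
    ∃ a : Ideal scalarForms, (a : Set scalarForms) = Set.range ξ :=
  ⟨{ carrier := Set.range ξ
     add_mem' := by
       rintro _ _ ⟨f, rfl⟩ ⟨g, rfl⟩
       exact ⟨f + g, map_add _ _ _⟩
     zero_mem' := ⟨0, map_zero _⟩
     smul_mem' := by
       rintro h _ ⟨f, rfl⟩
       exact ⟨formsSMul b L h f, xi_formsSMul hξ h f⟩ }, rfl⟩

end ThetaProd

/-- Linear maps `ξ`, `ξ'` onto ideals which are compatible, up to a factor `d`, with a map `res`
identify the induced map of the quotients by their kernels with the inclusion of ideals. -/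
theorem exists_quotient_maps {M M' R : Type*} [AddCommGroup M] [Module ℂ M] [AddCommGroup M']
    [Module ℂ M'] [CommRing R] [Algebra ℂ R] {A : Submodule ℂ M} {A' : Submodule ℂ M'}
    {ξ : M →ₗ[ℂ] R} {ξ' : M' →ₗ[ℂ] R} {res : M →ₗ[ℂ] M'} {mul : M →ₗ[ℂ] M →ₗ[ℂ] M}
    {mul' : M' →ₗ[ℂ] M' →ₗ[ℂ] M'} {d : ℂ} {a a' : Ideal R} (hA : A = LinearMap.ker ξ)
    (hA' : A' = LinearMap.ker ξ') (hd : d ≠ 0) (hres : ∀ f, ξ' (res f) = d • ξ f)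
    (hmul : ∀ f g, ξ (mul f g) = ξ f * ξ g) (hmul' : ∀ f g, ξ' (mul' f g) = ξ' f * ξ' g)
    (ha : (a : Set R) = Set.range ξ) (ha' : (a' : Set R) = Set.range ξ') :
    A'.comap res = A ∧ LinearMap.ker res ≤ A ∧
      ∃ (ι : (M ⧸ A) →ₗ[ℂ] R) (ι' : (M' ⧸ A') →ₗ[ℂ] R) (ind : (M ⧸ A) →ₗ[ℂ] (M' ⧸ A')),
        (∀ f, ι (Submodule.Quotient.mk f) = ξ f) ∧
        (∀ f, ι' (Submodule.Quotient.mk f) = ξ' f) ∧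
        (∀ f, ind (Submodule.Quotient.mk f) = Submodule.Quotient.mk (d⁻¹ • res f)) ∧
        Function.Injective ι ∧ Function.Injective ι' ∧
        (∀ f g, ι (Submodule.Quotient.mk (mul f g)) =
          ι (Submodule.Quotient.mk f) * ι (Submodule.Quotient.mk g)) ∧
        (∀ f g, ι' (Submodule.Quotient.mk (mul' f g)) =
          ι' (Submodule.Quotient.mk f) * ι' (Submodule.Quotient.mk g)) ∧
        ∃ a a' : Ideal R, (a : Set R) = Set.range ι ∧ (a' : Set R) = Set.range ι' ∧
          a ≤ a' ∧ ∀ x, ι' (ind x) = ι x := by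
  -- The annihilators are kernels, and `ξ' ∘ res = d ξ` with `d ≠ 0`.
  have hcomap : A'.comap res = A := by
    ext f
    rw [Submodule.mem_comap, hA, hA', LinearMap.mem_ker, LinearMap.mem_ker, hres,
      smul_eq_zero_iff_right hd]
  refine ⟨hcomap, fun f hf => ?_, A.liftQ ξ hA.le, A'.liftQ ξ' hA'.le,
    A.mapQ A' (d⁻¹ • res) fun f hf => ?_, fun f => rfl, fun f => rfl, fun f => rfl,
    LinearMap.ker_eq_bot.1 (Submodule.ker_liftQ_eq_bot _ _ _ hA.ge),
    LinearMap.ker_eq_bot.1 (Submodule.ker_liftQ_eq_bot _ _ _ hA'.ge), hmul, hmul', a, a', ?_, ?_,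
    fun x hx => ?_, fun x => ?_⟩
  · rw [← hcomap, Submodule.mem_comap, LinearMap.mem_ker.1 hf]
    exact A'.zero_mem
  · rw [← hcomap] at hf
    exact A'.smul_mem _ hf
  · rw [ha, ← LinearMap.coe_range, ← LinearMap.coe_range, Submodule.range_liftQ]
  · rw [ha', ← LinearMap.coe_range, ← LinearMap.coe_range, Submodule.range_liftQ]
  · rw [← SetLike.mem_coe, ha] at hx
    obtain ⟨f, rfl⟩ := hx
    rw [← SetLike.mem_coe, ha']
    -- The same vector that defines the induced map shows that each value `ξ f` is a value of `ξ'`.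
    refine ⟨d⁻¹ • res f, ?_⟩
    rw [map_smul, hres, inv_smul_smul₀ hd]
  · obtain ⟨f, rfl⟩ := Submodule.Quotient.mk_surjective _ x
    change ξ' (d⁻¹ • res f) = ξ f
    rw [map_smul, hres, inv_smul_smul₀ hd]

end ThetaProduct

end

/-- `L` is an even lattice of signature `(p, q)`, `L' ⊂ L` a sublattice of signature `(p, q')`, `I` a
maximal isotropic sublattice of `L` with `I_ℚ ⊂ L'_ℚ`, and `I' = I ∩ L'`. -/
theorem mainTheorem6 {V : Type*} [AddCommGroup V] [Module ℚ V]
    (b : LinearMap.BilinForm ℚ V) (hb : b.IsSymm)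
    (L L' I : Submodule ℤ V) (p q q' : ℕ)
    (hL : IsEvenLattice b L) (hLsig : HasSignature b L p q)
    (hL' : IsEvenLattice b L') (hL'sig : HasSignature b L' p q') (hLL' : L' ≤ L)
    (hI : IsMaximalIsotropic b L p I) (hIL' : rat I ≤ rat L') :
    -- `M^! = ℂ[j]` is a polynomial ring
    (∃ e : Polynomial ℂ ≃ₐ[ℂ] scalarForms, (e Polynomial.X : ℍ → ℂ) = jFun) ∧
    -- quasi-pullback, the maps `ξ`, `ξ'` and the `Θ`-products are well-defined on `M^!(L)`, `M^!(L')`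
    ∃ (res : forms b L →ₗ[ℂ] forms b L')
      (ξ : forms b L →ₗ[ℂ] scalarForms) (ξ' : forms b L' →ₗ[ℂ] scalarForms)
      (mul : forms b L →ₗ[ℂ] forms b L →ₗ[ℂ] forms b L)
      (mul' : forms b L' →ₗ[ℂ] forms b L' →ₗ[ℂ] forms b L'),
      (∀ f, (res f : ℍ → GroupSpace (disc b L')) = quasiPullback b L L' f) ∧
      (∀ f, (ξ f : ℍ → ℂ) = xi b L I f) ∧
      (∀ f, (ξ' f : ℍ → ℂ) = xi b L' (I ⊓ L') f) ∧
      (∀ f g, (mul f g : ℍ → GroupSpace (disc b L)) = thetaMul b L I f g) ∧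
      (∀ f g, (mul' f g : ℍ → GroupSpace (disc b L')) = thetaMul b L' (I ⊓ L') f g) ∧
      -- quasi-pullback pulls back the left annihilator exactly
      (leftAnn b L' (I ⊓ L')).comap res = leftAnn b L I ∧
      LinearMap.ker res ≤ leftAnn b L I ∧
      -- `ξ`, `ξ'` and `|I/I'|⁻¹ · |_{L'}` descend to the quotients by the left annihilators
      ∃ (ι : (forms b L ⧸ leftAnn b L I) →ₗ[ℂ] scalarForms)
        (ι' : (forms b L' ⧸ leftAnn b L' (I ⊓ L')) →ₗ[ℂ] scalarForms)
        (ind : (forms b L ⧸ leftAnn b L I) →ₗ[ℂ] (forms b L' ⧸ leftAnn b L' (I ⊓ L'))),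
        (∀ f, ι (Submodule.Quotient.mk f) = ξ f) ∧
        (∀ f, ι' (Submodule.Quotient.mk f) = ξ' f) ∧
        (∀ f, ind (Submodule.Quotient.mk f) =
          Submodule.Quotient.mk
            (((Nat.card (I ⧸ (I ⊓ L').submoduleOf I) : ℂ))⁻¹ • res f)) ∧
        -- they identify the quotient rings with ideals `a`, `a'` of `M^!`, ...
        Function.Injective ι ∧ Function.Injective ι' ∧
        (∀ f g, ι (Submodule.Quotient.mk (mul f g)) =
          ι (Submodule.Quotient.mk f) * ι (Submodule.Quotient.mk g)) ∧
        (∀ f g, ι' (Submodule.Quotient.mk (mul' f g)) =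
          ι' (Submodule.Quotient.mk f) * ι' (Submodule.Quotient.mk g)) ∧
        ∃ a a' : Ideal scalarForms,
          (a : Set scalarForms) = Set.range ι ∧ (a' : Set scalarForms) = Set.range ι' ∧
          -- ... and the induced map with the inclusion `a ⊂ a'`
          a ≤ a' ∧ ∀ x, ι' (ind x) = ι x := by
  refine ⟨exists_algEquiv_scalarForms, ?_⟩
  -- `L` and `L'` share the positive index `p`; this is what makes `N` negative definite.
  have hsig : sigPos (ratForm b L') = sigPos (ratForm b L) := hL'sig.1.trans hLsig.1.symm
  obtain ⟨ξ, hξ⟩ := exists_xi hb hL hLsig hI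
  obtain ⟨ξ', hξ'⟩ := exists_xi hb hL' hL'sig (hI.inf hL hLL' hIL')
  let res : forms b L →ₗ[ℂ] forms b L' :=
    { toFun := fun f => ⟨quasiPullback b L L' f,
        quasiPullback_mem_forms hb hL hL' hLL' hsig f.2⟩
      map_add' := fun _ _ => Subtype.ext (map_add _ _ _)
      map_smul' := fun _ _ => Subtype.ext (map_smul _ _ _) }
  -- `I` and `I'` have the same rational span, so the index is finite and `Nat.card` does not take
  -- its default value `0`.
  have hd : (Nat.card (I ⧸ (I ⊓ L').submoduleOf I) : ℂ) ≠ 0 := by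
    have hfin : Finite (I.map (I ⊓ L').mkQ) :=
      finite_map_mkQ (hI.fg hL) fun x hx => (rat_inf_eq hIL').ge (le_rat hx)
    rw [← card_map_mkQ]
    exact_mod_cast Nat.card_pos.ne'
  have hcomp : ∀ f, ξ' (res f) = (Nat.card (I ⧸ (I ⊓ L').submoduleOf I) : ℂ) • ξ f := by
    intro f
    refine Subtype.ext (funext fun τ => ?_)
    rw [hξ']
    refine (xi_quasiPullback hb hL hLsig hL' hL'sig hLL' hI hIL' f τ).trans ?_
    rw [card_map_mkQ, ← hξ]
    rfl
  obtain ⟨a, ha⟩ := exists_ideal_range hξ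
  obtain ⟨a', ha'⟩ := exists_ideal_range hξ'
  refine ⟨res, ξ, ξ', formsSMul b L ∘ₗ ξ, formsSMul b L' ∘ₗ ξ', fun f => rfl, hξ, hξ',
    fun f g => ?_, fun f g => ?_, exists_quotient_maps (leftAnn_eq_ker hξ) (leftAnn_eq_ker hξ') hd
      hcomp (fun f g => xi_formsSMul hξ (ξ f) g) (fun f g => xi_formsSMul hξ' (ξ' f) g) ha ha'⟩
  · rw [LinearMap.comp_apply, coe_formsSMul, hξ]
    rfl
  · rw [LinearMap.comp_apply, coe_formsSMul, hξ']
    rfl
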